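/- **Setting.** Let $M$ be a smooth manifold of dimension $d+1$ ($d\ge 1$), $U\subset M$ an open subregion, $\mathcal N$ a smooth hypersurface embedded in $M$ and contained in $\partial U$, and $\partial\Sigma\subset\mathcal N$ a closed (compact, boundaryless) oriented embedded $(d-1)$-dimensional surface. The fields $\phi$ are a multiplet of tensor fields on $M$ (e.g. the metric and matter fields) ranging over a field space $\mathscr F$ that is open in a space of tensor multiplets (the variations) stable under Lie derivatives and under multiplication by smooth functions. $\delta$ is the exterior derivative on $\mathscr F$, $I_V$ contraction with a vector field $V$ on $\mathscr F$, and $L_V=I_V\delta+\delta I_V$; $d$, $i_\xi$, $\pounds_\xi=i_\xi d+d\,i_\xi$ are the spacetime operations. A field-dependent vector field $\xi$ on $M$ defines the vector field $\hat\xi$ on $\mathscr F$ by $I_{\hat\xi}\delta\phi=\pounds_\xi\phi$. The anomaly operator is $\Delta_{\hat\xi}=L_{\hat\xi}-\pounds_\xi-I_{\widehat{\delta\xi}}$, where $I_{\widehat{\delta\xi}}\delta\phi=\pounds_{\delta\xi}\phi$, and on field-dependent vector fields $\Delta_{\hat\xi}\zeta=I_{\hat\xi}\delta\zeta-[\xi,\zeta]$.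 The modified Lie bracket is $$[\![\xi,\zeta]\!]=[\xi,\zeta]-I_{\hat\xi}\delta\zeta+I_{\hat\zeta}\delta\xi .$$ **Theory.** Let $L'$ be a smooth Lagrangian ($(d+1)$-form) with $\delta L'=E\cdot\delta\phi+d\theta'$, where $E\cdot\delta\phi$ is $C^\infty(M)$-linear in $\delta\phi$, and let $b'$, $\lambda'$ satisfy, for all smooth field-dependent $\xi$, $$\Delta_{\hat\xi}L'=d\Delta_{\hat\xi}b',\qquad \Delta_{\hat\xi}\theta'=\Delta_{\hat\xi}\delta b'+d\Delta_{\hat\xi}\lambda'.$$ The solution space $\mathscr S$ is the set of $\phi\in\mathscr F$ with $E=0$ in $U$. Let $Q^{vc}_\xi$ be a Noether potential: a smooth $(d-1)$-form-valued functional of $\phi$ and $\xi$, linear in $\xi$, with $\Delta_{\hat\xi}Q^{vc}_\zeta=Q^{vc}_{\Delta_{\hat\xi}\zeta}$, and with $dQ^{vc}_\xi=I_{\hat\xi}\big(\theta'-\delta b'-d\lambda'\big)-i_\xi(L'-db')$ in $U$ for solutions. Put $Q'_\xi=Q^{vc}_\xi+i_\xi b'+I_{\hat\xi}\lambda'$.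 On $\mathcal N$ let the pullback of $\theta'$ be decomposed, for solutions, as $-\delta\ell'+d\beta'+\mathcal E$. All these functionals are smooth ($\theta',\lambda',\beta',\mathcal E$ are one-forms on $\mathscr F$). **Charges.** For field-dependent $\xi$ tangent to $\mathcal N$ let, with all forms pulled back to $\mathcal N$ and then to $\partial\Sigma$, $$h_\xi=Q'_\xi+i_\xi\ell'-I_{\hat\xi}\beta',\qquad H_\xi=\int_{\partial\Sigma}h_\xi,\qquad \mathcal F_{\hat\xi}=\int_{\partial\Sigma}\Big(i_\xi\mathcal E-\Delta_{\hat\xi}(\beta'-\lambda')+h_{\delta\xi}\Big),$$ and define the Barnich–Troessaert bracket by $\{H_\xi,H_\zeta\}=-I_{\hat\xi}\delta H_\zeta+I_{\hat\zeta}\mathcal F_{\hat\xi}$. **Charge representation theorem.** For all smooth, possibly field-dependent vector fields $\xi,\zeta$ tangent to $\mathcal N$ (for all fields), at every solution $\phi\in\mathscr S$ the charge $H_\zeta$ is differentiable in the direction $\hat\xi$ and $$\{H_\xi,H_\zeta\}=H_{[\![\xi,\zeta]\!]}+K_{\xi,\zeta},\qquad K_{\xi,\zeta}=\int_{\partial\Sigma}\Big(i_\xi\Delta_{\hat\zeta}(\ell'+b')-i_\zeta\Delta_{\hat\xi}(\ell'+b')\Big).$$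 -/

import Mathlib

open scoped Manifold ContDiff Topology

noncomputable section

namespace CovPhase

/-! ### Differential forms on manifolds -/

/-- The model space `ℝᵐ`. -/
abbrev Mod (m : ℕ) : Type := EuclideanSpace ℝ (Fin m)

/-- A (not necessarily smooth) differential `p`-form on the `m`-manifold `X`. -/
abbrev DForm (m p : ℕ) (X : Type*) [TopologicalSpace X] [ChartedSpace (Mod m) X] :=
  ∀ x : X, TangentSpace (𝓡 m) x [⋀^Fin p]→L[ℝ] ℝ

/-- A (not necessarily smooth) vector field on the `m`-manifold `X`. -/
abbrev RawVF (m : ℕ) (X : Type*) [TopologicalSpace X] [ChartedSpace (Mod m) X] :=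
  ∀ x : X, TangentSpace (𝓡 m) x

section Forms

variable {m k p : ℕ} {X : Type*} [TopologicalSpace X] [ChartedSpace (Mod m) X]
  {Y : Type*} [TopologicalSpace Y] [ChartedSpace (Mod k) Y]

/-- The coordinate expression of a form in the preferred chart at `x₀`, that is, its pullback
under the inverse of that chart (meaningful on the target of the chart). -/
def chartRep (x₀ : X) (η : DForm m p X) : Mod m → Mod m [⋀^Fin p]→L[ℝ] ℝ := fun u =>
  (η ((extChartAt (𝓡 m) x₀).symm u)).compContinuousLinearMap
    (mfderiv 𝓘(ℝ, Mod m) (𝓡 m) (extChartAt (𝓡 m) x₀).symm u)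

/-- The exterior derivative: at `x`, computed in the preferred chart at `x`. -/
def extD (η : DForm m p X) : DForm m (p + 1) X := fun x =>
  (extDeriv (chartRep x η) (extChartAt (𝓡 m) x x)).compContinuousLinearMap
    (mfderiv (𝓡 m) 𝓘(ℝ, Mod m) (extChartAt (𝓡 m) x) x)

/-- The interior product `i_v η = η(v, ⋅, …, ⋅)`; the tangent space of a manifold modelled on
`ℝᵐ` is `ℝᵐ` by definition. -/
def intProd (v : RawVF m X) (η : DForm m (p + 1) X) : DForm m p X := fun x =>
  (show Mod m [⋀^Fin (p + 1)]→L[ℝ] ℝ from η x).curryLeft (v x)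

/-- The Lie derivative of a form, by Cartan's formula `£_v = i_v d + d i_v`
(with `i_v = 0` on functions). -/
def lieForm (v : RawVF m X) : {p : ℕ} → DForm m p X → DForm m p X
  | 0, η => intProd v (extD η)
  | _ + 1, η => intProd v (extD η) + extD (intProd v η)

/-- The pullback of a form under a map `f : Y → X`. -/
def pullback (f : Y → X) (η : DForm m p X) : DForm k p Y := fun y =>
  (η (f y)).compContinuousLinearMap (mfderiv (𝓡 k) (𝓡 m) f y)

/-- A form is smooth if its coordinate expressions are. -/
def IsSmoothForm (η : DForm m p X) : Prop :=
  ∀ x₀ : X, ContDiffOn ℝ ∞ (chartRep x₀ η) (extChartAt (𝓡 m) x₀).target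

/-- The integral of a top-degree form `η`, computed with a partition of unity `ρ` subordinate to
the chart domains. The orientation is the one for which the nowhere vanishing form `μ` is
positive: in each chart, `sign (μ(∂₁,…,∂ₘ))` is `1` or `-1` according as the coordinates are
positively oriented or not. -/
def chartIntegral (ρ : SmoothPartitionOfUnity X (𝓡 m) X Set.univ) (μ η : DForm m m X) : ℝ :=
  ∑ᶠ x : X, ∫ u in (extChartAt (𝓡 m) x).target,
    ρ x ((extChartAt (𝓡 m) x).symm u) *
      (Real.sign (chartRep x μ u (EuclideanSpace.basisFun (Fin m) ℝ)) *
        chartRep x η u (EuclideanSpace.basisFun (Fin m) ℝ))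

/-- The integral of a top-degree form over a (compact) manifold oriented by `μ`: the sum above,
for some partition of unity subordinate to the chart domains (it does not depend on which). -/
def formIntegral [IsManifold (𝓡 m) ∞ X] [T2Space X] [SigmaCompactSpace X]
    (μ η : DForm m m X) : ℝ :=
  chartIntegral
    (Classical.choose (SmoothPartitionOfUnity.exists_isSubordinate_chartAt_source (𝓡 m) X)) μ η

end Forms

/-! ### Algebraic tensor calculus

Tensor fields are described as multilinear maps over the algebra `A` of smooth functions. -/

section Tensors

/-- Derivations of `A`; for `A = C^∞(M)`, smooth vector fields acting on functions. -/
abbrev Der (A : Type*) [CommRing A] [Algebra ℝ A] := Derivation ℝ A A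

/-- `A`-linear functions of a derivation; for `A = C^∞(M)`, smooth covector fields. -/
abbrev Cov (A : Type*) [CommRing A] [Algebra ℝ A] := Der A →ₗ[A] A

variable {A : Type*} [CommRing A] [Algebra ℝ A] {r s : ℕ}

lemma der_lie_smul (D Y : Der A) (f : A) : ⁅D, f • Y⁆ = D f • Y + f • ⁅D, Y⁆ := by
  ext g
  simp [Derivation.commutator_apply]
  ring

/-- The Lie derivative of a covector field: `(£_D α)(Y) = D(α(Y)) - α([D, Y])`. -/
def covLie (D : Der A) (α : Cov A) : Cov A where
  toFun Y := D (α Y) - α ⁅D, Y⁆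
  map_add' Y Z := by simp only [map_add, lie_add]; abel
  map_smul' f Y := by
    rw [der_lie_smul, map_add, LinearMap.map_smul, LinearMap.map_smul, LinearMap.map_smul]
    simp
    ring

lemma covLie_add (D : Der A) (α β : Cov A) : covLie D (α + β) = covLie D α + covLie D β := by
  refine LinearMap.ext (fun Y => ?_)
  change D (α Y + β Y) - (α ⁅D, Y⁆ + β ⁅D, Y⁆) = (D (α Y) - α ⁅D, Y⁆) + (D (β Y) - β ⁅D, Y⁆)
  rw [map_add]
  ring

lemma covLie_smul (D : Der A) (f : A) (α : Cov A) :
    covLie D (f • α) = D f • α + f • covLie D α := by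
  refine LinearMap.ext (fun Y => ?_)
  change D (f * α Y) - f * α ⁅D, Y⁆ = D f * α Y + f * (D (α Y) - α ⁅D, Y⁆)
  simp
  ring

/-- The argument slots of a tensor field of type `(r, s)`: `r` covector fields and `s` vector
fields. -/
def Slot (A : Type*) [CommRing A] [Algebra ℝ A] (r s : ℕ) : Fin r ⊕ Fin s → Type _
  | .inl _ => Cov A
  | .inr _ => Der A

instance (k : Fin r ⊕ Fin s) : AddCommGroup (Slot A r s k) :=
  match k with
  | .inl _ => inferInstanceAs (AddCommGroup (Cov A))
  | .inr _ => inferInstanceAs (AddCommGroup (Der A))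

instance (k : Fin r ⊕ Fin s) : Module A (Slot A r s k) :=
  match k with
  | .inl _ => inferInstanceAs (Module A (Cov A))
  | .inr _ => inferInstanceAs (Module A (Der A))

/-- Tensor fields of type `(r, s)`. -/
abbrev Tensor (A : Type*) [CommRing A] [Algebra ℝ A] (r s : ℕ) :=
  MultilinearMap A (Slot A r s) A

/-- The Lie derivative of an argument of a tensor field: `£_D α` on covector fields, `[D, Y]` on
vector fields. -/
def slotLie (D : Der A) : (k : Fin r ⊕ Fin s) → Slot A r s k → Slot A r s k
  | .inl _, α => covLie D α
  | .inr _, Y => (⁅D, (Y : Der A)⁆ : Der A)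

lemma slotLie_add (D : Der A) : ∀ (k : Fin r ⊕ Fin s) (x y : Slot A r s k),
    slotLie D k (x + y) = slotLie D k x + slotLie D k y
  | .inl _, x, y => covLie_add D x y
  | .inr _, x, y => @lie_add (Der A) (Der A) _ _ _ D x y

lemma slotLie_smul (D : Der A) (f : A) : ∀ (k : Fin r ⊕ Fin s) (x : Slot A r s k),
    slotLie D k (f • x) = D f • x + f • slotLie D k x
  | .inl _, x => covLie_smul D f x
  | .inr _, x => der_lie_smul D x f

/-- The Lie derivative of a tensor field:
`(£_D T)(a₁, …) = D(T(a₁, …)) - ∑ₖ T(…, £_D aₖ, …)`. -/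
def tensorLie (D : Der A) (T : Tensor A r s) : Tensor A r s where
  toFun a := D (T a) - ∑ k, T (Function.update a k (slotLie D k (a k)))
  map_update_add' a i x y := by
    rename_i inst
    have : inst = fun a b => instDecidableEqSum a b := Subsingleton.elim _ _
    subst this
    have key : ∀ k, T (Function.update (Function.update a i (x + y)) k
          (slotLie D k (Function.update a i (x + y) k))) =
        T (Function.update (Function.update a i x) k
          (slotLie D k (Function.update a i x k))) +
        T (Function.update (Function.update a i y) k
          (slotLie D k (Function.update a i y k))) := by
      intro k
      by_cases h : k = i
      · subst h
        simp [slotLie_add]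
      · simp [Function.update_of_ne h, Function.update_comm (Ne.symm h)]
    simp only [key, Finset.sum_add_distrib, MultilinearMap.map_update_add, map_add]
    ring
  map_update_smul' a i f x := by
    rename_i inst
    have : inst = fun a b => instDecidableEqSum a b := Subsingleton.elim _ _
    subst this
    have key : ∀ k, T (Function.update (Function.update a i (f • x)) k
          (slotLie D k (Function.update a i (f • x) k))) =
        f * T (Function.update (Function.update a i x) k
          (slotLie D k (Function.update a i x k))) +
        if k = i then D f * T (Function.update a i x) else 0 := by
      intro k
      by_cases h : k = i
      · subst h
        simp [slotLie_smul, add_comm]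
      · simp [Function.update_comm (Ne.symm h), h]
    simp only [key, Finset.sum_add_distrib, MultilinearMap.map_update_smul, ← Finset.mul_sum]
    simp
    ring

end Tensors

/-! ### Vector fields on a manifold -/

section VectorFields

/-- Smooth functions on `M`. -/
abbrev Fn (m : ℕ) (M : Type*) [TopologicalSpace M] [ChartedSpace (Mod m) M] :=
  C^∞⟮𝓡 m, M; ℝ⟯

/-- Smooth vector fields on `M`. -/
abbrev VF (m : ℕ) (M : Type*) [TopologicalSpace M] [ChartedSpace (Mod m) M]
    [IsManifold (𝓡 m) ∞ M] :=
  ContMDiffSection (𝓡 m) (Mod m) ∞ (TangentSpace (𝓡 m) : M → Type _)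

variable {m k : ℕ} {M : Type*} [TopologicalSpace M] [ChartedSpace (Mod m) M]
  [IsManifold (𝓡 m) ∞ M] {N : Type*} [TopologicalSpace N] [ChartedSpace (Mod k) N]

lemma contMDiff_apply (v : VF m M) (f : Fn m M) :
    ContMDiff (𝓡 m) 𝓘(ℝ, ℝ) ∞ (fun x => mvfderiv (𝓡 m) f x (v x)) := by
  have h1 : ContMDiff (𝓡 m).tangent 𝓘(ℝ, ℝ).tangent ∞ (tangentMap (𝓡 m) 𝓘(ℝ, ℝ) f) :=
    f.contMDiff.contMDiff_tangentMap (by simp)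
  have h2 := h1.comp v.contMDiff
  have h3 := (contMDiff_snd_tangentBundle_modelSpace ℝ 𝓘(ℝ, ℝ) (n := ∞)).comp h2
  exact h3

/-- The derivation `f ↦ df(v)` of a smooth vector field `v`. -/
def VF.der (v : VF m M) : Der (Fn m M) :=
  Derivation.mk'
    { toFun := fun f => ⟨fun x => mvfderiv (𝓡 m) f x (v x), contMDiff_apply v f⟩
      map_add' := fun f g => by
        ext x
        have := mvfderiv_add (f.mdifferentiableAt (x := x)) (g.mdifferentiableAt (x := x))
        exact congrArg (fun L => L (v x)) this
      map_smul' := fun c f => by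
        ext x
        have := const_smul_mfderiv (f.mdifferentiableAt (x := x)) c
        exact congrArg (fun L => L (v x)) this }
    (fun f g => by
      ext x
      have := mvfderiv_mul (f.mdifferentiableAt (x := x)) (g.mdifferentiableAt (x := x))
      exact congrArg (fun L => L (v x)) this)

/-- The Lie bracket of smooth vector fields. -/
def VF.bracket (v w : VF m M) : VF m M :=
  ⟨VectorField.mlieBracket (𝓡 m) (fun x => v x) (fun x => w x), by
    have h1 : IsManifold (𝓡 m) (((⊤ : ℕ∞) : WithTop ℕ∞) + 1) M := by
      simpa using (inferInstance : IsManifold (𝓡 m) ∞ M)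
    have h2 : IsManifold (𝓡 m) (minSmoothness ℝ 2) M := by
      simpa using (inferInstance : IsManifold (𝓡 m) 2 M)
    exact ContDiff.mlieBracket_vectorField (n := ⊤) (m := ⊤) v.contMDiff w.contMDiff (by simp)⟩

/-- The vector field `v` on `M` is tangent to `i : N → M`. -/
def IsTangent (i : N → M) (v : VF m M) : Prop :=
  ∀ y : N, ∃ w : TangentSpace (𝓡 k) y, mfderiv (𝓡 k) (𝓡 m) i y w = v (i y)

open Classical in
/-- The restriction to `N` of a vector field tangent to the immersion `i : N → M`: the vector
field `w` on `N` with `di(w) = v ∘ i`. -/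
def restrict (i : N → M) (v : VF m M) : RawVF k N := fun y =>
  if h : ∃ w : TangentSpace (𝓡 k) y, mfderiv (𝓡 k) (𝓡 m) i y w = v (i y) then h.choose else 0

end VectorFields

/-! ### Smooth curves and variations

Field space and the other infinite-dimensional spaces are treated in the sense of smooth curves:
a map is smooth if it sends smooth curves to smooth curves, and its variation (differential) is
read off from velocities of curves. -/

section Curves

/-- The smooth curves of a space `V`, and the relation "the curve has velocity `v` at time `0`". -/
structure CurveStruct (V : Type*) where
  smooth : (ℝ → V) → Prop
  velocity : (ℝ → V) → V → Prop

/-- The product structure. -/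
def CurveStruct.prod {V W : Type*} (a : CurveStruct V) (b : CurveStruct W) :
    CurveStruct (V × W) where
  smooth c := a.smooth (fun t => (c t).1) ∧ b.smooth (fun t => (c t).2)
  velocity c v := a.velocity (fun t => (c t).1) v.1 ∧ b.velocity (fun t => (c t).2) v.2

/-- Curves of real numbers. -/
def realCurves : CurveStruct ℝ where
  smooth c := ContDiff ℝ ∞ c
  velocity c v := HasDerivAt c v 0

variable {V W : Type*}

/-- `w` is the variation at `p`, in the direction `v`, of the map `f` defined on `D`: every smooth
curve in `D` through `p` with velocity `v` is sent to a curve with velocity `w`. -/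
def HasVariation (a : CurveStruct V) (b : CurveStruct W) (D : Set V) (f : V → W)
    (p v : V) (w : W) : Prop :=
  ∀ c : ℝ → V, a.smooth c → (∀ t, c t ∈ D) → c 0 = p → a.velocity c v →
    b.velocity (fun t => f (c t)) w

/-- `f` is smooth on `D`: it sends smooth curves in `D` to smooth curves, and the velocity of the
image of a curve depends only on the position and velocity of the curve. -/
def IsSmoothMap (a : CurveStruct V) (b : CurveStruct W) (D : Set V) (f : V → W) : Prop :=
  (∀ c : ℝ → V, a.smooth c → (∀ t, c t ∈ D) → b.smooth (fun t => f (c t))) ∧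
    ∀ p ∈ D, ∀ v : V, ∃ w : W, HasVariation a b D f p v w

open Classical in
/-- The variation `δf` of `f` at `p` in the direction `v`. -/
def variation [Zero W] (a : CurveStruct V) (b : CurveStruct W) (D : Set V) (f : V → W)
    (p v : V) : W :=
  if h : ∃ w : W, HasVariation a b D f p v w then h.choose else 0

variable {m p : ℕ} {M : Type*} [TopologicalSpace M] [ChartedSpace (Mod m) M]

/-- A curve of forms is smooth if its coordinate expressions are jointly smooth in time and
position; its velocity is computed pointwise. -/
def formCurves (m p : ℕ) (M : Type*) [TopologicalSpace M] [ChartedSpace (Mod m) M] :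
    CurveStruct (DForm m p M) where
  smooth c := ∀ x₀ : M, ContDiffOn ℝ ∞ (fun q : ℝ × Mod m => chartRep x₀ (c q.1) q.2)
    (Set.univ ×ˢ (extChartAt (𝓡 m) x₀).target)
  velocity c v := ∀ (x : M) (w : Fin p → TangentSpace (𝓡 m) x),
    HasDerivAt (fun t => c t x w) (v x w) 0

/-- A curve of vector fields is smooth if it is jointly smooth in time and position; its velocity
is computed pointwise. -/
def vfCurves (m : ℕ) (M : Type*) [TopologicalSpace M] [ChartedSpace (Mod m) M]
    [IsManifold (𝓡 m) ∞ M] : CurveStruct (VF m M) where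
  smooth c := ContMDiff (𝓘(ℝ, ℝ).prod (𝓡 m)) (𝓡 m).tangent ∞
    (fun q : ℝ × M => (⟨q.2, c q.1 q.2⟩ : TangentBundle (𝓡 m) M))
  velocity c v := ∀ x : M,
    HasDerivAt (fun t => (show Mod m from c t x)) (show Mod m from v x) 0

/-- A curve of functions is smooth if it is jointly smooth in time and position. -/
def SmoothFnCurve (f : ℝ → Fn m M) : Prop :=
  ContMDiff (𝓘(ℝ, ℝ).prod (𝓡 m)) 𝓘(ℝ, ℝ) ∞ (fun q : ℝ × M => f q.1 q.2)

/-- A curve of derivations is smooth if it sends smooth curves of functions to such curves. -/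
def SmoothDerCurve (X : ℝ → Der (Fn m M)) : Prop :=
  ∀ f : ℝ → Fn m M, SmoothFnCurve f → SmoothFnCurve (fun t => X t (f t))

/-- A curve of covector fields is smooth if its values on smooth curves of vector fields are. -/
def SmoothCovCurve (α : ℝ → Cov (Fn m M)) : Prop :=
  ∀ X : ℝ → Der (Fn m M), SmoothDerCurve X → SmoothFnCurve (fun t => α t (X t))

/-- Smooth curves of arguments of a tensor field. -/
def SmoothSlotCurve {r s : ℕ} : (k : Fin r ⊕ Fin s) → (ℝ → Slot (Fn m M) r s k) → Prop
  | .inl _, a => SmoothCovCurve a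
  | .inr _, a => SmoothDerCurve a

/-- A curve of tensor fields is smooth if its values on smooth curves of arguments are. -/
def SmoothTensorCurve {r s : ℕ} (T : ℝ → Tensor (Fn m M) r s) : Prop :=
  ∀ a : ℝ → (∀ k, Slot (Fn m M) r s k), (∀ k, SmoothSlotCurve k (fun t => a t k)) →
    SmoothFnCurve (fun t => T t (a t))

/-- Multiplets of tensor fields, the `i`-th one of type `(r i, s i)`. -/
abbrev Fields (m : ℕ) (M : Type*) [TopologicalSpace M] [ChartedSpace (Mod m) M]
    {ι : Type*} (r s : ι → ℕ) :=
  ∀ i : ι, Tensor (Fn m M) (r i) (s i)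

/-- Smooth curves of field multiplets; the velocity is computed pointwise. -/
def fieldCurves (m : ℕ) (M : Type*) [TopologicalSpace M] [ChartedSpace (Mod m) M]
    {ι : Type*} (r s : ι → ℕ) : CurveStruct (Fields m M r s) where
  smooth c := ∀ i, SmoothTensorCurve (fun t => c t i)
  velocity c v := ∀ (i : ι) (a : ∀ k, Slot (Fn m M) (r i) (s i) k) (x : M),
    HasDerivAt (fun t => c t i a x) (v i a x) 0

/-- The Lie derivative `£_v φ` of a field multiplet. -/
def fieldLie {ι : Type*} {r s : ι → ℕ} [IsManifold (𝓡 m) ∞ M] (v : VF m M)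
    (φ : Fields m M r s) : Fields m M r s :=
  fun i => tensorLie v.der (φ i)

end Curves

/-! ### Field space and its differential calculus -/

section FieldSpace

/-- A space of field configurations. The allowed variations form a `C^∞(M)`-module of tensor
multiplets stable under Lie derivatives (which encodes symmetry types, e.g. symmetric tensors for
a metric), and the configurations are an open set in it (e.g. the nondegenerate symmetric tensors
of Lorentzian signature) in the sense that every variation is the velocity of a smooth curve of
configurations. -/
structure FieldSpace (m : ℕ) (M : Type*) [TopologicalSpace M] [ChartedSpace (Mod m) M]
    [IsManifold (𝓡 m) ∞ M] {ι : Type*} (r s : ι → ℕ) where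
  variations : Submodule (Fn m M) (Fields m M r s)
  configs : Set (Fields m M r s)
  configs_subset : ∀ φ ∈ configs, φ ∈ variations
  lie_mem : ∀ (v : VF m M), ∀ χ ∈ variations, fieldLie v χ ∈ variations
  exists_curve : ∀ φ ∈ configs, ∀ χ ∈ variations, ∃ c : ℝ → Fields m M r s,
    (fieldCurves m M r s).smooth c ∧ (∀ t, c t ∈ configs) ∧ c 0 = φ ∧
      (fieldCurves m M r s).velocity c χ

variable {m : ℕ} {M : Type*} [TopologicalSpace M] [ChartedSpace (Mod m) M]
  [IsManifold (𝓡 m) ∞ M] {ι : Type*} {r s : ι → ℕ} (F : FieldSpace m M r s)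
  {k p : ℕ} {X : Type*} [TopologicalSpace X] [ChartedSpace (Mod k) X]

namespace FieldSpace

/-- The variation `δα(φ; χ)` of a form-valued functional (field-space degree `0`). -/
def delta (α : Fields m M r s → DForm k p X) (φ χ : Fields m M r s) : DForm k p X :=
  variation (fieldCurves m M r s) (formCurves k p X) F.configs α φ χ

/-- The variation `δξ(φ; χ)` of a field-dependent vector field. -/
def deltaVF (ξ : Fields m M r s → VF m M) (φ χ : Fields m M r s) : VF m M :=
  variation (fieldCurves m M r s) (vfCurves m M) F.configs ξ φ χ

/-- The variation `δH(φ; χ)` of a real-valued functional. -/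
def deltaReal (H : Fields m M r s → ℝ) (φ χ : Fields m M r s) : ℝ :=
  variation (fieldCurves m M r s) realCurves F.configs H φ χ

/-- The exterior derivative of a field-space one-form `β(φ; χ)`, evaluated on two variations. -/
def deltaOne (β : Fields m M r s → Fields m M r s → DForm k p X)
    (φ χ₁ χ₂ : Fields m M r s) : DForm k p X :=
  F.delta (fun ψ => β ψ χ₂) φ χ₁ - F.delta (fun ψ => β ψ χ₁) φ χ₂

/-- A smooth field-space one-form: linear in the variation, and smooth in the field and the
variation together. -/
def IsOneForm (β : Fields m M r s → Fields m M r s → DForm k p X) : Prop :=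
  (∀ φ ∈ F.configs, ∀ χ₁ ∈ F.variations, ∀ χ₂ ∈ F.variations,
    β φ (χ₁ + χ₂) = β φ χ₁ + β φ χ₂) ∧
  (∀ φ ∈ F.configs, ∀ (a : ℝ), ∀ χ ∈ F.variations, β φ (a • χ) = a • β φ χ) ∧
  IsSmoothMap ((fieldCurves m M r s).prod (fieldCurves m M r s)) (formCurves k p X)
    (F.configs ×ˢ (F.variations : Set (Fields m M r s))) (fun q => β q.1 q.2)

/-- A smooth field-space function with values in forms, whose variation is a smooth one-form. -/
def IsZeroForm (α : Fields m M r s → DForm k p X) : Prop :=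
  IsSmoothMap (fieldCurves m M r s) (formCurves k p X) F.configs α ∧ F.IsOneForm (F.delta α)

/-- A smooth field-dependent vector field on spacetime. -/
def IsFieldDepVF (ξ : Fields m M r s → VF m M) : Prop :=
  IsSmoothMap (fieldCurves m M r s) (vfCurves m M) F.configs ξ

/-- The vector field `ξ̂` on field space: `I_ξ̂ δφ = £_ξ φ`. -/
def hat (ξ : Fields m M r s → VF m M) (φ : Fields m M r s) : Fields m M r s :=
  fieldLie (ξ φ) φ

/-- The modified Lie bracket `⟦ξ, ζ⟧ = [ξ, ζ] - I_ξ̂ δζ + I_ζ̂ δξ`. -/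
def brmod (ξ ζ : Fields m M r s → VF m M) (φ : Fields m M r s) : VF m M :=
  (ξ φ).bracket (ζ φ) - F.deltaVF ζ φ (hat ξ φ) + F.deltaVF ξ φ (hat ζ φ)

/-- The field-space Lie derivative `L_ξ̂ = I_ξ̂ δ + δ I_ξ̂` on functions. -/
def lieZero (ξ : Fields m M r s → VF m M) (α : Fields m M r s → DForm k p X)
    (φ : Fields m M r s) : DForm k p X :=
  F.delta α φ (hat ξ φ)

/-- The field-space Lie derivative `L_ξ̂ = I_ξ̂ δ + δ I_ξ̂` on one-forms. -/
def lieOne (ξ : Fields m M r s → VF m M) (β : Fields m M r s → Fields m M r s → DForm k p X)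
    (φ χ : Fields m M r s) : DForm k p X :=
  F.deltaOne β φ (hat ξ φ) χ + F.delta (fun ψ => β ψ (hat ξ ψ)) φ χ

/-- The anomaly operator `Δ_ξ̂ = L_ξ̂ - £_ξ - I_δξ̂` on field-space functions (on which `I_δξ̂`
vanishes) with values in forms on `X`; `res` turns vector fields on spacetime into vector fields
on `X` (the identity for `X = M`, the restriction for a hypersurface). -/
def anomalyZero (res : VF m M → RawVF k X) (ξ : Fields m M r s → VF m M)
    (α : Fields m M r s → DForm k p X) (φ : Fields m M r s) : DForm k p X :=
  F.lieZero ξ α φ - lieForm (res (ξ φ)) (α φ)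

/-- The anomaly operator `Δ_ξ̂ = L_ξ̂ - £_ξ - I_δξ̂` on field-space one-forms. -/
def anomalyOne (res : VF m M → RawVF k X) (ξ : Fields m M r s → VF m M)
    (β : Fields m M r s → Fields m M r s → DForm k p X) (φ χ : Fields m M r s) : DForm k p X :=
  F.lieOne ξ β φ χ - lieForm (res (ξ φ)) (β φ χ) - β φ (fieldLie (F.deltaVF ξ φ χ) φ)

/-- The anomaly of a field-dependent vector field: `Δ_ξ̂ ζ = L_ξ̂ ζ - £_ξ ζ = I_ξ̂ δζ - [ξ, ζ]`. -/
def anomalyVF (ξ ζ : Fields m M r s → VF m M) (φ : Fields m M r s) : VF m M :=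
  F.deltaVF ζ φ (hat ξ φ) - (ξ φ).bracket (ζ φ)

end FieldSpace

end FieldSpace

/-! ### The theory, its localized charges and their brackets -/

section Charges

variable {n : ℕ} {M : Type*} [TopologicalSpace M] [ChartedSpace (Mod (n + 2)) M]
  [IsManifold (𝓡 (n + 2)) ∞ M] {N : Type*} [TopologicalSpace N] [ChartedSpace (Mod (n + 1)) N]
  {ι : Type*} {r s : ι → ℕ}

/-- The underlying vector field of a smooth vector field on spacetime. -/
def bulk (v : VF (n + 2) M) : RawVF (n + 2) M := fun x => v x

/-- The functionals entering the covariant phase space construction: on the spacetime `M`,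
the Lagrangian `L'`, the field equations `E·δφ`, the symplectic potential `θ'`, the terms `b'`,
`λ'` that measure their noncovariance, and the vector-covariant Noether potential `Q^vc_v` (linear
in the vector field `v`); on the hypersurface `N`, the boundary term `ℓ'`, the corner term `β'`
and the flux term `𝓔`. -/
structure Functionals (n : ℕ) (M : Type*) [TopologicalSpace M] [ChartedSpace (Mod (n + 2)) M]
    [IsManifold (𝓡 (n + 2)) ∞ M] (N : Type*) [TopologicalSpace N]
    [ChartedSpace (Mod (n + 1)) N] {ι : Type*} (r s : ι → ℕ) where
  L : Fields (n + 2) M r s → DForm (n + 2) (n + 2) M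
  E : Fields (n + 2) M r s → Fields (n + 2) M r s → DForm (n + 2) (n + 2) M
  θ : Fields (n + 2) M r s → Fields (n + 2) M r s → DForm (n + 2) (n + 1) M
  b : Fields (n + 2) M r s → DForm (n + 2) (n + 1) M
  lam : Fields (n + 2) M r s → Fields (n + 2) M r s → DForm (n + 2) n M
  Qvc : Fields (n + 2) M r s → VF (n + 2) M → DForm (n + 2) n M
  ell : Fields (n + 2) M r s → DForm (n + 1) (n + 1) N
  β : Fields (n + 2) M r s → Fields (n + 2) M r s → DForm (n + 1) n N
  flux : Fields (n + 2) M r s → Fields (n + 2) M r s → DForm (n + 1) (n + 1) N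

namespace Functionals

variable (T : Functionals n M N r s) (F : FieldSpace (n + 2) M r s) (U : Set M) (i : N → M)

/-- The solution space: configurations satisfying the field equations in the subregion `U` (a
field on `U` smooth up to the boundary is represented by an extension to `M`). -/
def solutions : Set (Fields (n + 2) M r s) :=
  {φ | φ ∈ F.configs ∧ ∀ χ ∈ F.variations, ∀ x ∈ U, T.E φ χ x = 0}

/-- The covariant Lagrangian `L^c = L' - db'`. -/
def covL (φ : Fields (n + 2) M r s) : DForm (n + 2) (n + 2) M := T.L φ - extD (T.b φ)

/-- The covariant symplectic potential `θ^c = θ' - δb' - dλ'`. -/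
def covθ (φ χ : Fields (n + 2) M r s) : DForm (n + 2) (n + 1) M :=
  T.θ φ χ - F.delta T.b φ χ - extD (T.lam φ χ)

/-- The vector-covariant Noether current `J^vc_v = I_v̂ θ^c - i_v L^c`. -/
def Jvc (φ : Fields (n + 2) M r s) (v : VF (n + 2) M) : DForm (n + 2) (n + 1) M :=
  T.covθ F φ (fieldLie v φ) - intProd (bulk v) (T.covL φ)

/-- The defining relations between the functionals of a covariant phase space for the subregion
`U` with boundary hypersurface `i : N → M`. -/
structure IsCovariantPhaseSpace : Prop where
  smooth_L : F.IsZeroForm T.L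
  smooth_θ : F.IsOneForm T.θ
  smooth_b : F.IsZeroForm T.b
  smooth_lam : F.IsOneForm T.lam
  smooth_ell : F.IsZeroForm T.ell
  smooth_β : F.IsOneForm T.β
  /-- `Q^vc` is smooth in the fields and the vector field together. -/
  smooth_Qvc : IsSmoothMap ((fieldCurves (n + 2) M r s).prod (vfCurves (n + 2) M))
    (formCurves (n + 2) n M) (F.configs ×ˢ Set.univ) (fun q => T.Qvc q.1 q.2)
  Qvc_add : ∀ φ ∈ F.configs, ∀ v w, T.Qvc φ (v + w) = T.Qvc φ v + T.Qvc φ w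
  Qvc_smul : ∀ φ ∈ F.configs, ∀ (a : ℝ) v, T.Qvc φ (a • v) = a • T.Qvc φ v
  /-- `E·δφ` is `C^∞(M)`-linear in `δφ`. -/
  E_add : ∀ φ ∈ F.configs, ∀ χ₁ ∈ F.variations, ∀ χ₂ ∈ F.variations,
    T.E φ (χ₁ + χ₂) = T.E φ χ₁ + T.E φ χ₂
  E_smul : ∀ φ ∈ F.configs, ∀ (f : Fn (n + 2) M), ∀ χ ∈ F.variations, ∀ x,
    T.E φ (f • χ) x = f x • T.E φ χ x
  /-- `δL' = E·δφ + dθ'`. -/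
  delta_L : ∀ φ ∈ F.configs, ∀ χ ∈ F.variations,
    F.delta T.L φ χ = T.E φ χ + extD (T.θ φ χ)
  /-- `Δ_ξ̂ L' = d Δ_ξ̂ b'`. -/
  anomaly_L : ∀ ξ, F.IsFieldDepVF ξ → ∀ φ ∈ F.configs,
    F.anomalyZero bulk ξ T.L φ = extD (F.anomalyZero bulk ξ T.b φ)
  /-- `Δ_ξ̂ θ' = Δ_ξ̂ δb' + d Δ_ξ̂ λ'`. -/
  anomaly_θ : ∀ ξ, F.IsFieldDepVF ξ → ∀ φ ∈ F.configs, ∀ χ ∈ F.variations,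
    F.anomalyOne bulk ξ T.θ φ χ =
      F.anomalyOne bulk ξ (F.delta T.b) φ χ + extD (F.anomalyOne bulk ξ T.lam φ χ)
  /-- `Δ_ξ̂ Q^vc_ζ = Q^vc_{Δ_ξ̂ ζ}`. -/
  anomaly_Qvc : ∀ ξ, F.IsFieldDepVF ξ → ∀ ζ, F.IsFieldDepVF ζ → ∀ φ ∈ F.configs,
    F.anomalyZero bulk ξ (fun ψ => T.Qvc ψ (ζ ψ)) φ = T.Qvc φ (F.anomalyVF ξ ζ φ)
  /-- `J^vc_v = d Q^vc_v` on solutions. -/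
  noether : ∀ φ ∈ T.solutions F U, ∀ v, ∀ x ∈ U, T.Jvc F φ v x = extD (T.Qvc φ v) x
  /-- The pullback of `θ'` to `N` is `-δℓ' + dβ' + 𝓔`. -/
  decomposition : ∀ φ ∈ T.solutions F U, ∀ χ ∈ F.variations,
    pullback i (T.θ φ χ) = -F.delta T.ell φ χ + extD (T.β φ χ) + T.flux φ χ

/-- The Noether potential `Q'_v = Q^vc_v + i_v b' + I_v̂ λ'`. -/
def Q' (φ : Fields (n + 2) M r s) (v : VF (n + 2) M) : DForm (n + 2) n M :=
  T.Qvc φ v + intProd (bulk v) (T.b φ) + T.lam φ (fieldLie v φ)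

/-- The localized charge density `h_v = Q'_v + i_v ℓ' - I_v̂ β'`, a form on `N`. -/
def density (φ : Fields (n + 2) M r s) (v : VF (n + 2) M) : DForm (n + 1) n N :=
  pullback i (T.Q' φ v) + intProd (restrict i v) (T.ell φ) - T.β φ (fieldLie v φ)

variable {S : Type*} [TopologicalSpace S] [ChartedSpace (Mod n) S] [IsManifold (𝓡 n) ∞ S]
  [T2Space S] [CompactSpace S] (j : S → N) (μ : DForm n n S)

/-- The localized charge `H_ξ = ∫ h_ξ` over the cut `j : S → N`, oriented by `μ`. -/
def charge (ξ : Fields (n + 2) M r s → VF (n + 2) M) (φ : Fields (n + 2) M r s) : ℝ :=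
  formIntegral μ (pullback j (T.density i φ (ξ φ)))

/-- The symplectic flux `𝓕_ξ̂ = ∫ (i_ξ 𝓔 - Δ_ξ̂(β' - λ') + h_δξ)`, a one-form on field space. -/
def totalFlux (ξ : Fields (n + 2) M r s → VF (n + 2) M) (φ χ : Fields (n + 2) M r s) : ℝ :=
  formIntegral μ (pullback j (intProd (restrict i (ξ φ)) (T.flux φ χ)
    - F.anomalyOne (restrict i) ξ (fun ψ η => T.β ψ η - pullback i (T.lam ψ η)) φ χ
    + T.density i φ (F.deltaVF ξ φ χ)))

/-- The Barnich–Troessaert bracket `{H_ξ, H_ζ} = -I_ξ̂ δH_ζ + I_ζ̂ 𝓕_ξ̂`. -/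
def bracketBT (ξ ζ : Fields (n + 2) M r s → VF (n + 2) M) (φ : Fields (n + 2) M r s) : ℝ :=
  -F.deltaReal (T.charge i j μ ζ) φ (FieldSpace.hat ξ φ)
    + T.totalFlux F i j μ ξ φ (FieldSpace.hat ζ φ)

/-- The extension `K_{ξ,ζ} = ∫ (i_ξ Δ_ζ̂(ℓ' + b') - i_ζ Δ_ξ̂(ℓ' + b'))`. -/
def extension (ξ ζ : Fields (n + 2) M r s → VF (n + 2) M) (φ : Fields (n + 2) M r s) : ℝ :=
  formIntegral μ (pullback j
    (intProd (restrict i (ξ φ))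
        (F.anomalyZero (restrict i) ζ (fun ψ => T.ell ψ + pullback i (T.b ψ)) φ)
      - intProd (restrict i (ζ φ))
        (F.anomalyZero (restrict i) ξ (fun ψ => T.ell ψ + pullback i (T.b ψ)) φ)))

end Functionals

end Charges

end CovPhase

end

/-! On `N` put ω = ℓ' + b' and C = β' - λ'. For a vector field v tangent to `N` the charge density
is h_v = Q^vc_v + i_v ω - C(v̂) (`density_eq`), and the theorem rests on two pointwise identities on
`N`.

Off shell, `delta_density_hat`: δh_ζ(ξ̂) = £_ξ h_ζ + h_{Δ_ξ̂ ζ} + i_ζ Δ_ξ̂ ω - (Δ_ξ̂ C)(ζ̂). Each of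
the three pieces of h_ζ is varied separately. For Q^vc this is its vector covariance. For i_ζ ω it
is the Leibniz rule, with δζ(ξ̂) = Δ_ξ̂ ζ + [ξ, ζ] and £_ξ i_ζ = i_ζ £_ξ + i_[ξ, ζ]. For C(ζ̂) it is
the commutation rule `IsOneForm.anomalyOne_hat` between anomalies and contractions, which comes down
to £_[ξ, ζ] = [£_ξ, £_ζ] on the fields.

On shell, `flux_eq`: 𝓔(ζ̂) = dh_ζ + Δ_ζ̂ ω. The Noether identity extends by continuity from U to
`N`; the term i_ζ L^c pulls back to zero because ζ is tangent and L^c has degree larger than dim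
`N`; and £_ζ ω = d i_ζ ω because ω has top degree. The decomposition of θ' then gives the flux.

Insert the second identity into the integrand of 𝓕_ξ̂ evaluated on ζ̂ and subtract the first. The
corner anomalies cancel, the two densities combine into the one of δξ(ζ̂) - Δ_ξ̂ ζ = ⟦ξ, ζ⟧, the
anomalies of ω form K, and what remains is i_ξ dh_ζ - £_ξ h_ζ. Its integral over the closed cut
vanishes by Cartan's formula and Stokes' theorem (`formIntegral_pullback_lieForm`).

The greater part of the work justifies this calculus. Forms are handled in charts, where Cartan's
formula and the rule for £_V i_W are finite sums. Vector fields tangent to `N` restrict smoothly,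
compatibly with velocities and brackets, by means of local left inverses of the immersion.
Variations are velocities along curves, so the chain rule for β(φ; £_ξ φ) needs a product rule for
£_{v_t} φ_t. That rule comes from writing v_t = v_0 + t v'_t with v' smooth (Hadamard's lemma in
time). Tensors being multilinear maps over the algebra of functions, local frames are needed to see
that constant curves of tensors are smooth. Differentiation under the integral sign gives the
differentiability of the charge, and a partition of unity reduces Stokes' theorem to a chart. -/

set_option linter.unusedSectionVars false

noncomputable section

namespace CovPhase

/-! ### Calculus of alternating forms on `ℝᵐ` -/

section AltCalculus

variable {m k p : ℕ} {G : Type*} [NormedAddCommGroup G] [NormedSpace ℝ G]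

/-- Alternating forms are determined by their values on the standard basis. -/
def altCoords (m p : ℕ) :
    (Mod m [⋀^Fin p]→L[ℝ] ℝ) →L[ℝ] ((Fin p → Fin m) → ℝ) :=
  ContinuousLinearMap.pi fun I =>
    ContinuousAlternatingMap.apply ℝ (Mod m) ℝ (fun a => EuclideanSpace.basisFun (Fin m) ℝ (I a))

lemma altCoords_injective : Function.Injective (altCoords m p) := by
  intro f g h
  have : f.toAlternatingMap = g.toAlternatingMap := by
    refine Module.Basis.ext_alternating (EuclideanSpace.basisFun (Fin m) ℝ).toBasis ?_
    intro v _
    have := congrFun h v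
    simpa [altCoords] using this
  exact ContinuousAlternatingMap.toAlternatingMap_injective this

lemma exists_altCoords_inv : ∃ r : ((Fin p → Fin m) → ℝ) →L[ℝ] (Mod m [⋀^Fin p]→L[ℝ] ℝ),
    ∀ f, r (altCoords m p f) = f := by
  obtain ⟨g, hg⟩ := LinearMap.exists_leftInverse_of_injective (altCoords m p).toLinearMap
    (LinearMap.ker_eq_bot.2 altCoords_injective)
  exact ⟨LinearMap.toContinuousLinearMap g, fun f => LinearMap.congr_fun hg f⟩

/-- A form-valued map is recovered from its finitely many basis values by a fixed continuous linear
map, the left inverse of `altCoords`; smoothness can therefore be tested on constant arguments. -/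
lemma contDiffAt_alt_iff {n : WithTop ℕ∞} {f : G → Mod m [⋀^Fin p]→L[ℝ] ℝ} {x : G} :
    ContDiffAt ℝ n f x ↔ ∀ v : Fin p → Mod m, ContDiffAt ℝ n (fun y => f y v) x := by
  constructor
  · intro h v
    exact (ContinuousAlternatingMap.apply ℝ (Mod m) ℝ v).contDiff.contDiffAt.comp x h
  · intro h
    obtain ⟨r, hr⟩ := exists_altCoords_inv (m := m) (p := p)
    have : f = fun y => r (altCoords m p (f y)) := by ext1 y; rw [hr]
    rw [this]
    refine r.contDiff.contDiffAt.comp x (contDiffAt_pi.2 fun I => ?_)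
    exact h _

/-- Evaluation is linear in the form and multilinear in the arguments, hence jointly analytic. -/
lemma contDiffAt_alt_apply {n : WithTop ℕ∞} {f : G → Mod m [⋀^Fin p]→L[ℝ] ℝ}
    {v : G → Fin p → Mod m} {x : G}
    (hf : ContDiffAt ℝ n f x) (hv : ∀ a, ContDiffAt ℝ n (fun y => v y a) x) :
    ContDiffAt ℝ n (fun y => f y (v y)) x := by
  have h := (ContinuousAlternatingMap.toContinuousMultilinearMapCLM (𝕜 := ℝ) (E := Mod m)
    (F := ℝ) (ι := Fin p) ℝ).analyticAt_uncurry_of_multilinear (x := (f x, v x))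
  exact h.contDiffAt.comp x (hf.prodMk (contDiffAt_pi.2 hv))

lemma contDiffAt_compCLM {n : WithTop ℕ∞} {f : G → Mod m [⋀^Fin p]→L[ℝ] ℝ}
    {A : G → Mod k →L[ℝ] Mod m} {x : G}
    (hf : ContDiffAt ℝ n f x) (hA : ContDiffAt ℝ n A x) :
    ContDiffAt ℝ n (fun y => (f y).compContinuousLinearMap (A y)) x := by
  rw [contDiffAt_alt_iff]
  intro v
  exact contDiffAt_alt_apply (v := fun y a => A y (v a)) hf
    (fun a => hA.clm_apply contDiffAt_const)

lemma contDiffAt_curryLeft {n : WithTop ℕ∞} {f : G → Mod m [⋀^Fin (p + 1)]→L[ℝ] ℝ}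
    {v : G → Mod m} {x : G} (hf : ContDiffAt ℝ n f x) (hv : ContDiffAt ℝ n v x) :
    ContDiffAt ℝ n (fun y => (f y).curryLeft (v y)) x := by
  rw [contDiffAt_alt_iff]
  intro w
  refine contDiffAt_alt_apply (v := fun y => Matrix.vecCons (v y) w) hf fun a => ?_
  refine Fin.cases ?_ (fun b => ?_) a
  · simpa [Matrix.vecCons] using hv
  · simpa [Matrix.vecCons] using contDiffAt_const

lemma contDiffAt_extDeriv {f : Mod m → Mod m [⋀^Fin p]→L[ℝ] ℝ} {x : Mod m}
    (hf : ContDiffAt ℝ ∞ f x) : ContDiffAt ℝ ∞ (extDeriv f) x := by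
  have h : ContDiffAt ℝ ∞ (fderiv ℝ f) x := hf.fderiv_right (by simp)
  exact (ContinuousAlternatingMap.alternatizeUncurryFinCLM ℝ (Mod m) ℝ
    (n := p)).contDiff.contDiffAt.comp x h

lemma curryLeft_compCLM (η : Mod m [⋀^Fin (p + 1)]→L[ℝ] ℝ) (A : Mod k →L[ℝ] Mod m) (v : Mod k) :
    (η.compContinuousLinearMap A).curryLeft v = (η.curryLeft (A v)).compContinuousLinearMap A := by
  ext w
  simp only [ContinuousAlternatingMap.curryLeft_apply_apply,
    ContinuousAlternatingMap.compContinuousLinearMap_apply]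
  congr 1
  ext a
  refine Fin.cases ?_ (fun b => ?_) a <;> simp

/-- The Lie derivative of a form on `ℝᵐ` in coordinates. -/
def coordLie (V : Mod m → Mod m) (η : Mod m → Mod m [⋀^Fin p]→L[ℝ] ℝ) (x : Mod m)
    (w : Fin p → Mod m) : ℝ :=
  fderiv ℝ η x (V x) w + ∑ a, η x (Function.update w a (fderiv ℝ V x (w a)))

lemma extDeriv_eq_sum (η : Mod m → Mod m [⋀^Fin p]→L[ℝ] ℝ) (x : Mod m) (v : Fin (p + 1) → Mod m) :
    extDeriv η x v = ∑ a : Fin (p + 1), (-1) ^ (a : ℕ) * fderiv ℝ η x (v a) (a.removeNth v) := by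
  simp [extDeriv, ContinuousAlternatingMap.alternatizeUncurryFin_apply]

lemma alt_update_eq (η : Mod m [⋀^Fin (p + 1)]→L[ℝ] ℝ) (w : Fin (p + 1) → Mod m)
    (a : Fin (p + 1)) (z : Mod m) :
    η (Function.update w a z) = (-1) ^ (a : ℕ) * η (Matrix.vecCons z (a.removeNth w)) := by
  have := η.toAlternatingMap.map_insertNth a z (a.removeNth w)
  simp only [Fin.insertNth_removeNth] at this
  simpa using this

lemma fderiv_curryLeft {η : Mod m → Mod m [⋀^Fin (p + 1)]→L[ℝ] ℝ} {V : Mod m → Mod m} {x : Mod m}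
    (hη : ContDiffAt ℝ 1 η x) (hV : ContDiffAt ℝ 1 V x) (u : Mod m) :
    fderiv ℝ (fun y => (η y).curryLeft (V y)) x u =
      (fderiv ℝ η x u).curryLeft (V x) + (η x).curryLeft (fderiv ℝ V x u) := by
  ext w
  have hc := (contDiffAt_curryLeft hη hV).differentiableAt one_ne_zero
  rw [← fderiv_continuousAlternatingMap_apply_const_apply hc]
  simp only [ContinuousAlternatingMap.curryLeft_apply_apply, ContinuousAlternatingMap.add_apply]
  have hw : ∀ a : Fin (p + 1),
      DifferentiableAt ℝ (fun y => Matrix.vecCons (V y) w a) x := by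
    intro a
    refine Fin.cases ?_ (fun b => ?_) a
    · simpa [Matrix.vecCons] using hV.differentiableAt one_ne_zero
    · simp [Matrix.vecCons]
  have := fderiv_continuousAlternatingMap_apply_apply (hη.differentiableAt one_ne_zero) hw u
  rw [this, Fin.sum_univ_succ, Finset.sum_eq_zero]
  · simp [Matrix.vecCons]
  -- The tail `w` does not depend on the point, so differentiating these slots inserts a zero
  -- argument.
  · intro b _
    simp only [Matrix.vecCons, Fin.cons_succ]
    refine ContinuousAlternatingMap.map_coord_zero _ b.succ ?_
    simp

/-- Cartan's formula. The zeroth term of `dη(V, w)` differentiates `η` along `V`; the other terms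
cancel against the part of `d(i_V η)` in which `η` is differentiated. What is left has `V`
differentiated, and the sign is absorbed by moving that vector back to its slot. -/
lemma coordLie_eq {η : Mod m → Mod m [⋀^Fin (p + 1)]→L[ℝ] ℝ} {V : Mod m → Mod m} {x : Mod m}
    (hη : ContDiffAt ℝ 1 η x) (hV : ContDiffAt ℝ 1 V x) (w : Fin (p + 1) → Mod m) :
    (extDeriv η x).curryLeft (V x) w + extDeriv (fun y => (η y).curryLeft (V y)) x w =
      coordLie V η x w := by
  rw [ContinuousAlternatingMap.curryLeft_apply_apply, extDeriv_eq_sum, extDeriv_eq_sum, coordLie,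
    Fin.sum_univ_succ, add_assoc, ← Finset.sum_add_distrib]
  congr 1
  · simp [Matrix.vecCons]
  · refine Finset.sum_congr rfl fun a _ => ?_
    rw [fderiv_curryLeft hη hV, alt_update_eq]
    have : a.succ.removeNth (Matrix.vecCons (V x) w) = Matrix.vecCons (V x) (a.removeNth w) := by
      ext1 b
      refine Fin.cases ?_ (fun c => ?_) b <;> simp [Fin.removeNth, Matrix.vecCons]
    rw [this]
    simp [pow_succ]
    ring

lemma coordLie_zero {η : Mod m → Mod m [⋀^Fin 0]→L[ℝ] ℝ} {V : Mod m → Mod m} {x : Mod m}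
    (w : Fin 0 → Mod m) : (extDeriv η x).curryLeft (V x) w = coordLie V η x w := by
  rw [ContinuousAlternatingMap.curryLeft_apply_apply, extDeriv_eq_sum, coordLie]
  simp [Matrix.vecCons]

/-- `£_V i_W - i_W £_V = i_[V, W]` in coordinates. -/
lemma coordLie_curryLeft {η : Mod m → Mod m [⋀^Fin (p + 1)]→L[ℝ] ℝ} {V W : Mod m → Mod m}
    {x : Mod m} (hη : ContDiffAt ℝ 1 η x) (hW : ContDiffAt ℝ 1 W x) (w : Fin p → Mod m) :
    coordLie V (fun y => (η y).curryLeft (W y)) x w =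
      coordLie V η x (Matrix.vecCons (W x) w) +
        (η x).curryLeft (VectorField.lieBracket ℝ V W x) w := by
  rw [coordLie, coordLie, fderiv_curryLeft hη hW, Fin.sum_univ_succ, VectorField.lieBracket]
  have h0 : Function.update (Matrix.vecCons (W x) w) 0
      (fderiv ℝ V x (Matrix.vecCons (W x) w 0)) = Matrix.vecCons (fderiv ℝ V x (W x)) w := by
    simp [Matrix.vecCons]
  have hs : ∀ a : Fin p, Function.update (Matrix.vecCons (W x) w) a.succ
      (fderiv ℝ V x (Matrix.vecCons (W x) w a.succ)) =
      Matrix.vecCons (W x) (Function.update w a (fderiv ℝ V x (w a))) := by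
    intro a
    simp [Matrix.vecCons, Fin.cons_update]
  simp only [h0, hs, map_sub, ContinuousAlternatingMap.add_apply,
    ContinuousAlternatingMap.sub_apply, ContinuousAlternatingMap.curryLeft_apply_apply]
  ring

end AltCalculus

/-! ### Smooth dependence of integrals on parameters, and Hadamard's lemma -/

section Hadamard

open MeasureTheory

/-- Induction on the order, differentiating under the integral sign. The spaces are quantified
inside the statement because the induction hypothesis is applied to the partial derivative, whose
values lie in `E →L[ℝ] G`. -/
lemma contDiff_parametric_integral_nat (n : ℕ) :
    ∀ {E G : Type} [NormedAddCommGroup E] [NormedSpace ℝ E] [FiniteDimensional ℝ E]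
      [NormedAddCommGroup G] [NormedSpace ℝ G] [CompleteSpace G] {f : E × ℝ → G},
      ContDiff ℝ ∞ f → ContDiff ℝ n (fun x => ∫ s in (0 : ℝ)..1, f (x, s)) := by
  induction n with
  | zero =>
    intro E G _ _ _ _ _ _ f hf
    refine contDiff_zero.2 ?_
    exact intervalIntegral.continuous_parametric_intervalIntegral_of_continuous'
      (f := fun x s => f (x, s)) hf.continuous 0 1
  | succ n ih =>
    intro E G _ _ _ _ _ _ f hf
    have hg : ContDiff ℝ ∞ (fun q : E × ℝ => (fderiv ℝ f q).comp (ContinuousLinearMap.inl ℝ E ℝ)) :=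
      (hf.fderiv_right (by simp)).clm_comp contDiff_const
    have hd : ∀ x, HasFDerivAt (fun x => ∫ s in (0 : ℝ)..1, f (x, s))
        (∫ s in (0 : ℝ)..1, (fderiv ℝ f (x, s)).comp (ContinuousLinearMap.inl ℝ E ℝ)) x := by
      intro x
      obtain ⟨C, hC⟩ := ((isCompact_closedBall x 1).prod (isCompact_Icc (a := (0 : ℝ)) (b := 1))).exists_bound_of_continuousOn hg.continuous.continuousOn
      refine intervalIntegral.hasFDerivAt_integral_of_dominated_of_fderiv_le
        (𝕜 := ℝ) (μ := volume) (a := 0) (b := 1)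
        (F' := fun x s => (fderiv ℝ f (x, s)).comp (ContinuousLinearMap.inl ℝ E ℝ)) (F := fun x s => f (x, s)) (bound := fun _ => C) (Metric.ball_mem_nhds x one_pos) ?_ ?_ ?_ ?_ ?_ ?_
      · exact Filter.Eventually.of_forall fun y =>
          (hf.continuous.comp (Continuous.prodMk_right y)).aestronglyMeasurable
      · exact (hf.continuous.comp (Continuous.prodMk_right x)).intervalIntegrable _ _
      · exact (hg.continuous.comp (Continuous.prodMk_right x)).aestronglyMeasurable
      · refine Filter.Eventually.of_forall fun s hs y hy => hC (y, s) ⟨Metric.ball_subset_closedBall hy, ?_⟩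
        rw [Set.uIoc_of_le zero_le_one] at hs
        exact Set.Ioc_subset_Icc_self hs
      · exact intervalIntegrable_const
      · refine Filter.Eventually.of_forall fun s _ y _ => ?_
        have h1 : HasFDerivAt f (fderiv ℝ f (y, s)) (y, s) :=
          (hf.differentiable (by simp)).differentiableAt.hasFDerivAt
        exact h1.comp y (hasFDerivAt_prodMk_left y s)
    push_cast
    rw [contDiff_succ_iff_hasFDerivAt]
    · exact ⟨_, ih hg, hd⟩

lemma contDiff_parametric_integral {E G : Type} [NormedAddCommGroup E] [NormedSpace ℝ E]
    [FiniteDimensional ℝ E] [NormedAddCommGroup G] [NormedSpace ℝ G] [CompleteSpace G]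
    {f : E × ℝ → G} (hf : ContDiff ℝ ∞ f) : ContDiff ℝ ∞ (fun x => ∫ s in (0 : ℝ)..1, f (x, s)) :=
  contDiff_infty.2 fun n => contDiff_parametric_integral_nat n hf

/-- Fundamental theorem of calculus along the segment from `x₀` to `u`: `g a` is the mean over the
segment of the `a`-th partial derivative. -/
lemma hadamard_space {m : ℕ} {f : Mod m → ℝ} (hf : ContDiff ℝ ∞ f) (x₀ : Mod m) :
    ∃ g : Fin m → Mod m → ℝ, (∀ a, ContDiff ℝ ∞ (g a)) ∧
      (∀ a, g a x₀ = fderiv ℝ f x₀ (EuclideanSpace.basisFun (Fin m) ℝ a)) ∧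
      ∀ u, f u = f x₀ + ∑ a, (u a - x₀ a) * g a u := by
  refine ⟨fun a u => ∫ s in (0 : ℝ)..1,
    fderiv ℝ f (x₀ + s • (u - x₀)) (EuclideanSpace.basisFun (Fin m) ℝ a), fun a => ?_, fun a => ?_,
    fun u => ?_⟩
  · refine contDiff_parametric_integral (f := fun q : Mod m × ℝ =>
      fderiv ℝ f (x₀ + q.2 • (q.1 - x₀)) (EuclideanSpace.basisFun (Fin m) ℝ a)) ?_
    have h1 : ContDiff ℝ ∞ (fderiv ℝ f) := hf.fderiv_right (by simp)
    exact (h1.comp (by fun_prop)).clm_apply contDiff_const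
  · simp
  · have hc : ∀ v, Continuous fun s : ℝ => fderiv ℝ f (x₀ + s • (u - x₀)) v := fun v =>
      ((hf.continuous_fderiv (by simp)).comp (by fun_prop)).clm_apply continuous_const
    have hd : ∀ s ∈ Set.uIcc (0 : ℝ) 1, HasDerivAt (fun s : ℝ => f (x₀ + s • (u - x₀)))
        (fderiv ℝ f (x₀ + s • (u - x₀)) (u - x₀)) s := by
      intro s _
      have h1 : HasDerivAt (fun s : ℝ => x₀ + s • (u - x₀)) (u - x₀) s := by
        simpa using ((hasDerivAt_id s).smul_const (u - x₀)).const_add x₀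
      exact ((hf.differentiable (by simp)).differentiableAt.hasFDerivAt).comp_hasDerivAt s h1
    have h2 := intervalIntegral.integral_eq_sub_of_hasDerivAt hd ((hc _).intervalIntegrable _ _)
    have h3 : ∀ s : ℝ, fderiv ℝ f (x₀ + s • (u - x₀)) (u - x₀) = ∑ a, (u a - x₀ a) *
        fderiv ℝ f (x₀ + s • (u - x₀)) (EuclideanSpace.basisFun (Fin m) ℝ a) := by
      intro s
      generalize fderiv ℝ f (x₀ + s • (u - x₀)) = L
      conv_lhs => rw [← (EuclideanSpace.basisFun (Fin m) ℝ).sum_repr (u - x₀)]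
      simp
    simp only [h3] at h2
    rw [intervalIntegral.integral_finsetSum] at h2
    · simp only [intervalIntegral.integral_const_mul] at h2
      rw [h2]
      simp
    · intro a _
      exact ((hc _).intervalIntegrable _ _).const_mul _

lemma exists_cutoff {m : ℕ} {O : Set (Mod m)} {u₀ : Mod m} (hO : O ∈ 𝓝 u₀) :
    ∃ χ : Mod m → ℝ, ContDiff ℝ ∞ χ ∧ χ =ᶠ[𝓝 u₀] 1 ∧ tsupport χ ⊆ O ∧ HasCompactSupport χ := by
  obtain ⟨ε, hε, hb⟩ := Metric.nhds_basis_closedBall.mem_iff.1 hO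
  let χ : ContDiffBump u₀ := ⟨ε / 2, ε, by positivity, by linarith⟩
  exact ⟨χ, χ.contDiff, χ.eventuallyEq_one, by rw [χ.tsupport_eq]; exact hb, χ.hasCompactSupport⟩

/-- Hadamard's lemma in the time variable: `g (t, u)` equals `∫₀¹ ∂ₜf (st, u) ds`, also at `t = 0`.
The cutoff in `u` makes `f` smooth on the whole space, as the lemma on parametric integrals
requires. -/
lemma contDiffAt_div_time {m : ℕ} {G : Type} [NormedAddCommGroup G] [NormedSpace ℝ G]
    [CompleteSpace G] {f g : ℝ × Mod m → G} {O : Set (Mod m)} (hO : IsOpen O)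
    (hf : ContDiffOn ℝ ∞ f (Set.univ ×ˢ O)) (hg : ∀ t, ∀ u ∈ O, f (t, u) = f (0, u) + t • g (t, u))
    (hg0 : ∀ u ∈ O, HasDerivAt (fun t => f (t, u)) (g (0, u)) 0) (t₀ : ℝ) {u₀ : Mod m}
    (hu₀ : u₀ ∈ O) : ContDiffAt ℝ ∞ g (t₀, u₀) := by
  obtain ⟨χ, hχ, hχ1, hχO, -⟩ := exists_cutoff (hO.mem_nhds hu₀)
  have hF : ContDiff ℝ ∞ (fun q : ℝ × Mod m => χ q.2 • f q) := by
    rw [contDiff_iff_contDiffAt]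
    rintro ⟨t, u⟩
    by_cases hu : u ∈ O
    · exact (hχ.contDiffAt.comp (t, u) contDiffAt_snd).smul
        (hf.contDiffAt ((isOpen_univ.prod hO).mem_nhds ⟨trivial, hu⟩))
    · have hu' : u ∉ tsupport χ := fun h => hu (hχO h)
      have h0 : (fun q : ℝ × Mod m => χ q.2 • f q) =ᶠ[𝓝 (t, u)] fun _ => 0 := by
        have : Filter.Tendsto (Prod.snd : ℝ × Mod m → Mod m) (𝓝 (t, u)) (𝓝 u) :=
          continuous_snd.tendsto _
        filter_upwards [this.eventually (notMem_tsupport_iff_eventuallyEq.1 hu')] with q hq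
        rw [hq]
        simp
      exact contDiffAt_const.congr_of_eventuallyEq h0
  have hF' : ContDiff ℝ ∞ (fun q : (ℝ × Mod m) × ℝ =>
      fderiv ℝ (fun q : ℝ × Mod m => χ q.2 • f q) (q.2 * q.1.1, q.1.2) (1, 0)) := by
    have h1 : ContDiff ℝ ∞ (fderiv ℝ (fun q : ℝ × Mod m => χ q.2 • f q)) :=
      hF.fderiv_right (by simp)
    exact (h1.comp (by fun_prop)).clm_apply contDiff_const
  refine (contDiff_parametric_integral hF').contDiffAt.congr_of_eventuallyEq ?_
  have hev : ∀ᶠ q : ℝ × Mod m in 𝓝 (t₀, u₀), χ q.2 = 1 ∧ q.2 ∈ O := by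
    have : Filter.Tendsto (Prod.snd : ℝ × Mod m → Mod m) (𝓝 (t₀, u₀)) (𝓝 u₀) :=
      continuous_snd.tendsto _
    exact this.eventually (hχ1.and (hO.mem_nhds hu₀))
  filter_upwards [hev] with ⟨t, u⟩ ⟨h1, h2⟩
  simp only at h1 h2
  have hd : ∀ t : ℝ, HasDerivAt (fun t => f (t, u))
      (fderiv ℝ (fun q : ℝ × Mod m => χ q.2 • f q) (t, u) (1, 0)) t := by
    intro t
    have h3 := ((hF.differentiable (by simp)).differentiableAt (x := (t, u))).hasFDerivAt
    have h4 := h3.comp_hasDerivAt t ((hasDerivAt_id t).prodMk (hasDerivAt_const t u))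
    simpa [Function.comp_def, h1] using h4
  by_cases ht : t = 0
  · subst ht
    simpa using (hg0 u h2).unique (hd 0)
  · have hc : Continuous fun s : ℝ =>
        fderiv ℝ (fun q : ℝ × Mod m => χ q.2 • f q) (s * t, u) (1, 0) :=
      ((hF.continuous_fderiv (by simp)).comp (by fun_prop)).clm_apply continuous_const
    have hd' : ∀ s ∈ Set.uIcc (0 : ℝ) 1, HasDerivAt (fun s : ℝ => f (s * t, u))
        (t • fderiv ℝ (fun q : ℝ × Mod m => χ q.2 • f q) (s * t, u) (1, 0)) s := by
      intro s _
      have h5 : HasDerivAt (fun s : ℝ => s * t) t s := by simpa using (hasDerivAt_id s).mul_const t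
      exact (hd (s * t)).scomp s h5
    have h6 := intervalIntegral.integral_eq_sub_of_hasDerivAt hd'
      ((continuous_const.smul hc).intervalIntegrable _ _)
    rw [intervalIntegral.integral_smul] at h6
    simp only [one_mul, zero_mul] at h6
    have h7 := hg t u h2
    have h8 : t • g (t, u) = t • ∫ s in (0 : ℝ)..1,
        fderiv ℝ (fun q : ℝ × Mod m => χ q.2 • f q) (s * t, u) (1, 0) := by
      rw [h6, h7]
      simp
    exact smul_right_injective G ht h8

end Hadamard

end CovPhase
end

noncomputable section

namespace CovPhase

/-! ### Charts -/

section Charts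

variable {m k p : ℕ} {X : Type*} [TopologicalSpace X] [ChartedSpace (Mod m) X]
  {Y : Type*} [TopologicalSpace Y] [ChartedSpace (Mod k) Y]

/-- The derivative of a chart. -/
def chartD (x₀ x : X) : Mod m →L[ℝ] Mod m := mfderiv (𝓡 m) 𝓘(ℝ, Mod m) (extChartAt (𝓡 m) x₀) x

/-- The derivative of the inverse of a chart. -/
def chartDSymm (x₀ : X) (u : Mod m) : Mod m →L[ℝ] Mod m :=
  mfderiv 𝓘(ℝ, Mod m) (𝓡 m) (extChartAt (𝓡 m) x₀).symm u

/-- The derivative of a map between manifolds, as a map between the model spaces. -/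
def mapD (k m : ℕ) {X : Type*} [TopologicalSpace X] [ChartedSpace (Mod m) X]
    {Y : Type*} [TopologicalSpace Y] [ChartedSpace (Mod k) Y] (f : Y → X) (y : Y) : Mod k →L[ℝ] Mod m := mfderiv (𝓡 k) (𝓡 m) f y

lemma chartRep_eq (x₀ : X) (η : DForm m p X) (u : Mod m) :
    chartRep x₀ η u = ContinuousAlternatingMap.compContinuousLinearMap
      (show Mod m [⋀^Fin p]→L[ℝ] ℝ from η ((extChartAt (𝓡 m) x₀).symm u)) (chartDSymm x₀ u) := rfl

lemma pullback_eq (f : Y → X) (η : DForm m p X) (y : Y) :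
    pullback f η y = ContinuousAlternatingMap.compContinuousLinearMap
      (show Mod m [⋀^Fin p]→L[ℝ] ℝ from η (f y)) (mapD k m f y) := rfl

lemma target_mem_nhds {x₀ : X} {u : Mod m} (hu : u ∈ (extChartAt (𝓡 m) x₀).target) :
    (extChartAt (𝓡 m) x₀).target ∈ 𝓝 u :=
  (isOpen_extChartAt_target x₀).mem_nhds hu

lemma source_mem_nhds {x₀ x : X} (hx : x ∈ (extChartAt (𝓡 m) x₀).source) :
    (extChartAt (𝓡 m) x₀).source ∈ 𝓝 x :=
  (isOpen_extChartAt_source x₀).mem_nhds hx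

/-- A map between manifolds in the preferred charts at `y₀` and `x₀`. -/
def coordMap (k m : ℕ) {X : Type*} [TopologicalSpace X] [ChartedSpace (Mod m) X]
    {Y : Type*} [TopologicalSpace Y] [ChartedSpace (Mod k) Y] (f : Y → X) (y₀ : Y) (x₀ : X) (u : Mod k) : Mod m :=
  extChartAt (𝓡 m) x₀ (f ((extChartAt (𝓡 k) y₀).symm u))

variable [IsManifold (𝓡 m) ∞ X] [IsManifold (𝓡 k) ∞ Y]

lemma contMDiffAt_chart {x₀ x : X} (hx : x ∈ (extChartAt (𝓡 m) x₀).source) :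
    ContMDiffAt (𝓡 m) 𝓘(ℝ, Mod m) ∞ (extChartAt (𝓡 m) x₀) x :=
  contMDiffAt_extChartAt' (by simpa using hx)

lemma contMDiffAt_chart_symm {x₀ : X} {u : Mod m} (hu : u ∈ (extChartAt (𝓡 m) x₀).target) :
    ContMDiffAt 𝓘(ℝ, Mod m) (𝓡 m) ∞ (extChartAt (𝓡 m) x₀).symm u :=
  (contMDiffOn_extChartAt_symm x₀).contMDiffAt (target_mem_nhds hu)

lemma chartD_chartDSymm {x₀ : X} {u : Mod m} (hu : u ∈ (extChartAt (𝓡 m) x₀).target) (v : Mod m) :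
    chartD x₀ ((extChartAt (𝓡 m) x₀).symm u) (chartDSymm x₀ u v) = v := by
  have h1 := (contMDiffAt_chart ((extChartAt (𝓡 m) x₀).map_target hu)).mdifferentiableAt (by simp)
  have h2 := (contMDiffAt_chart_symm hu).mdifferentiableAt (by simp)
  have h3 := mfderiv_comp u h1 h2
  have h4 : extChartAt (𝓡 m) x₀ ∘ (extChartAt (𝓡 m) x₀).symm =ᶠ[𝓝 u] id := by
    filter_upwards [target_mem_nhds hu] with w hw
    exact (extChartAt (𝓡 m) x₀).right_inv hw
  rw [h4.mfderiv_eq, mfderiv_id] at h3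
  exact (congrArg (fun L : Mod m →L[ℝ] Mod m => L v) h3).symm

lemma chartDSymm_chartD {x₀ x : X} (hx : x ∈ (extChartAt (𝓡 m) x₀).source) (v : Mod m) :
    chartDSymm x₀ (extChartAt (𝓡 m) x₀ x) (chartD x₀ x v) = v := by
  have h1 := (contMDiffAt_chart hx).mdifferentiableAt (by simp)
  have h2 := (contMDiffAt_chart_symm ((extChartAt (𝓡 m) x₀).map_source hx)).mdifferentiableAt
    (by simp)
  have h3 := mfderiv_comp x h2 h1
  have h4 : (extChartAt (𝓡 m) x₀).symm ∘ extChartAt (𝓡 m) x₀ =ᶠ[𝓝 x] id := by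
    filter_upwards [source_mem_nhds hx] with w hw
    exact (extChartAt (𝓡 m) x₀).left_inv hw
  rw [h4.mfderiv_eq, mfderiv_id] at h3
  exact (congrArg (fun L : Mod m →L[ℝ] Mod m => L v) h3).symm

/-- The tangent space at `x` is identified with the model space through the preferred chart at `x`
itself. This is why the chart definitions of `extD` and of the bracket carry no Jacobian at the base
point. -/
lemma chartD_self (x : X) : chartD x x = ContinuousLinearMap.id ℝ (Mod m) :=
  have : IsManifold (𝓡 m) 1 X := IsManifold.of_le (n := ∞) (by simp)
  mfderiv_extChartAt_self

lemma chartDSymm_self (x : X) :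
    chartDSymm x (extChartAt (𝓡 m) x x) = ContinuousLinearMap.id ℝ (Mod m) := by
  ext1 v
  have := chartDSymm_chartD (mem_extChartAt_source (I := 𝓡 m) x) v
  rwa [chartD_self] at this

lemma contDiffAt_coordMap {f : Y → X} {y₀ : Y} {x₀ : X} {u : Mod k}
    (hu : u ∈ (extChartAt (𝓡 k) y₀).target)
    (hf : ContMDiffAt (𝓡 k) (𝓡 m) ∞ f ((extChartAt (𝓡 k) y₀).symm u))
    (hx : f ((extChartAt (𝓡 k) y₀).symm u) ∈ (extChartAt (𝓡 m) x₀).source) :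
    ContDiffAt ℝ ∞ (coordMap k m f y₀ x₀) u := by
  rw [← contMDiffAt_iff_contDiffAt]
  exact (contMDiffAt_chart hx).comp u (hf.comp u (contMDiffAt_chart_symm hu))

lemma fderiv_coordMap {f : Y → X} {y₀ : Y} {x₀ : X} {u : Mod k}
    (hu : u ∈ (extChartAt (𝓡 k) y₀).target)
    (hf : ContMDiffAt (𝓡 k) (𝓡 m) ∞ f ((extChartAt (𝓡 k) y₀).symm u))
    (hx : f ((extChartAt (𝓡 k) y₀).symm u) ∈ (extChartAt (𝓡 m) x₀).source) (v : Mod k) :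
    fderiv ℝ (coordMap k m f y₀ x₀) u v =
      chartD x₀ (f ((extChartAt (𝓡 k) y₀).symm u))
        (mapD k m f ((extChartAt (𝓡 k) y₀).symm u) (chartDSymm y₀ u v)) := by
  have h1 := (contMDiffAt_chart hx).mdifferentiableAt (by simp)
  have h2 := hf.mdifferentiableAt (by simp)
  have h3 := (contMDiffAt_chart_symm hu).mdifferentiableAt (by simp)
  have h4 := mfderiv_comp u h1 (h2.comp u h3)
  rw [mfderiv_comp u h2 h3] at h4
  rw [← mfderiv_eq_fderiv]
  exact congrArg (fun L : Mod k →L[ℝ] Mod m => L v) h4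

lemma chartRep_pullback {f : Y → X} {y₀ : Y} {x₀ : X} {u : Mod k} (η : DForm m p X)
    (hu : u ∈ (extChartAt (𝓡 k) y₀).target)
    (hf : ContMDiffAt (𝓡 k) (𝓡 m) ∞ f ((extChartAt (𝓡 k) y₀).symm u))
    (hx : f ((extChartAt (𝓡 k) y₀).symm u) ∈ (extChartAt (𝓡 m) x₀).source) :
    chartRep y₀ (pullback f η) u =
      (chartRep x₀ η (coordMap k m f y₀ x₀ u)).compContinuousLinearMap
        (fderiv ℝ (coordMap k m f y₀ x₀) u) := by
  ext v
  have h1 : (extChartAt (𝓡 m) x₀).symm (coordMap k m f y₀ x₀ u) =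
    f ((extChartAt (𝓡 k) y₀).symm u) := (extChartAt (𝓡 m) x₀).left_inv hx
  have h2 : ∀ a, chartDSymm x₀ (coordMap k m f y₀ x₀ u) (fderiv ℝ (coordMap k m f y₀ x₀) u (v a)) =
      mapD k m f ((extChartAt (𝓡 k) y₀).symm u) (chartDSymm y₀ u (v a)) := by
    intro a
    rw [fderiv_coordMap hu hf hx]
    exact chartDSymm_chartD hx _
  let η' : X → Mod m [⋀^Fin p]→L[ℝ] ℝ := η
  change η' (f ((extChartAt (𝓡 k) y₀).symm u))
      (fun a => mapD k m f ((extChartAt (𝓡 k) y₀).symm u) (chartDSymm y₀ u (v a))) =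
    η' ((extChartAt (𝓡 m) x₀).symm (coordMap k m f y₀ x₀ u))
      (fun a => chartDSymm x₀ (coordMap k m f y₀ x₀ u) (fderiv ℝ (coordMap k m f y₀ x₀) u (v a)))
  rw [h1]
  simp only [h2]

lemma eq_chartRep (η : DForm m p X) (x : X) :
    (η x : Mod m [⋀^Fin p]→L[ℝ] ℝ) = chartRep x η (extChartAt (𝓡 m) x x) := by
  let η' : X → Mod m [⋀^Fin p]→L[ℝ] ℝ := η
  have h : (extChartAt (𝓡 m) x).symm (extChartAt (𝓡 m) x x) = x := extChartAt_to_inv x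
  rw [chartRep_eq, chartDSymm_self]
  change η' x = ContinuousAlternatingMap.compContinuousLinearMap (η' ((extChartAt (𝓡 m) x).symm (extChartAt (𝓡 m) x x))) _
  rw [h]
  rfl

lemma extD_eq (η : DForm m p X) (x : X) :
    extD η x = extDeriv (chartRep x η) (extChartAt (𝓡 m) x x) := by
  have : extD η x = ContinuousAlternatingMap.compContinuousLinearMap
    (extDeriv (chartRep x η) (extChartAt (𝓡 m) x x)) (chartD x x) := rfl
  rw [this, chartD_self]
  rfl

lemma chartRep_model (u₀ : Mod m) (η : DForm m p (Mod m)) (u : Mod m) : chartRep u₀ η u = η u := by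
  rw [chartRep_eq]
  have h : chartDSymm u₀ u = ContinuousLinearMap.id ℝ (Mod m) := by
    exact mfderiv_id
  rw [h]
  rfl

/-- Naturality of `extDeriv` between model spaces, applied to the map read in the preferred charts
at `y` and `f y`, whose derivatives at these points are identities. -/
lemma extD_pullback {f : Y → X} {η : DForm m p X} {y : Y}
    (hf : ∀ᶠ y' in 𝓝 y, ContMDiffAt (𝓡 k) (𝓡 m) ∞ f y')
    (hη : DifferentiableAt ℝ (chartRep (f y) η) (extChartAt (𝓡 m) (f y) (f y))) :
    extD (pullback (k := k) f η) y = pullback f (extD η) y := by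
  have hy := mem_extChartAt_source (I := 𝓡 k) y
  have hfy := mem_extChartAt_source (I := 𝓡 m) (f y)
  have hsymm : (extChartAt (𝓡 k) y).symm (extChartAt (𝓡 k) y y) = y := extChartAt_to_inv y
  have hut := mem_extChartAt_target (I := 𝓡 k) y
  have hcs : ContinuousAt (extChartAt (𝓡 k) y).symm (extChartAt (𝓡 k) y y) :=
    (contMDiffAt_chart_symm hut).continuousAt
  have hev : ∀ᶠ y' in 𝓝 y, ContMDiffAt (𝓡 k) (𝓡 m) ∞ f y' ∧
      f y' ∈ (extChartAt (𝓡 m) (f y)).source :=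
    hf.and (hf.self_of_nhds.continuousAt.eventually (source_mem_nhds hfy))
  have h1 : chartRep y (pullback f η) =ᶠ[𝓝 (extChartAt (𝓡 k) y y)] fun u =>
      (chartRep (f y) η (coordMap k m f y (f y) u)).compContinuousLinearMap
        (fderiv ℝ (coordMap k m f y (f y)) u) := by
    have h2 := hcs.eventually (p := fun y' => ContMDiffAt (𝓡 k) (𝓡 m) ∞ f y' ∧
      f y' ∈ (extChartAt (𝓡 m) (f y)).source) (by rw [hsymm]; exact hev)
    filter_upwards [h2, target_mem_nhds hut] with u hu hu'
    exact chartRep_pullback η hu' hu.1 hu.2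
  have hF : coordMap k m f y (f y) (extChartAt (𝓡 k) y y) = extChartAt (𝓡 m) (f y) (f y) := by
    rw [coordMap, hsymm]
  rw [extD_eq, h1.extDeriv_eq, extDeriv_pullback (r := ∞) (by rw [hF]; exact hη)
    (contDiffAt_coordMap hut (by rw [hsymm]; exact hf.self_of_nhds) (by rw [hsymm]; exact hfy))
    (by rw [minSmoothness_of_isRCLikeNormedField]; exact WithTop.coe_le_coe.2 le_top), hF,
    ← extD_eq, pullback_eq]
  congr 1
  ext1 v
  rw [fderiv_coordMap hut (by rw [hsymm]; exact hf.self_of_nhds) (by rw [hsymm]; exact hfy), hsymm,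
    chartDSymm_self, chartD_self]
  rfl

/-- Chart independence of the exterior derivative: `extD` uses a different chart at every point, and
naturality under the inverse chart, seen as a map out of `ℝᵐ`, transports the result to one fixed
chart. -/
lemma chartRep_extD {x₀ : X} {u : Mod m} {η : DForm m p X}
    (hu : u ∈ (extChartAt (𝓡 m) x₀).target)
    (hη : DifferentiableAt ℝ (chartRep ((extChartAt (𝓡 m) x₀).symm u) η)
      (extChartAt (𝓡 m) ((extChartAt (𝓡 m) x₀).symm u) ((extChartAt (𝓡 m) x₀).symm u))) :
    chartRep x₀ (extD η) u = extDeriv (chartRep x₀ η) u := by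
  have h := extD_pullback (k := m) (Y := Mod m) (f := (extChartAt (𝓡 m) x₀).symm) (η := η) (y := u)
    (by filter_upwards [target_mem_nhds hu] with w hw using contMDiffAt_chart_symm hw) hη
  have h2 : chartRep u (pullback (k := m) (extChartAt (𝓡 m) x₀).symm η) = chartRep x₀ η := by
    ext1 w
    rw [chartRep_model]
    rfl
  rw [extD_eq, h2] at h
  exact h.symm

/-! ### Smoothness of forms and of curves of forms -/

/-- The coordinate expression of a vector field. -/
def vecRep (x₀ : X) (v : RawVF m X) (u : Mod m) : Mod m :=
  chartD x₀ ((extChartAt (𝓡 m) x₀).symm u) (v ((extChartAt (𝓡 m) x₀).symm u))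

/-- A curve of vector fields whose coordinate expressions are jointly smooth. -/
def SmoothRawCurve (v : ℝ → RawVF m X) : Prop :=
  ∀ x₀ : X, ∀ t : ℝ, ∀ u ∈ (extChartAt (𝓡 m) x₀).target,
    ContDiffAt ℝ ∞ (fun q : ℝ × Mod m => vecRep x₀ (v q.1) q.2) (t, u)

lemma formCurves_smooth_iff {c : ℝ → DForm m p X} : (formCurves m p X).smooth c ↔
    ∀ x₀ : X, ∀ t : ℝ, ∀ u ∈ (extChartAt (𝓡 m) x₀).target,
      ContDiffAt ℝ ∞ (fun q : ℝ × Mod m => chartRep x₀ (c q.1) q.2) (t, u) := by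
  have ho : ∀ x₀ : X, IsOpen (Set.univ ×ˢ (extChartAt (𝓡 m) x₀).target : Set (ℝ × Mod m)) :=
    fun x₀ => isOpen_univ.prod (isOpen_extChartAt_target x₀)
  constructor
  · intro h x₀ t u hu
    exact (h x₀).contDiffAt ((ho x₀).mem_nhds ⟨trivial, hu⟩)
  · rintro h x₀ ⟨t, u⟩ ⟨-, hu⟩
    exact (h x₀ t u hu).contDiffWithinAt

lemma isSmoothForm_iff {η : DForm m p X} : IsSmoothForm η ↔
    ∀ x₀ : X, ∀ u ∈ (extChartAt (𝓡 m) x₀).target, ContDiffAt ℝ ∞ (chartRep x₀ η) u := by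
  constructor
  · intro h x₀ u hu
    exact (h x₀).contDiffAt (target_mem_nhds hu)
  · intro h x₀ u hu
    exact (h x₀ u hu).contDiffWithinAt

/-- Together with `SmoothFormCurve.apply`, this makes closure properties of smooth forms special
cases of those of smooth curves of forms. -/
lemma IsSmoothForm.const_curve {η : DForm m p X} (h : IsSmoothForm η) :
    (formCurves m p X).smooth (fun _ => η) := by
  rw [formCurves_smooth_iff]
  intro x₀ t u hu
  exact (isSmoothForm_iff.1 h x₀ u hu).comp (t, u) contDiffAt_snd

lemma SmoothFormCurve.apply {c : ℝ → DForm m p X} (h : (formCurves m p X).smooth c) (t : ℝ) :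
    IsSmoothForm (c t) := by
  rw [isSmoothForm_iff]
  intro x₀ u hu
  exact (formCurves_smooth_iff.1 h x₀ t u hu).comp u (f := fun w => (t, w))
    (contDiffAt_const.prodMk contDiffAt_id)

lemma chartRep_add (x₀ : X) (η θ : DForm m p X) (u : Mod m) :
    chartRep x₀ (η + θ) u = chartRep x₀ η u + chartRep x₀ θ u := rfl

lemma SmoothFormCurve.add {c d : ℝ → DForm m p X} (hc : (formCurves m p X).smooth c)
    (hd : (formCurves m p X).smooth d) : (formCurves m p X).smooth (fun t => c t + d t) := by
  rw [formCurves_smooth_iff] at *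
  exact fun x₀ t u hu => (hc x₀ t u hu).add (hd x₀ t u hu)

lemma SmoothFormCurve.sub {c d : ℝ → DForm m p X} (hc : (formCurves m p X).smooth c)
    (hd : (formCurves m p X).smooth d) : (formCurves m p X).smooth (fun t => c t - d t) := by
  rw [formCurves_smooth_iff] at *
  exact fun x₀ t u hu => (hc x₀ t u hu).sub (hd x₀ t u hu)

lemma SmoothFormCurve.pullback {f : Y → X} (hf : ContMDiff (𝓡 k) (𝓡 m) ∞ f) {c : ℝ → DForm m p X}
    (hc : (formCurves m p X).smooth c) :
    (formCurves k p Y).smooth (fun t => CovPhase.pullback f (c t)) := by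
  rw [formCurves_smooth_iff] at *
  intro y₀ t u hu
  set y := (extChartAt (𝓡 k) y₀).symm u with hy
  have hx := mem_extChartAt_source (I := 𝓡 m) (f y)
  have hF := contDiffAt_coordMap (x₀ := f y) hu (hf.contMDiffAt) hx
  have hG : ContDiffAt ℝ ∞ (fun q : ℝ × Mod k =>
      (chartRep (f y) (c q.1) (coordMap k m f y₀ (f y) q.2)).compContinuousLinearMap
        (fderiv ℝ (coordMap k m f y₀ (f y)) q.2)) (t, u) := by
    refine contDiffAt_compCLM ?_ ?_
    · have h1 := hc (f y) t (coordMap k m f y₀ (f y) u) ((extChartAt (𝓡 m) (f y)).map_source hx)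
      exact h1.comp (t, u) (f := fun q : ℝ × Mod k => (q.1, coordMap k m f y₀ (f y) q.2))
        (contDiffAt_fst.prodMk (ContDiffAt.comp (g := coordMap k m f y₀ (f y)) (t, u) hF
          contDiffAt_snd))
    · have h2 : ContDiffAt ℝ ∞ (fderiv ℝ (coordMap k m f y₀ (f y))) u := hF.fderiv_right (by simp)
      exact h2.comp (t, u) contDiffAt_snd
  refine hG.congr_of_eventuallyEq ?_
  have hcont : ContinuousAt (fun w => f ((extChartAt (𝓡 k) y₀).symm w)) u :=
    ContinuousAt.comp (hf.continuous.continuousAt) (contMDiffAt_chart_symm hu).continuousAt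
  have hev : ∀ᶠ w in 𝓝 u, w ∈ (extChartAt (𝓡 k) y₀).target ∧
      f ((extChartAt (𝓡 k) y₀).symm w) ∈ (extChartAt (𝓡 m) (f y)).source :=
    (Filter.eventually_mem_set.2 (target_mem_nhds hu)).and (hcont.eventually (source_mem_nhds hx))
  have : Filter.Tendsto (Prod.snd : ℝ × Mod k → Mod k) (𝓝 (t, u)) (𝓝 u) := continuous_snd.tendsto _
  filter_upwards [this.eventually hev] with q hq
  exact chartRep_pullback _ hq.1 hf.contMDiffAt hq.2

lemma chartRep_intProd {x₀ : X} {u : Mod m} (hu : u ∈ (extChartAt (𝓡 m) x₀).target)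
    (v : RawVF m X) (η : DForm m (p + 1) X) :
    chartRep x₀ (intProd v η) u = (chartRep x₀ η u).curryLeft (vecRep x₀ v u) := by
  rw [chartRep_eq, chartRep_eq, curryLeft_compCLM]
  have h : chartDSymm x₀ u (vecRep x₀ v u) = v ((extChartAt (𝓡 m) x₀).symm u) := by
    have h1 := chartDSymm_chartD ((extChartAt (𝓡 m) x₀).map_target hu)
      (v ((extChartAt (𝓡 m) x₀).symm u))
    rwa [(extChartAt (𝓡 m) x₀).right_inv hu] at h1
  rw [h]
  rfl

lemma SmoothFormCurve.intProd {v : ℝ → RawVF m X} (hv : SmoothRawCurve v)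
    {c : ℝ → DForm m (p + 1) X} (hc : (formCurves m (p + 1) X).smooth c) :
    (formCurves m p X).smooth (fun t => CovPhase.intProd (v t) (c t)) := by
  rw [formCurves_smooth_iff] at *
  intro x₀ t u hu
  refine (contDiffAt_curryLeft (hc x₀ t u hu) (hv x₀ t u hu)).congr_of_eventuallyEq ?_
  have : Filter.Tendsto (Prod.snd : ℝ × Mod m → Mod m) (𝓝 (t, u)) (𝓝 u) := continuous_snd.tendsto _
  filter_upwards [this.eventually (target_mem_nhds hu)] with q hq
  exact chartRep_intProd hq _ _

lemma IsSmoothForm.differentiableAt {η : DForm m p X} (h : IsSmoothForm η) {x₀ : X} {u : Mod m}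
    (hu : u ∈ (extChartAt (𝓡 m) x₀).target) : DifferentiableAt ℝ (chartRep x₀ η) u :=
  (isSmoothForm_iff.1 h x₀ u hu).differentiableAt (by simp)

lemma IsSmoothForm.chartRep_extD {η : DForm m p X} (h : IsSmoothForm η) {x₀ : X} {u : Mod m}
    (hu : u ∈ (extChartAt (𝓡 m) x₀).target) :
    chartRep x₀ (extD η) u = extDeriv (chartRep x₀ η) u :=
  CovPhase.chartRep_extD hu (h.differentiableAt (mem_extChartAt_target _))

lemma IsSmoothForm.extD {η : DForm m p X} (h : IsSmoothForm η) : IsSmoothForm (extD η) := by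
  rw [isSmoothForm_iff]
  intro x₀ u hu
  refine (contDiffAt_extDeriv (isSmoothForm_iff.1 h x₀ u hu)).congr_of_eventuallyEq ?_
  filter_upwards [target_mem_nhds hu] with w hw
  exact h.chartRep_extD hw

lemma IsSmoothForm.extD_pullback {f : Y → X} (hf : ContMDiff (𝓡 k) (𝓡 m) ∞ f) {η : DForm m p X}
    (h : IsSmoothForm η) : CovPhase.extD (pullback (k := k) f η) = pullback f (CovPhase.extD η) :=
  funext fun _ => CovPhase.extD_pullback (Filter.Eventually.of_forall fun _ => hf.contMDiffAt)
    (h.differentiableAt (mem_extChartAt_target _))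

end Charts
end CovPhase
end

noncomputable section

namespace CovPhase

/-! ### Time-dependent vector fields in charts, Cartan calculus on manifolds, immersions. -/

section VectorCalculus

variable {m k p : ℕ} {X : Type*} [TopologicalSpace X] [ChartedSpace (Mod m) X]
  {Y : Type*} [TopologicalSpace Y] [ChartedSpace (Mod k) Y]
  [IsManifold (𝓡 m) ∞ X] [IsManifold (𝓡 k) ∞ Y]

lemma contDiffAt_iff_contMDiffAt_prod {G : Type*} [NormedAddCommGroup G] [NormedSpace ℝ G]
    {f : ℝ × Mod m → G} {z : ℝ × Mod m} :
    ContDiffAt ℝ ∞ f z ↔ ContMDiffAt (𝓘(ℝ, ℝ).prod 𝓘(ℝ, Mod m)) 𝓘(ℝ, G) ∞ f z := by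
  rw [← contMDiffAt_iff_contDiffAt, modelWithCornersSelf_prod, ← chartedSpaceSelf_prod]

/-- Smoothness of a function of time and position, in a chart. -/
lemma contMDiffAt_time_iff {G : Type*} [NormedAddCommGroup G] [NormedSpace ℝ G] {g : ℝ × X → G}
    {x₀ x : X} (hx : x ∈ (extChartAt (𝓡 m) x₀).source) (t : ℝ) :
    ContMDiffAt (𝓘(ℝ, ℝ).prod (𝓡 m)) 𝓘(ℝ, G) ∞ g (t, x) ↔
      ContDiffAt ℝ ∞ (fun q : ℝ × Mod m => g (q.1, (extChartAt (𝓡 m) x₀).symm q.2))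
        (t, extChartAt (𝓡 m) x₀ x) := by
  have hinv := (extChartAt (𝓡 m) x₀).left_inv hx
  have ht := (extChartAt (𝓡 m) x₀).map_source hx
  rw [contDiffAt_iff_contMDiffAt_prod]
  constructor
  · intro h
    have h1 : ContMDiffAt (𝓘(ℝ, ℝ).prod 𝓘(ℝ, Mod m)) (𝓘(ℝ, ℝ).prod (𝓡 m)) ∞
        (fun q : ℝ × Mod m => (q.1, (extChartAt (𝓡 m) x₀).symm q.2))
        (t, extChartAt (𝓡 m) x₀ x) :=
      contMDiffAt_fst.prodMk ((contMDiffAt_chart_symm ht).comp (t, extChartAt (𝓡 m) x₀ x)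
        contMDiffAt_snd)
    refine ContMDiffAt.comp (g := g) (t, extChartAt (𝓡 m) x₀ x) ?_ h1
    change ContMDiffAt _ _ _ g (t, (extChartAt (𝓡 m) x₀).symm (extChartAt (𝓡 m) x₀ x))
    rwa [hinv]
  · intro h
    have h1 : ContMDiffAt (𝓘(ℝ, ℝ).prod (𝓡 m)) (𝓘(ℝ, ℝ).prod 𝓘(ℝ, Mod m)) ∞
        (fun q : ℝ × X => (q.1, extChartAt (𝓡 m) x₀ q.2)) (t, x) :=
      contMDiffAt_fst.prodMk ((contMDiffAt_chart hx).comp (t, x) contMDiffAt_snd)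
    have h2 := ContMDiffAt.comp (t, x) h h1
    refine h2.congr_of_eventuallyEq ?_
    have : Filter.Tendsto (Prod.snd : ℝ × X → X) (𝓝 (t, x)) (𝓝 x) := continuous_snd.tendsto _
    filter_upwards [this.eventually (source_mem_nhds hx)] with q hq
    simp only [Function.comp_apply]
    rw [(extChartAt (𝓡 m) x₀).left_inv hq]

/-- The fibre part of the tangent bundle trivialization at `x₀` is the derivative of the chart at
`x₀`, so smoothness into the bundle is smoothness of `vecRep`. -/
lemma contMDiffAt_tangent_iff {v : ℝ → RawVF m X} {x₀ x : X} {t : ℝ}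
    (hx : x ∈ (extChartAt (𝓡 m) x₀).source) :
    ContMDiffAt (𝓘(ℝ, ℝ).prod (𝓡 m)) (𝓡 m).tangent ∞
        (fun q : ℝ × X => (⟨q.2, v q.1 q.2⟩ : TangentBundle (𝓡 m) X)) (t, x) ↔
      ContDiffAt ℝ ∞ (fun q : ℝ × Mod m => vecRep x₀ (v q.1) q.2) (t, extChartAt (𝓡 m) x₀ x) := by
  have hx' : x ∈ (chartAt (Mod m) x₀).source := by simpa using hx
  rw [Bundle.Trivialization.contMDiffAt_iff (e := trivializationAt (Mod m) (TangentSpace (𝓡 m)) x₀)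
    (by rw [Bundle.Trivialization.mem_source]; exact hx'),
    and_iff_right contMDiffAt_snd]
  have h1 : (fun q : ℝ × X => (trivializationAt (Mod m) (TangentSpace (𝓡 m)) x₀
      (⟨q.2, v q.1 q.2⟩ : TangentBundle (𝓡 m) X)).2) =ᶠ[𝓝 (t, x)]
      fun q => chartD x₀ q.2 (v q.1 q.2) := by
    have : Filter.Tendsto (Prod.snd : ℝ × X → X) (𝓝 (t, x)) (𝓝 x) := continuous_snd.tendsto _
    filter_upwards [this.eventually (source_mem_nhds hx)] with q hq
    have hq' : q.2 ∈ (chartAt (Mod m) x₀).source := by rwa [← extChartAt_source (𝓡 m)]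
    have : IsManifold (𝓡 m) 1 X := IsManifold.of_le (n := ∞) (by simp)
    have h2 := TangentBundle.continuousLinearMapAt_trivializationAt (I := 𝓡 m) hq'
    have h3 := congrArg (fun L : Mod m →L[ℝ] Mod m => L (v q.1 q.2)) h2
    refine Eq.trans ?_ h3
    exact (congrFun (Bundle.Trivialization.coe_linearMapAt_of_mem (R := ℝ)
      (trivializationAt (Mod m) (TangentSpace (𝓡 m)) x₀) hq') (v q.1 q.2)).symm
  rw [h1.contMDiffAt_iff, contMDiffAt_time_iff (g := fun q : ℝ × X => chartD x₀ q.2 (v q.1 q.2)) hx]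
  rfl

lemma contMDiff_tangent_iff {v : ℝ → RawVF m X} :
    ContMDiff (𝓘(ℝ, ℝ).prod (𝓡 m)) (𝓡 m).tangent ∞
      (fun q : ℝ × X => (⟨q.2, v q.1 q.2⟩ : TangentBundle (𝓡 m) X)) ↔ SmoothRawCurve v := by
  constructor
  · intro h x₀ t u hu
    have h1 := (contMDiffAt_tangent_iff ((extChartAt (𝓡 m) x₀).map_target hu)).1 (h (t, _))
    rwa [(extChartAt (𝓡 m) x₀).right_inv hu] at h1
  · rintro h ⟨t, x⟩
    exact (contMDiffAt_tangent_iff (mem_extChartAt_source x)).2 (h x t _ (mem_extChartAt_target x))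

lemma SmoothRawCurve.apply {v : ℝ → RawVF m X} (hv : SmoothRawCurve v) (t : ℝ) {x₀ : X} {u : Mod m}
    (hu : u ∈ (extChartAt (𝓡 m) x₀).target) : ContDiffAt ℝ ∞ (vecRep x₀ (v t)) u :=
  (hv x₀ t u hu).comp u (f := fun w => (t, w)) (contDiffAt_const.prodMk contDiffAt_id)

lemma chartRep_intProd_eventuallyEq {x₀ : X} {u : Mod m} (hu : u ∈ (extChartAt (𝓡 m) x₀).target)
    (v : RawVF m X) (η : DForm m (p + 1) X) :
    chartRep x₀ (intProd v η) =ᶠ[𝓝 u] fun u => (chartRep x₀ η u).curryLeft (vecRep x₀ v u) := by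
  filter_upwards [target_mem_nhds hu] with w hw using chartRep_intProd hw v η

lemma vecRep_self (v : RawVF m X) (x : X) : vecRep x v (extChartAt (𝓡 m) x x) = v x := by
  have h : (extChartAt (𝓡 m) x).symm (extChartAt (𝓡 m) x x) = x := extChartAt_to_inv x
  rw [vecRep, h, chartD_self]
  rfl

lemma ContDiffAt.one_of_infty {E F : Type*} [NormedAddCommGroup E] [NormedSpace ℝ E]
    [NormedAddCommGroup F] [NormedSpace ℝ F] {f : E → F} {x : E} (h : ContDiffAt ℝ ∞ f x) :
    ContDiffAt ℝ 1 f x := h.of_le (by simp)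

/-- Cartan's formula in coordinates. -/
lemma lieForm_apply {V : RawVF m X} (hV : SmoothRawCurve fun _ => V) {η : DForm m p X}
    (hη : IsSmoothForm η) (x : X) (w : Fin p → Mod m) :
    (show Mod m [⋀^Fin p]→L[ℝ] ℝ from lieForm V η x) w =
      coordLie (vecRep x V) (chartRep x η) (extChartAt (𝓡 m) x x) w := by
  have hx := mem_extChartAt_target (I := 𝓡 m) x
  cases p with
  | zero =>
    rw [← coordLie_zero, vecRep_self, ← extD_eq]
    rfl
  | succ p =>
    rw [← coordLie_eq (ContDiffAt.one_of_infty (isSmoothForm_iff.1 hη x _ hx))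
      (ContDiffAt.one_of_infty (hV.apply 0 hx)),
      ← (chartRep_intProd_eventuallyEq hx V η).extDeriv_eq, vecRep_self, ← extD_eq, ← extD_eq]
    rfl

lemma coordLie_congr {V : Mod m → Mod m} {η θ : Mod m → Mod m [⋀^Fin p]→L[ℝ] ℝ} {x : Mod m}
    (h : η =ᶠ[𝓝 x] θ) (w : Fin p → Mod m) : coordLie V η x w = coordLie V θ x w := by
  rw [coordLie, coordLie, h.fderiv_eq, h.self_of_nhds]

/-- `VectorField.mlieBracket` pulls the fields back by the inverse chart at `x`. Inverting the
derivative of that map gives the derivative of the chart, so the pulled back fields are the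
`vecRep`s, and the final transport to `x` is the identity. -/
lemma mlieBracket_eq (v w : RawVF m X) (x : X) :
    VectorField.mlieBracket (𝓡 m) v w x =
      VectorField.lieBracket ℝ (vecRep x v) (vecRep x w) (extChartAt (𝓡 m) x x) := by
  have hx := mem_extChartAt_target (I := 𝓡 m) x
  have hv : ∀ v : RawVF m X, VectorField.mpullbackWithin 𝓘(ℝ, Mod m) (𝓡 m)
      (extChartAt (𝓡 m) x).symm v (Set.range (𝓡 m)) =ᶠ[𝓝 (extChartAt (𝓡 m) x x)] vecRep x v := by
    intro v
    filter_upwards [target_mem_nhds hx] with u hu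
    rw [VectorField.mpullbackWithin_apply]
    have hr : Set.range (𝓡 m) = Set.univ := ModelWithCorners.range_eq_univ _
    rw [hr, mfderivWithin_univ]
    have h1 : (chartDSymm x u).inverse = chartD x ((extChartAt (𝓡 m) x).symm u) := by
      refine ContinuousLinearMap.inverse_eq ?_ ?_
      · ext1 z
        have := chartDSymm_chartD ((extChartAt (𝓡 m) x).map_target hu) z
        rwa [(extChartAt (𝓡 m) x).right_inv hu] at this
      · ext1 z
        exact chartD_chartDSymm hu z
    exact congrArg (fun L : Mod m →L[ℝ] Mod m => L (v ((extChartAt (𝓡 m) x).symm u))) h1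
  have hr : (extChartAt (𝓡 m) x).symm ⁻¹' Set.univ ∩ Set.range (𝓡 m) = Set.univ := by simp
  have key : ∀ (V W : Mod m → Mod m) (s : Set (Mod m)), s = Set.univ →
      V =ᶠ[𝓝 (extChartAt (𝓡 m) x x)] vecRep x v → W =ᶠ[𝓝 (extChartAt (𝓡 m) x x)] vecRep x w →
      (chartD x x).inverse (VectorField.lieBracketWithin ℝ V W s (extChartAt (𝓡 m) x x)) =
        VectorField.lieBracket ℝ (vecRep x v) (vecRep x w) (extChartAt (𝓡 m) x x) := by
    rintro V W s rfl hV hW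
    rw [chartD_self, ContinuousLinearMap.inverse_id, VectorField.lieBracketWithin_univ,
      hV.lieBracket_vectorField_eq hW]
    rfl
  exact key _ _ _ hr (hv v) (hv w)

/-- `£_V i_W = i_W £_V + i_[V, W]`. -/
lemma lieForm_intProd {V W : RawVF m X} (hV : SmoothRawCurve fun _ => V)
    (hW : SmoothRawCurve fun _ => W) {η : DForm m (p + 1) X} (hη : IsSmoothForm η) :
    lieForm V (intProd W η) =
      intProd W (lieForm V η) + intProd (VectorField.mlieBracket (𝓡 m) V W) η := by
  funext x
  have hx := mem_extChartAt_target (I := 𝓡 m) x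
  have hWη : IsSmoothForm (intProd W η) :=
    SmoothFormCurve.apply (SmoothFormCurve.intProd hW hη.const_curve) 0
  refine ContinuousAlternatingMap.ext fun w => ?_
  have h1 := (lieForm_apply hV hWη x w).trans
    (coordLie_congr (chartRep_intProd_eventuallyEq hx W η) w)
  have h2 := coordLie_curryLeft (V := vecRep x V) (ContDiffAt.one_of_infty (isSmoothForm_iff.1 hη x _ hx))
    (ContDiffAt.one_of_infty (hW.apply 0 hx)) w
  rw [← lieForm_apply hV hη, ← mlieBracket_eq, vecRep_self, ← eq_chartRep] at h2
  exact h1.trans h2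

/-! ### Vector fields tangent to an immersed hypersurface -/

/-- In adapted charts an immersion is the inclusion of a factor; the left inverse is the projection
onto that factor. It is smooth near `f y`, and not merely at it, because the target of the extended
chart of the domain is open. -/
lemma exists_local_leftInverse {f : Y → X} (hf : Manifold.IsImmersion (𝓡 k) (𝓡 m) ∞ f) (y : Y) :
    ∃ r : X → Y, (∀ᶠ x in 𝓝 (f y), ContMDiffAt (𝓡 m) (𝓡 k) ∞ r x) ∧ ∀ᶠ z in 𝓝 y, r (f z) = z := by
  have h := hf.isImmersionAt y
  refine ⟨fun x => (h.domChart.extend (𝓡 k)).symm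
    (h.equiv.symm (h.codChart.extend (𝓡 m) x)).1, ?_, ?_⟩
  · have ht : (h.domChart.extend (𝓡 k)).target = (𝓡 k) '' h.domChart.target := by
      rw [OpenPartialHomeomorph.extend_target']
    have ho : IsOpen (h.domChart.extend (𝓡 k)).target := h.domChart.isOpen_extend_target
    have h0 : ContMDiffAt (𝓡 m) 𝓘(ℝ, Mod m) ∞ (h.codChart.extend (𝓡 m)) (f y) :=
      OpenPartialHomeomorph.contMDiffAt_extend h.codChart_mem_maximalAtlas h.mem_codChart_source
    have h1 : ContinuousAt (fun x => (h.equiv.symm (h.codChart.extend (𝓡 m) x)).1) (f y) :=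
      (continuous_fst.comp h.equiv.symm.continuous).continuousAt.comp h0.continuousAt
    have h2 : (h.equiv.symm (h.codChart.extend (𝓡 m) (f y))).1 ∈
        (h.domChart.extend (𝓡 k)).target := by
      have hz' : y ∈ (h.domChart.extend (𝓡 k)).source := by
        rw [h.domChart.extend_source]; exact h.mem_domChart_source
      have h1 := h.writtenInCharts ((h.domChart.extend (𝓡 k)).map_source hz')
      simp only [Function.comp_apply] at h1
      rw [(h.domChart.extend (𝓡 k)).left_inv hz'] at h1
      rw [h1, ContinuousLinearEquiv.symm_apply_apply]
      exact (h.domChart.extend (𝓡 k)).map_source hz'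
    filter_upwards [h1.eventually (ho.mem_nhds h2),
      h.codChart.open_source.mem_nhds h.mem_codChart_source] with x hx hx'
    have h3 : ContMDiffAt (𝓡 m) 𝓘(ℝ, Mod m) ∞ (h.codChart.extend (𝓡 m)) x :=
      OpenPartialHomeomorph.contMDiffAt_extend h.codChart_mem_maximalAtlas hx'
    have h4 : ContDiff ℝ ∞ (fun z : Mod m => (h.equiv.symm z).1) :=
      contDiff_fst.comp h.equiv.symm.contDiff
    have h5 := (contMDiffOn_extend_symm h.domChart_mem_maximalAtlas).contMDiffAt (x := (h.equiv.symm (h.codChart.extend (𝓡 m) x)).1)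
      (by rw [← ht]; exact ho.mem_nhds hx)
    exact h5.comp x (h4.contMDiff.contMDiffAt.comp x h3)
  · filter_upwards [h.domChart.open_source.mem_nhds h.mem_domChart_source] with z hz
    have hz' : z ∈ (h.domChart.extend (𝓡 k)).source := by rwa [h.domChart.extend_source]
    have h1 := h.writtenInCharts ((h.domChart.extend (𝓡 k)).map_source hz')
    simp only [Function.comp_apply] at h1
    rw [(h.domChart.extend (𝓡 k)).left_inv hz'] at h1
    rw [h1]
    simpa using h.domChart.left_inv hz

variable {f : Y → X} (hf : Manifold.IsImmersion (𝓡 k) (𝓡 m) ∞ f)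
include hf

lemma mapD_injective (y : Y) : Function.Injective (mapD k m f y) := by
  obtain ⟨r, hr, hrf⟩ := exists_local_leftInverse hf y
  have h1 := mfderiv_comp y (hr.self_of_nhds.mdifferentiableAt (by simp))
    (hf.contMDiff.contMDiffAt.mdifferentiableAt (x := y) (by simp))
  have h2 : r ∘ f =ᶠ[𝓝 y] id := hrf
  rw [h2.mfderiv_eq, mfderiv_id] at h1
  refine Function.LeftInverse.injective (g := mapD m k r (f y)) fun v => ?_
  exact (congrArg (fun L : Mod k →L[ℝ] Mod k => L v) h1).symm

end VectorCalculus

/-! ### Restriction of tangent vector fields: smoothness, velocity and bracket. -/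

section Restriction

variable {m k p : ℕ} {X : Type*} [TopologicalSpace X] [ChartedSpace (Mod m) X]
  {Y : Type*} [TopologicalSpace Y] [ChartedSpace (Mod k) Y]
  [IsManifold (𝓡 m) ∞ X] [IsManifold (𝓡 k) ∞ Y]

lemma vfCurves_smooth_iff {c : ℝ → VF m X} :
    (vfCurves m X).smooth c ↔ SmoothRawCurve fun t x => c t x :=
  contMDiff_tangent_iff (v := fun t x => c t x)

lemma smoothRawCurve_const (v : VF m X) : SmoothRawCurve fun _ x => v x :=
  contMDiff_tangent_iff.1 (v.contMDiff.comp contMDiff_snd)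

lemma mapD_restrict {f : Y → X} {v : VF m X} (hv : IsTangent (k := k) f v) (y : Y) :
    mapD k m f y (restrict (k := k) f v y) = v (f y) := by
  have h := hv y
  rw [restrict, dif_pos h]
  exact h.choose_spec

/-- Since the differential of an immersion is injective, the vector chosen in `restrict` is the only
possible one. -/
lemma restrict_eq {f : Y → X} (hf : Manifold.IsImmersion (𝓡 k) (𝓡 m) ∞ f) {v : VF m X} {y : Y}
    {w : Mod k} (h : mapD k m f y w = v (f y)) : restrict (k := k) f v y = w := by
  have h' : ∃ w : TangentSpace (𝓡 k) y, mfderiv (𝓡 k) (𝓡 m) f y w = v (f y) := ⟨w, h⟩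
  rw [restrict, dif_pos h']
  exact mapD_injective hf y (h'.choose_spec.trans h.symm)

lemma IsTangent.add {f : Y → X} {v w : VF m X} (hv : IsTangent (k := k) f v)
    (hw : IsTangent (k := k) f w) : IsTangent (k := k) f (v + w) := fun y =>
  ⟨restrict f v y + restrict f w y, by
    have h1 := mapD_restrict hv y
    have h2 := mapD_restrict hw y
    rw [map_add]
    exact congrArg₂ (fun a b : Mod m => a + b) h1 h2⟩

lemma IsTangent.neg {f : Y → X} {v : VF m X} (hv : IsTangent (k := k) f v) :
    IsTangent (k := k) f (-v) := fun y =>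
  ⟨-restrict f v y, by
    have h1 := mapD_restrict hv y
    rw [map_neg]
    exact congrArg (fun a : Mod m => -a) h1⟩

lemma IsTangent.sub {f : Y → X} {v w : VF m X} (hv : IsTangent (k := k) f v)
    (hw : IsTangent (k := k) f w) : IsTangent (k := k) f (v - w) := by
  rw [sub_eq_add_neg]
  exact hv.add hw.neg

lemma restrict_add {f : Y → X} (hf : Manifold.IsImmersion (𝓡 k) (𝓡 m) ∞ f) {v w : VF m X}
    (hv : IsTangent (k := k) f v) (hw : IsTangent (k := k) f w) :
    restrict (k := k) f (v + w) = restrict f v + restrict f w := by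
  funext y
  refine restrict_eq hf ?_
  have h := map_add (mapD k m f y) (restrict (k := k) f v y) (restrict (k := k) f w y)
  exact h.trans (congrArg₂ (fun a b : Mod m => a + b) (mapD_restrict hv y) (mapD_restrict hw y))

lemma pullback_intProd {f : Y → X} {v : VF m X} (hv : IsTangent (k := k) f v)
    (η : DForm m (p + 1) X) :
    pullback (k := k) f (intProd (fun x => v x) η) = intProd (restrict f v) (pullback f η) := by
  funext y
  have h := curryLeft_compCLM (show Mod m [⋀^Fin (p + 1)]→L[ℝ] ℝ from η (f y)) (mapD k m f y)
    (restrict (k := k) f v y)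
  have h' := congrArg (fun w : Mod m => ContinuousAlternatingMap.compContinuousLinearMap
    ((show Mod m [⋀^Fin (p + 1)]→L[ℝ] ℝ from η (f y)).curryLeft w) (mapD k m f y))
    (mapD_restrict hv y)
  exact (h.trans h').symm

lemma fderiv_coordMap_vecRep {f : Y → X} {y₀ : Y} {x₀ : X} {u : Mod k} {v : VF m X}
    (hv : IsTangent (k := k) f v) (hu : u ∈ (extChartAt (𝓡 k) y₀).target)
    (hf : ContMDiffAt (𝓡 k) (𝓡 m) ∞ f ((extChartAt (𝓡 k) y₀).symm u))
    (hx : f ((extChartAt (𝓡 k) y₀).symm u) ∈ (extChartAt (𝓡 m) x₀).source) :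
    fderiv ℝ (coordMap k m f y₀ x₀) u (vecRep y₀ (restrict f v) u) =
      vecRep x₀ (fun x => v x) (coordMap k m f y₀ x₀ u) := by
  have h1 : (extChartAt (𝓡 m) x₀).symm (coordMap k m f y₀ x₀ u) =
    f ((extChartAt (𝓡 k) y₀).symm u) := (extChartAt (𝓡 m) x₀).left_inv hx
  have h2 := chartDSymm_chartD ((extChartAt (𝓡 k) y₀).map_target hu)
    (restrict (k := k) f v ((extChartAt (𝓡 k) y₀).symm u))
  rw [(extChartAt (𝓡 k) y₀).right_inv hu] at h2
  rw [fderiv_coordMap hu hf hx, vecRep, h2, mapD_restrict hv, vecRep, h1]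

lemma eventually_coord {f : Y → X} (hf : Continuous f) {y₀ : Y} {x₀ : X} {u : Mod k}
    (hu : u ∈ (extChartAt (𝓡 k) y₀).target)
    (hx : f ((extChartAt (𝓡 k) y₀).symm u) ∈ (extChartAt (𝓡 m) x₀).source) :
    ∀ᶠ w in 𝓝 u, w ∈ (extChartAt (𝓡 k) y₀).target ∧
      f ((extChartAt (𝓡 k) y₀).symm w) ∈ (extChartAt (𝓡 m) x₀).source :=
  (Filter.eventually_mem_set.2 (target_mem_nhds hu)).and
    ((ContinuousAt.comp (f := (extChartAt (𝓡 k) y₀).symm) hf.continuousAt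
      (contMDiffAt_chart_symm hu).continuousAt).eventually (source_mem_nhds hx))

/-- If `r` is a local left inverse of `f`, then `dr ∘ df = id` shows that the restriction is `dr`
applied to the ambient field along `f`, an expression that is visibly smooth in time and position.
-/
lemma smoothRawCurve_restrict {f : Y → X} (hf : Manifold.IsImmersion (𝓡 k) (𝓡 m) ∞ f)
    {c : ℝ → VF m X} (hc : SmoothRawCurve fun t x => c t x)
    (ht : ∀ t, IsTangent (k := k) f (c t)) : SmoothRawCurve fun t => restrict (k := k) f (c t) := by
  intro y₀ t u hu
  set y := (extChartAt (𝓡 k) y₀).symm u with hy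
  obtain ⟨r, hr, hrf⟩ := exists_local_leftInverse hf y
  have hx := mem_extChartAt_source (I := 𝓡 m) (f y)
  have hfu := extChartAt_to_inv (I := 𝓡 m) (f y)
  have hF := contDiffAt_coordMap (x₀ := f y) hu hf.contMDiff.contMDiffAt hx
  have hxt := mem_extChartAt_target (I := 𝓡 m) (f y)
  have hrfy : r (f y) = y := hrf.self_of_nhds
  have hfu' : (extChartAt (𝓡 m) (f y)).symm (coordMap k m f y₀ (f y) u) = f y := hfu
  have hR : ContDiffAt ℝ ∞ (coordMap m k r (f y) y₀) (coordMap k m f y₀ (f y) u) := by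
    refine contDiffAt_coordMap hxt (by rw [hfu']; exact hr.self_of_nhds) ?_
    rw [hfu', hrfy]
    exact (extChartAt (𝓡 k) y₀).map_target hu
  have hD : ContDiffAt ℝ ∞ (fderiv ℝ (coordMap m k r (f y) y₀)) (coordMap k m f y₀ (f y) u) :=
    hR.fderiv_right (by simp)
  have hsnd : ContDiffAt ℝ ∞ (fun q : ℝ × Mod k => coordMap k m f y₀ (f y) q.2) (t, u) :=
    ContDiffAt.comp (g := coordMap k m f y₀ (f y)) (t, u) hF contDiffAt_snd
  have hG : ContDiffAt ℝ ∞ (fun q : ℝ × Mod k =>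
      fderiv ℝ (coordMap m k r (f y) y₀) (coordMap k m f y₀ (f y) q.2)
        (vecRep (f y) (fun x => c q.1 x) (coordMap k m f y₀ (f y) q.2))) (t, u) :=
    (ContDiffAt.comp (g := fderiv ℝ (coordMap m k r (f y) y₀)) (t, u) hD hsnd).clm_apply
      (ContDiffAt.comp (g := fun q : ℝ × Mod m => vecRep (f y) (fun x => c q.1 x) q.2)
        (f := fun q : ℝ × Mod k => (q.1, coordMap k m f y₀ (f y) q.2)) (t, u) (hc (f y) t _ hxt)
        (contDiffAt_fst.prodMk hsnd))
  refine hG.congr_of_eventuallyEq ?_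
  have hrcont : ContinuousAt (extChartAt (𝓡 k) y₀).symm u :=
    (contMDiffAt_chart_symm hu).continuousAt
  -- The neighbourhood has to serve for all times, so the formula is proved on it for all tangent
  -- fields at once.
  have hev : ∀ᶠ w in 𝓝 u, ∀ v : VF m X, IsTangent (k := k) f v →
      vecRep y₀ (restrict (k := k) f v) w =
      fderiv ℝ (coordMap m k r (f y) y₀) (coordMap k m f y₀ (f y) w)
        (vecRep (f y) (fun x => v x) (coordMap k m f y₀ (f y) w)) := by
    have hev2 : coordMap m k r (f y) y₀ ∘ coordMap k m f y₀ (f y) =ᶠ[𝓝 u] id := by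
      filter_upwards [hrcont.eventually hrf, eventually_coord hf.contMDiff.continuous hu hx]
        with w hw hw'
      change extChartAt (𝓡 k) y₀ (r ((extChartAt (𝓡 m) (f y)).symm (extChartAt (𝓡 m) (f y)
        (f ((extChartAt (𝓡 k) y₀).symm w))))) = w
      rw [(extChartAt (𝓡 m) (f y)).left_inv hw'.2, hw, (extChartAt (𝓡 k) y₀).right_inv hw'.1]
    have hRd : ∀ᶠ w in 𝓝 u, DifferentiableAt ℝ (coordMap m k r (f y) y₀)
        (coordMap k m f y₀ (f y) w) := by
      have h1 := (hR.of_le (m := 1) (by simp)).eventually (by simp)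
      filter_upwards [hF.continuousAt.eventually h1] with w hw
      exact hw.differentiableAt one_ne_zero
    filter_upwards [hev2.eventuallyEq_nhds, hRd, eventually_coord hf.contMDiff.continuous hu hx]
      with w h2 h3 h4 v hv
    rw [← fderiv_coordMap_vecRep hv h4.1 hf.contMDiff.contMDiffAt h4.2]
    have h5 := fderiv_comp w h3 ((contDiffAt_coordMap h4.1 hf.contMDiff.contMDiffAt
      h4.2).differentiableAt (by simp))
    rw [h2.fderiv_eq, fderiv_id] at h5
    exact congrArg (fun L : Mod k →L[ℝ] Mod k => L (vecRep y₀ (restrict (k := k) f v) w)) h5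
  have : Filter.Tendsto (Prod.snd : ℝ × Mod k → Mod k) (𝓝 (t, u)) (𝓝 u) := continuous_snd.tendsto _
  filter_upwards [this.eventually hev] with q hq
  exact hq _ (ht _)

/-- At a fixed point the restriction is a constant linear left inverse of the differential applied
to the ambient vector, hence differentiable in time. Mapping its derivative forward and comparing
with the ambient velocity shows that the velocity is again tangent. -/
lemma hasDerivAt_restrict {f : Y → X} (hf : Manifold.IsImmersion (𝓡 k) (𝓡 m) ∞ f)
    {c : ℝ → VF m X} {v : VF m X} (hc : (vfCurves m X).velocity c v)
    (ht : ∀ t, IsTangent (k := k) f (c t)) :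
    IsTangent (k := k) f v ∧ ∀ y, HasDerivAt (fun t => (restrict (k := k) f (c t) y : Mod k))
      (restrict (k := k) f v y : Mod k) 0 := by
  have key : ∀ y, ∃ A : Mod m →L[ℝ] Mod k, ∀ w, A (mapD k m f y w) = w := by
    intro y
    obtain ⟨g, hg⟩ := LinearMap.exists_leftInverse_of_injective (mapD k m f y).toLinearMap
      (LinearMap.ker_eq_bot.2 (mapD_injective hf y))
    exact ⟨LinearMap.toContinuousLinearMap g, fun w => LinearMap.congr_fun hg w⟩
  choose A hA using key
  have h1 : ∀ y t, A y (c t (f y)) = restrict (k := k) f (c t) y := by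
    intro y t
    exact (congrArg (A y) (mapD_restrict (ht t) y).symm).trans (hA y _)
  have h2 : ∀ y, @HasDerivAt ℝ _ (Mod k) _ _ _ _ (fun t => restrict (k := k) f (c t) y)
      (A y (v (f y))) 0 := by
    intro y
    have h3 := ((A y).hasFDerivAt (x := (c 0 (f y) : Mod m))).comp_hasDerivAt (0 : ℝ) (hc (f y))
    refine h3.congr_of_eventuallyEq (Filter.Eventually.of_forall fun t => (h1 y t).symm)
  have h4 : ∀ y, mapD k m f y (A y (v (f y))) = v (f y) := by
    intro y
    have h5 := ((mapD k m f y).hasFDerivAt (x := (restrict (k := k) f (c 0) y : Mod k))).comp_hasDerivAt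
      (0 : ℝ) (h2 y)
    have h6 : HasDerivAt (fun t => (c t (f y) : Mod m)) (mapD k m f y (A y (v (f y)))) 0 :=
      h5.congr_of_eventuallyEq (Filter.Eventually.of_forall fun t => (mapD_restrict (ht t) y).symm)
    exact h6.unique (hc (f y))
  refine ⟨fun y => ⟨A y (v (f y)), h4 y⟩, fun y => ?_⟩
  rw [restrict_eq hf (h4 y)]
  exact h2 y

/-- Differentiate each relation `dF(V') = V ∘ F` along the other field and subtract: the second
derivative of `F` is symmetric and drops out. -/
lemma lieBracket_related {F : Mod k → Mod m} {V W : Mod m → Mod m} {V' W' : Mod k → Mod k}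
    {u : Mod k} (hF : ContDiffAt ℝ ∞ F u) (hV : DifferentiableAt ℝ V (F u))
    (hW : DifferentiableAt ℝ W (F u)) (hV' : DifferentiableAt ℝ V' u)
    (hW' : DifferentiableAt ℝ W' u) (h1 : ∀ᶠ w in 𝓝 u, fderiv ℝ F w (V' w) = V (F w))
    (h2 : ∀ᶠ w in 𝓝 u, fderiv ℝ F w (W' w) = W (F w)) :
    fderiv ℝ F u (VectorField.lieBracket ℝ V' W' u) = VectorField.lieBracket ℝ V W (F u) := by
  have hd : HasFDerivAt (fderiv ℝ F) (fderiv ℝ (fderiv ℝ F) u) u := by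
    have : ContDiffAt ℝ ∞ (fderiv ℝ F) u := hF.fderiv_right (by simp)
    exact (this.differentiableAt (by simp)).hasFDerivAt
  have key : ∀ {V : Mod m → Mod m} {V' : Mod k → Mod k}, DifferentiableAt ℝ V (F u) →
      DifferentiableAt ℝ V' u → (∀ᶠ w in 𝓝 u, fderiv ℝ F w (V' w) = V (F w)) → ∀ a,
      fderiv ℝ (fderiv ℝ F) u a (V' u) + fderiv ℝ F u (fderiv ℝ V' u a) =
        fderiv ℝ V (F u) (fderiv ℝ F u a) := by
    intro V V' hV hV' h a
    have h3 := hd.clm_apply hV'.hasFDerivAt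
    have h4 := (hV.hasFDerivAt.comp u (hF.differentiableAt (by simp)).hasFDerivAt)
    have h5 := (h3.congr_of_eventuallyEq (h.mono fun w hw => hw.symm)).unique h4
    have h6 := congrArg (fun L : Mod k →L[ℝ] Mod m => L a) h5
    simpa [add_comm] using h6
  have hsymm := (hF.isSymmSndFDerivAt (by
    rw [minSmoothness_of_isRCLikeNormedField]; exact WithTop.coe_le_coe.2 le_top)).eq (V' u) (W' u)
  rw [VectorField.lieBracket, VectorField.lieBracket, map_sub, ← h1.self_of_nhds,
    ← h2.self_of_nhds, ← key hV hV' h1, ← key hW hW' h2, hsymm]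
  abel

lemma restrict_bracket {f : Y → X} (hf : Manifold.IsImmersion (𝓡 k) (𝓡 m) ∞ f) {v w : VF m X}
    (hv : IsTangent (k := k) f v) (hw : IsTangent (k := k) f w) :
    IsTangent (k := k) f (v.bracket w) ∧ restrict (k := k) f (v.bracket w) =
      VectorField.mlieBracket (𝓡 k) (restrict (k := k) f v) (restrict (k := k) f w) := by
  have key : ∀ y, mapD k m f y (VectorField.mlieBracket (𝓡 k) (restrict (k := k) f v)
      (restrict (k := k) f w) y) = v.bracket w (f y) := by
    intro y
    have hy := mem_extChartAt_target (I := 𝓡 k) y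
    have hsymm : (extChartAt (𝓡 k) y).symm (extChartAt (𝓡 k) y y) = y := extChartAt_to_inv y
    have hx : f ((extChartAt (𝓡 k) y).symm (extChartAt (𝓡 k) y y)) ∈
        (extChartAt (𝓡 m) (f y)).source := by
      rw [hsymm]; exact mem_extChartAt_source (f y)
    have hF := contDiffAt_coordMap hy hf.contMDiff.contMDiffAt hx
    have hFu : coordMap k m f y (f y) (extChartAt (𝓡 k) y y) = extChartAt (𝓡 m) (f y) (f y) := by
      rw [coordMap, hsymm]
    have hxt := mem_extChartAt_target (I := 𝓡 m) (f y)
    have hd : ∀ v : VF m X, DifferentiableAt ℝ (vecRep (f y) fun x => v x)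
        (coordMap k m f y (f y) (extChartAt (𝓡 k) y y)) := by
      intro v
      rw [hFu]
      exact ((smoothRawCurve_const v).apply 0 hxt).differentiableAt (by simp)
    have hd' : ∀ v : VF m X, IsTangent (k := k) f v → DifferentiableAt ℝ
        (vecRep y (restrict (k := k) f v)) (extChartAt (𝓡 k) y y) := by
      intro v hv
      exact ((smoothRawCurve_restrict hf (smoothRawCurve_const v) fun _ => hv).apply 0
        hy).differentiableAt (by simp)
    have hrel : ∀ v : VF m X, IsTangent (k := k) f v → ∀ᶠ u in 𝓝 (extChartAt (𝓡 k) y y),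
        fderiv ℝ (coordMap k m f y (f y)) u (vecRep y (restrict f v) u) =
          vecRep (f y) (fun x => v x) (coordMap k m f y (f y) u) := by
      intro v hv
      filter_upwards [eventually_coord hf.contMDiff.continuous hy hx] with u hu
      exact fderiv_coordMap_vecRep hv hu.1 hf.contMDiff.contMDiffAt hu.2
    have h := lieBracket_related hF (hd v) (hd w) (hd' v hv) (hd' w hw) (hrel v hv) (hrel w hw)
    rw [fderiv_coordMap hy hf.contMDiff.contMDiffAt hx, hsymm, chartDSymm_self, chartD_self, hFu]
      at h
    rw [mlieBracket_eq]
    refine h.trans (mlieBracket_eq (fun x => v x) (fun x => w x) (f y)).symm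
  exact ⟨fun y => ⟨_, key y⟩, funext fun y => restrict_eq hf (key y)⟩

end Restriction
end CovPhase
end

noncomputable section

namespace CovPhase

/-! ### Vector fields as derivations, and local frames -/

section Derivations

variable {m : ℕ} {M : Type*} [TopologicalSpace M] [ChartedSpace (Mod m) M]
  [IsManifold (𝓡 m) ∞ M]

lemma contDiffAt_chart_symm_comp {G : Type*} [NormedAddCommGroup G] [NormedSpace ℝ G] {f : M → G}
    (hf : ContMDiff (𝓡 m) 𝓘(ℝ, G) ∞ f) {x₀ : M} {u : Mod m}
    (hu : u ∈ (extChartAt (𝓡 m) x₀).target) :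
    ContDiffAt ℝ ∞ (fun u => f ((extChartAt (𝓡 m) x₀).symm u)) u := by
  rw [← contMDiffAt_iff_contDiffAt]
  exact hf.contMDiffAt.comp u (contMDiffAt_chart_symm hu)

lemma smoothFnCurve_iff {f : ℝ → Fn m M} : SmoothFnCurve f ↔
    ∀ x₀ : M, ∀ t : ℝ, ∀ u ∈ (extChartAt (𝓡 m) x₀).target,
      ContDiffAt ℝ ∞ (fun q : ℝ × Mod m => f q.1 ((extChartAt (𝓡 m) x₀).symm q.2)) (t, u) := by
  constructor
  · intro h x₀ t u hu
    have := (contMDiffAt_time_iff (g := fun q : ℝ × M => f q.1 q.2)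
      ((extChartAt (𝓡 m) x₀).map_target hu) t).1 (h _)
    rwa [(extChartAt (𝓡 m) x₀).right_inv hu] at this
  · rintro h ⟨t, x⟩
    exact (contMDiffAt_time_iff (mem_extChartAt_source x) t).2 (h x t _ (mem_extChartAt_target x))

lemma fn_sum_apply {κ : Type*} (s : Finset κ) (f : κ → Fn m M) (x : M) :
    (∑ a ∈ s, f a) x = ∑ a ∈ s, f a x :=
  map_sum (⟨⟨fun f => f x, rfl⟩, fun _ _ => rfl⟩ : Fn m M →+ ℝ) f s

lemma der_sum_apply {κ : Type*} (s : Finset κ) (D : κ → Der (Fn m M)) (f : Fn m M) :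
    (∑ a ∈ s, D a) f = ∑ a ∈ s, D a f :=
  map_sum (⟨⟨fun D => D f, rfl⟩, fun _ _ => rfl⟩ : Der (Fn m M) →+ Fn m M) D s

lemma smoothFnCurve_const (f : Fn m M) : SmoothFnCurve fun _ => f :=
  f.contMDiff.comp contMDiff_snd

lemma SmoothFnCurve.add {f g : ℝ → Fn m M} (hf : SmoothFnCurve f) (hg : SmoothFnCurve g) :
    SmoothFnCurve fun t => f t + g t := ContMDiff.add hf hg

lemma SmoothFnCurve.sub {f g : ℝ → Fn m M} (hf : SmoothFnCurve f) (hg : SmoothFnCurve g) :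
    SmoothFnCurve fun t => f t - g t := ContMDiff.sub hf hg

lemma SmoothFnCurve.mul {f g : ℝ → Fn m M} (hf : SmoothFnCurve f) (hg : SmoothFnCurve g) :
    SmoothFnCurve fun t => f t * g t := ContMDiff.mul hf hg

lemma SmoothFnCurve.sum {κ : Type*} (s : Finset κ) {f : κ → ℝ → Fn m M}
    (hf : ∀ a ∈ s, SmoothFnCurve (f a)) : SmoothFnCurve fun t => ∑ a ∈ s, f a t := by
  classical
  induction s using Finset.induction_on with
  | empty => simpa using smoothFnCurve_const (0 : Fn m M)
  | insert a s ha ih =>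
    simp only [Finset.sum_insert ha]
    exact (hf a (by simp)).add (ih fun b hb => hf b (by simp [hb]))

lemma SmoothFnCurve.prod {κ : Type*} (s : Finset κ) {f : κ → ℝ → Fn m M}
    (hf : ∀ a ∈ s, SmoothFnCurve (f a)) : SmoothFnCurve fun t => ∏ a ∈ s, f a t := by
  classical
  induction s using Finset.induction_on with
  | empty => simpa using smoothFnCurve_const (1 : Fn m M)
  | insert a s ha ih =>
    simp only [Finset.prod_insert ha]
    exact (hf a (by simp)).mul (ih fun b hb => hf b (by simp [hb]))

lemma SmoothFnCurve.time_smul {f : ℝ → Fn m M} (hf : SmoothFnCurve f) :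
    SmoothFnCurve fun t => t • f t := ContMDiff.smul contMDiff_fst hf

/-- A curve of functions is smooth if near each point it coincides with a smooth curve. -/
lemma SmoothFnCurve.of_local {f : ℝ → Fn m M}
    (h : ∀ x : M, ∃ g : ℝ → Fn m M, SmoothFnCurve g ∧ ∀ᶠ y in 𝓝 x, ∀ t, f t y = g t y) :
    SmoothFnCurve f := by
  rintro ⟨t, x⟩
  obtain ⟨g, hg, hfg⟩ := h x
  refine (hg (t, x)).congr_of_eventuallyEq ?_
  have : Filter.Tendsto (Prod.snd : ℝ × M → M) (𝓝 (t, x)) (𝓝 x) := continuous_snd.tendsto _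
  filter_upwards [this.eventually hfg] with q hq using hq q.1

lemma SmoothFnCurve.contDiff {f : ℝ → Fn m M} (hf : SmoothFnCurve f) (x : M) :
    ContDiff ℝ ∞ fun t => f t x := by
  rw [← contMDiff_iff_contDiff]
  exact ContMDiff.comp hf (contMDiff_id.prodMk contMDiff_const)

lemma der_apply (v : VF m M) (f : Fn m M) {x₀ : M} {u : Mod m}
    (hu : u ∈ (extChartAt (𝓡 m) x₀).target) :
    v.der f ((extChartAt (𝓡 m) x₀).symm u) =
      fderiv ℝ (fun w => f ((extChartAt (𝓡 m) x₀).symm w)) u (vecRep x₀ (fun x => v x) u) := by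
  set x := (extChartAt (𝓡 m) x₀).symm u with hx
  have h1 := mfderiv_comp u (f.mdifferentiableAt (x := x))
    ((contMDiffAt_chart_symm hu).mdifferentiableAt (by simp))
  have h2 : chartDSymm x₀ u (vecRep x₀ (fun x => v x) u) = v x := by
    have := chartDSymm_chartD ((extChartAt (𝓡 m) x₀).map_target hu) (v x)
    rwa [(extChartAt (𝓡 m) x₀).right_inv hu] at this
  have h3 : mfderiv 𝓘(ℝ, Mod m) 𝓘(ℝ, ℝ) (⇑f ∘ (extChartAt (𝓡 m) x₀).symm) u =
    fderiv ℝ (fun w => f ((extChartAt (𝓡 m) x₀).symm w)) u := mfderiv_eq_fderiv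
  refine Eq.trans ?_ (congrArg (fun L : Mod m →L[ℝ] ℝ => L (vecRep x₀ (fun x => v x) u))
    (h1.symm.trans h3))
  exact (congrArg (fun w : Mod m => mvfderiv (𝓡 m) f x w) h2).symm

lemma smoothDerCurve_der {v : ℝ → VF m M} (hv : (vfCurves m M).smooth v) :
    SmoothDerCurve fun t => (v t).der := by
  intro f hf
  rw [smoothFnCurve_iff] at *
  rw [vfCurves_smooth_iff] at hv
  intro x₀ t u hu
  have h1 : ContDiffAt ℝ ∞ (fun q : ℝ × Mod m =>
      fderiv ℝ (fun w => f q.1 ((extChartAt (𝓡 m) x₀).symm w)) q.2) (t, u) := by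
    refine ContDiffAt.fderiv (f := fun (q : ℝ × Mod m) w => f q.1 ((extChartAt (𝓡 m) x₀).symm w))
      (g := Prod.snd) (n := ∞) ?_ contDiffAt_snd (by simp)
    exact ContDiffAt.comp (g := fun q : ℝ × Mod m => f q.1 ((extChartAt (𝓡 m) x₀).symm q.2))
      (f := fun q : (ℝ × Mod m) × Mod m => (q.1.1, q.2)) ((t, u), u) (hf x₀ t u hu)
      ((contDiffAt_fst.comp _ contDiffAt_fst).prodMk contDiffAt_snd)
  refine (h1.clm_apply (hv x₀ t u hu)).congr_of_eventuallyEq ?_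
  have : Filter.Tendsto (Prod.snd : ℝ × Mod m → Mod m) (𝓝 (t, u)) (𝓝 u) := continuous_snd.tendsto _
  filter_upwards [this.eventually (target_mem_nhds hu)] with q hq
  exact der_apply _ _ hq

lemma vfCurves_const (v : VF m M) : (vfCurves m M).smooth fun _ => v :=
  vfCurves_smooth_iff.2 (smoothRawCurve_const v)

/-- Both sides are the mixed second derivative of `F` in the time direction and in the direction
`z`; its symmetry exchanges the two orders. -/
lemma hasDerivAt_fderiv {F : ℝ × Mod m → ℝ} {G : Mod m → ℝ} {u : Mod m}
    (hF : ContDiffAt ℝ ∞ F (0, u)) (hG : ∀ᶠ w in 𝓝 u, HasDerivAt (fun t => F (t, w)) (G w) 0)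
    (z : Mod m) :
    HasDerivAt (fun t => fderiv ℝ (fun w => F (t, w)) u z) (fderiv ℝ G u z) 0 := by
  have hd : ∀ᶠ q in 𝓝 ((0 : ℝ), u), DifferentiableAt ℝ F q := by
    have := (ContDiffAt.one_of_infty hF).eventually (by simp)
    filter_upwards [this] with q hq using hq.differentiableAt one_ne_zero
  have hD : ContDiffAt ℝ ∞ (fderiv ℝ F) (0, u) := hF.fderiv_right (by simp)
  have hD' := (hD.differentiableAt (by simp)).hasFDerivAt
  have hin : ∀ t w, HasFDerivAt (fun w : Mod m => (t, w)) (ContinuousLinearMap.inr ℝ ℝ (Mod m)) w :=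
    fun t w => hasFDerivAt_prodMk_right t w
  have hin' : ∀ w : Mod m, HasDerivAt (fun t : ℝ => (t, w)) ((1 : ℝ), (0 : Mod m)) 0 :=
    fun w => (hasDerivAt_id (0 : ℝ)).prodMk (hasDerivAt_const _ _)
  have hsymm := (hF.isSymmSndFDerivAt (by
    rw [minSmoothness_of_isRCLikeNormedField]; exact WithTop.coe_le_coe.2 le_top)).eq
      ((1 : ℝ), (0 : Mod m)) ((0 : ℝ), z)
  have h1 : ∀ᶠ t in 𝓝 (0 : ℝ), fderiv ℝ (fun w => F (t, w)) u z = fderiv ℝ F (t, u) (0, z) := by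
    have : Filter.Tendsto (fun t : ℝ => (t, u)) (𝓝 0) (𝓝 (0, u)) :=
      (Continuous.prodMk_left u).tendsto _
    filter_upwards [this.eventually hd] with t ht
    exact congrArg (fun L : Mod m →L[ℝ] ℝ => L z) (ht.hasFDerivAt.comp u (hin t u)).fderiv
  have h2 : G =ᶠ[𝓝 u] fun w => fderiv ℝ F (0, w) (1, 0) := by
    have : Filter.Tendsto (fun w : Mod m => ((0 : ℝ), w)) (𝓝 u) (𝓝 (0, u)) :=
      (Continuous.prodMk_right (0 : ℝ)).tendsto _
    filter_upwards [this.eventually hd, hG] with w hw hw'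
    exact hw'.unique (hw.hasFDerivAt.comp_hasDerivAt 0 (hin' w))
  have h3 : fderiv ℝ G u z = fderiv ℝ (fderiv ℝ F) (0, u) (1, 0) (0, z) := by
    rw [h2.fderiv_eq, hsymm]
    have h4 : HasFDerivAt (fun w => fderiv ℝ F (0, w) (1, 0)) (((ContinuousLinearMap.apply ℝ ℝ
        ((1 : ℝ), (0 : Mod m))).comp (fderiv ℝ (fderiv ℝ F) (0, u))).comp
          (ContinuousLinearMap.inr ℝ ℝ (Mod m))) u :=
      ((ContinuousLinearMap.apply ℝ ℝ ((1 : ℝ), (0 : Mod m))).hasFDerivAt.comp (0, u) hD').comp u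
        (hin 0 u)
    rw [h4.fderiv]
    rfl
  rw [h3]
  have h6 : HasDerivAt (fun t => fderiv ℝ F (t, u) (0, z))
      (fderiv ℝ (fderiv ℝ F) (0, u) (1, 0) (0, z)) 0 :=
    HasFDerivAt.comp_hasDerivAt (f := fun t : ℝ => (t, u)) 0
      ((ContinuousLinearMap.apply ℝ ℝ ((0 : ℝ), z)).hasFDerivAt.comp (0, u) hD') (hin' u)
  exact h6.congr_of_eventuallyEq h1

/-- Differentiation along a vector field commutes with the time derivative. -/
lemma hasDerivAt_der {f : ℝ → Fn m M} (hf : SmoothFnCurve f) {g : Fn m M}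
    (hg : ∀ x, HasDerivAt (fun t => f t x) (g x) 0) (v : VF m M) (x : M) :
    HasDerivAt (fun t => v.der (f t) x) (v.der g x) 0 := by
  have hx := mem_extChartAt_target (I := 𝓡 m) x
  have hs : (extChartAt (𝓡 m) x).symm (extChartAt (𝓡 m) x x) = x := extChartAt_to_inv x
  have h := hasDerivAt_fderiv (F := fun q => f q.1 ((extChartAt (𝓡 m) x).symm q.2))
    (G := fun w => g ((extChartAt (𝓡 m) x).symm w)) (smoothFnCurve_iff.1 hf x 0 _ hx)
    (Filter.Eventually.of_forall fun w => hg ((extChartAt (𝓡 m) x).symm w))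
    (vecRep x (fun x => v x) (extChartAt (𝓡 m) x x))
  rw [← der_apply v g hx, hs] at h
  refine h.congr_of_eventuallyEq (Filter.Eventually.of_forall fun t => ?_)
  have := der_apply v (f t) hx
  rw [hs] at this
  exact this

/-- In the chart at `x`, the second derivatives of `f` in `v(w f) - w(v f)` cancel by symmetry, and
the first-order terms are the coordinate bracket. -/
lemma der_bracket (v w : VF m M) : (v.bracket w).der = ⁅v.der, w.der⁆ := by
  ext f x
  have hx := mem_extChartAt_target (I := 𝓡 m) x
  have hs : (extChartAt (𝓡 m) x).symm (extChartAt (𝓡 m) x x) = x := extChartAt_to_inv x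
  have hf := contDiffAt_chart_symm_comp f.contMDiff hx
  have hD : HasFDerivAt (fderiv ℝ fun u => f ((extChartAt (𝓡 m) x).symm u))
      (fderiv ℝ (fderiv ℝ fun u => f ((extChartAt (𝓡 m) x).symm u)) (extChartAt (𝓡 m) x x))
      (extChartAt (𝓡 m) x x) := by
    have : ContDiffAt ℝ ∞ (fderiv ℝ fun u => f ((extChartAt (𝓡 m) x).symm u))
      (extChartAt (𝓡 m) x x) := hf.fderiv_right (by simp)
    exact (this.differentiableAt (by simp)).hasFDerivAt
  have hsymm := (hf.isSymmSndFDerivAt (by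
    rw [minSmoothness_of_isRCLikeNormedField]; exact WithTop.coe_le_coe.2 le_top)).eq
      (vecRep x (fun x => v x) (extChartAt (𝓡 m) x x))
      (vecRep x (fun x => w x) (extChartAt (𝓡 m) x x))
  have key : ∀ v w : VF m M, v.der (w.der f) x =
      fderiv ℝ (fderiv ℝ fun u => f ((extChartAt (𝓡 m) x).symm u)) (extChartAt (𝓡 m) x x)
        (vecRep x (fun x => v x) (extChartAt (𝓡 m) x x))
        (vecRep x (fun x => w x) (extChartAt (𝓡 m) x x)) +
      fderiv ℝ (fun u => f ((extChartAt (𝓡 m) x).symm u)) (extChartAt (𝓡 m) x x)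
        (fderiv ℝ (vecRep x (fun x => w x)) (extChartAt (𝓡 m) x x)
          (vecRep x (fun x => v x) (extChartAt (𝓡 m) x x))) := by
    intro v w
    have h1 := der_apply v (w.der f) hx
    rw [hs] at h1
    have h2 : (fun u => w.der f ((extChartAt (𝓡 m) x).symm u)) =ᶠ[𝓝 (extChartAt (𝓡 m) x x)]
        fun u => fderiv ℝ (fun w => f ((extChartAt (𝓡 m) x).symm w)) u
          (vecRep x (fun x => w x) u) := by
      filter_upwards [target_mem_nhds hx] with u hu using der_apply w f hu
    have hw := (((smoothRawCurve_const w).apply 0 hx).differentiableAt (by simp)).hasFDerivAt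
    rw [h1, h2.fderiv_eq, (hD.clm_apply hw).fderiv]
    simp [add_comm]
  have h1 := der_apply (v.bracket w) f hx
  rw [hs] at h1
  have h2 : vecRep x (fun x => v.bracket w x) (extChartAt (𝓡 m) x x) =
      VectorField.lieBracket ℝ (vecRep x fun x => v x) (vecRep x fun x => w x)
        (extChartAt (𝓡 m) x x) :=
    (vecRep_self _ x).trans (mlieBracket_eq (fun x => v x) (fun x => w x) x)
  rw [h1, h2, Derivation.commutator_apply]
  change _ = v.der (w.der f) x - w.der (v.der f) x
  rw [key, key, hsymm, VectorField.lieBracket, map_sub]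
  ring

lemma der_add (v w : VF m M) : (v + w).der = v.der + w.der := by
  ext f x
  exact map_add (mvfderiv (𝓡 m) f x) (v x) (w x)

lemma der_sub (v w : VF m M) : (v - w).der = v.der - w.der := by
  ext f x
  exact map_sub (mvfderiv (𝓡 m) f x) (v x) (w x)

lemma der_smul (a : ℝ) (v : VF m M) : (a • v).der = a • v.der := by
  ext f x
  exact map_smul (mvfderiv (𝓡 m) f x) a (v x)

/-- A smooth curve of vector fields is `v t = v 0 + t v' t` with a smooth curve `v'`. -/
lemma exists_div_time {v : ℝ → VF m M} (hv : (vfCurves m M).smooth v) {w : VF m M}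
    (hw : (vfCurves m M).velocity v w) :
    ∃ v' : ℝ → VF m M, (vfCurves m M).smooth v' ∧ v' 0 = w ∧ ∀ t, v t = v 0 + t • v' t := by
  -- The difference quotient in time, continued by the velocity `w` at `t = 0`; its smoothness
  -- across `t = 0` is `contDiffAt_div_time`.
  let g : ℝ → RawVF m M := fun t x =>
    if t = 0 then (w x : Mod m) else t⁻¹ • ((v t x : Mod m) - (v 0 x : Mod m))
  have hg : SmoothRawCurve g := by
    intro x₀ t u hu
    refine contDiffAt_div_time (f := fun q => vecRep x₀ (fun x => v q.1 x) q.2)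
      (isOpen_extChartAt_target x₀) ?_ ?_ ?_ t hu
    · rintro ⟨t, u⟩ ⟨-, hu⟩
      exact ((vfCurves_smooth_iff.1 hv) x₀ t u hu).contDiffWithinAt
    · intro t u hu
      by_cases ht : t = 0
      · subst ht; simp
      · have : vecRep x₀ (g t) u = t⁻¹ • (vecRep x₀ (fun x => v t x) u -
            vecRep x₀ (fun x => v 0 x) u) := by
          simp only [vecRep, g, if_neg ht]
          exact (map_smul (chartD x₀ ((extChartAt (𝓡 m) x₀).symm u)) t⁻¹ _).trans
            (congrArg (fun z : Mod m => t⁻¹ • z) (map_sub _ _ _))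
        simp only [this, smul_inv_smul₀ ht]
        abel
    · intro u hu
      have h1 := (chartD x₀ ((extChartAt (𝓡 m) x₀).symm u)).hasFDerivAt.comp_hasDerivAt 0
        (hw ((extChartAt (𝓡 m) x₀).symm u))
      have h2 : vecRep x₀ (g 0) u = chartD x₀ ((extChartAt (𝓡 m) x₀).symm u)
          (w ((extChartAt (𝓡 m) x₀).symm u)) := by simp [vecRep, g]
      simp only [h2]
      exact h1
  have hs := contMDiff_tangent_iff.2 hg
  refine ⟨fun t => ⟨g t, hs.comp (contMDiff_const.prodMk contMDiff_id)⟩,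
    vfCurves_smooth_iff.2 hg, ?_, fun t => ?_⟩
  · ext x
    exact if_pos rfl
  · ext x
    change (v t x : Mod m) = (v 0 x : Mod m) + t • (g t x : Mod m)
    by_cases ht : t = 0
    · subst ht; simp
    · simp only [g, if_neg ht, smul_inv_smul₀ ht]
      abel

variable [T2Space M]

/-- Local frames: near each point, derivations are combinations of coordinate vector fields. -/
lemma exists_frame (x₀ : M) : ∃ (ψ : Fn m M) (X : Fin m → Fn m M) (e : Fin m → VF m M),
    (∀ᶠ x in 𝓝 x₀, ψ x = 1) ∧
      ∀ D : Der (Fn m M), ψ • D = ∑ a, D (X a) • (e a).der := by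
  obtain ⟨f⟩ : Nonempty (SmoothBumpFunction (𝓡 m) x₀) := inferInstance
  -- The support of `ψ` lies where `f` is locally equal to `1`. There the globally defined functions
  -- `X a` are true coordinates, while the fields `e a` are the coordinate fields multiplied by `ψ`.
  obtain ⟨ψ, -, hψ⟩ := (SmoothBumpFunction.nhds_basis_tsupport (I := 𝓡 m) x₀).mem_iff.1
    f.eventuallyEq_one.eventually_nhds
  have hsrc : ∀ x ∈ tsupport ψ, x ∈ (extChartAt (𝓡 m) x₀).source := fun x hx => by
    rw [extChartAt_source]; exact ψ.tsupport_subset_chartAt_source hx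
  let ψ' : Fn m M := ⟨ψ, ψ.contMDiff⟩
  let X : Fin m → Fn m M := fun a => ⟨fun x => f x • extChartAt (𝓡 m) x₀ x a,
    f.contMDiff_smul (by
      have h1 : ContMDiffOn (𝓡 m) 𝓘(ℝ, Mod m) ∞ (extChartAt (𝓡 m) x₀) (chartAt (Mod m) x₀).source :=
        contMDiffOn_extChartAt
      have h2 : ContDiff ℝ ∞ (fun u : Mod m => u a) :=
        (EuclideanSpace.proj (𝕜 := ℝ) a : Mod m →L[ℝ] ℝ).contDiff
      exact h2.contMDiff.comp_contMDiffOn h1)⟩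
  let g : Fin m → RawVF m M := fun a x =>
    ψ x • chartDSymm x₀ (extChartAt (𝓡 m) x₀ x) (EuclideanSpace.basisFun (Fin m) ℝ a)
  have hgrep : ∀ a, ∀ u ∈ (extChartAt (𝓡 m) x₀).target, vecRep x₀ (g a) u =
      ψ ((extChartAt (𝓡 m) x₀).symm u) • EuclideanSpace.basisFun (Fin m) ℝ a := by
    intro a u hu
    simp only [vecRep, g]
    rw [map_smul, (extChartAt (𝓡 m) x₀).right_inv hu, chartD_chartDSymm hu]
  have hg : ∀ a, ContMDiff (𝓘(ℝ, ℝ).prod (𝓡 m)) (𝓡 m).tangent ∞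
      (fun q : ℝ × M => (⟨q.2, g a q.2⟩ : TangentBundle (𝓡 m) M)) := by
    rintro a ⟨t, x⟩
    by_cases hx : x ∈ tsupport ψ
    · have hxs := hsrc x hx
      rw [contMDiffAt_tangent_iff (v := fun _ => g a) hxs]
      have hxt := (extChartAt (𝓡 m) x₀).map_source hxs
      have h1 : ContDiffAt ℝ ∞ (fun q : ℝ × Mod m => ψ ((extChartAt (𝓡 m) x₀).symm q.2) •
          EuclideanSpace.basisFun (Fin m) ℝ a) (t, extChartAt (𝓡 m) x₀ x) :=
        ((contDiffAt_chart_symm_comp ψ.contMDiff hxt).comp (t, extChartAt (𝓡 m) x₀ x)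
          contDiffAt_snd).smul contDiffAt_const
      refine h1.congr_of_eventuallyEq ?_
      have : Filter.Tendsto (Prod.snd : ℝ × Mod m → Mod m) (𝓝 (t, extChartAt (𝓡 m) x₀ x))
        (𝓝 (extChartAt (𝓡 m) x₀ x)) := continuous_snd.tendsto _
      filter_upwards [this.eventually (target_mem_nhds hxt)] with q hq using hgrep a _ hq
    · have h0 : ContMDiff (𝓘(ℝ, ℝ).prod (𝓡 m)) (𝓡 m).tangent ∞
          (fun q : ℝ × M => (⟨q.2, (0 : VF m M) q.2⟩ : TangentBundle (𝓡 m) M)) :=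
        (0 : VF m M).contMDiff.comp contMDiff_snd
      refine (h0 (t, x)).congr_of_eventuallyEq ?_
      have : Filter.Tendsto (Prod.snd : ℝ × M → M) (𝓝 (t, x)) (𝓝 x) := continuous_snd.tendsto _
      filter_upwards [this.eventually (notMem_tsupport_iff_eventuallyEq.1 hx)] with q hq
      have : g a q.2 = (0 : VF m M) q.2 := by
        have hq' : ψ q.2 = 0 := hq
        simp only [g, hq', zero_smul]
        rfl
      rw [this]
  let e : Fin m → VF m M := fun a => ⟨g a, (hg a).comp
    ((contMDiff_const (c := (0 : ℝ))).prodMk contMDiff_id)⟩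
  refine ⟨ψ', X, e, ψ.eventuallyEq_one, fun D => ?_⟩
  ext h x
  have hsum : (∑ a, D (X a) • (e a).der) h x = ∑ a, D (X a) x * (e a).der h x := by
    rw [der_sum_apply, fn_sum_apply]
    rfl
  rw [hsum]
  change ψ x * D h x = _
  by_cases hx : x ∈ tsupport ψ
  swap
  · have hψ0 : ψ x = 0 := image_eq_zero_of_notMem_tsupport hx
    rw [hψ0, zero_mul]
    refine (Finset.sum_eq_zero fun a _ => ?_).symm
    have h1 : g a x = (0 : Mod m) := by simp only [g, hψ0, zero_smul]; rfl
    have h2 : (e a).der h x = 0 :=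
      (congrArg (fun w : Mod m => mvfderiv (𝓡 m) h x w) h1).trans (map_zero (mvfderiv (𝓡 m) h x))
    rw [h2, mul_zero]
  have hxs := hsrc x hx
  have hxt := (extChartAt (𝓡 m) x₀).map_source hxs
  have hinv := (extChartAt (𝓡 m) x₀).left_inv hxs
  set u₀ := extChartAt (𝓡 m) x₀ x with hu₀
  have hder : ∀ a, (e a).der h x = ψ x * fderiv ℝ (fun w => h ((extChartAt (𝓡 m) x₀).symm w)) u₀
      (EuclideanSpace.basisFun (Fin m) ℝ a) := by
    intro a
    have h1 := der_apply (e a) h hxt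
    have h2 : vecRep x₀ (fun x => e a x) u₀ =
        ψ ((extChartAt (𝓡 m) x₀).symm u₀) • EuclideanSpace.basisFun (Fin m) ℝ a := hgrep a u₀ hxt
    rw [h2, hinv, map_smul, smul_eq_mul] at h1
    exact h1
  simp only [hder]
  -- It remains to see that `D h x` depends only on the values `D (X a) x`. The coordinate
  -- expression of `h` is cut off to all of `ℝᵐ` so that Hadamard's expansion around `u₀` applies.
  obtain ⟨χ, hχ, hχ1, hχO, -⟩ := exists_cutoff (target_mem_nhds hxt)
  have hH : ContDiff ℝ ∞ fun u => χ u * h ((extChartAt (𝓡 m) x₀).symm u) := by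
    rw [contDiff_iff_contDiffAt]
    intro u
    by_cases hu : u ∈ tsupport χ
    · exact hχ.contDiffAt.mul (contDiffAt_chart_symm_comp h.contMDiff (hχO hu))
    · refine (contDiffAt_const (c := (0 : ℝ))).congr_of_eventuallyEq ?_
      filter_upwards [notMem_tsupport_iff_eventuallyEq.1 hu] with w hw
      rw [hw]; simp
  obtain ⟨γ, hγ, hγ0, hγH⟩ := hadamard_space hH u₀
  have hcont : ContinuousAt (extChartAt (𝓡 m) x₀) x := (contMDiffAt_chart hxs).continuousAt
  obtain ⟨κ, -, hκ⟩ := (SmoothBumpFunction.nhds_basis_tsupport (I := 𝓡 m) x).mem_iff.1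
    (((hψ hx : ∀ᶠ y in 𝓝 x, f y = 1).and (hcont.eventually hχ1)).and (source_mem_nhds hxs))
  let κ' : Fn m M := ⟨κ, κ.contMDiff⟩
  let Γ : Fin m → Fn m M := fun a => ⟨fun y => κ y • γ a (extChartAt (𝓡 m) x₀ y), by
    refine contMDiff_of_tsupport fun y hy => ?_
    have hy' := (hκ (tsupport_smul_subset_left _ _ hy)).2
    exact κ.contMDiff.contMDiffAt.smul ((hγ a).contMDiff.contMDiffAt.comp y (contMDiffAt_chart hy'))⟩
  -- Hadamard's expansion as an identity of global functions. Of the two factors `κ`, one is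
  -- absorbed in `Γ a` to make it globally smooth.
  have hid : κ' * κ' * h = (h x) • (κ' * κ') +
      ∑ a, κ' * (X a - algebraMap ℝ (Fn m M) (u₀ a)) * Γ a := by
    ext y
    have hsum' : (∑ a, κ' * (X a - algebraMap ℝ (Fn m M) (u₀ a)) * Γ a) y =
        ∑ a, κ y * (X a y - u₀ a) * (κ y * γ a (extChartAt (𝓡 m) x₀ y)) := by
      rw [fn_sum_apply]
      rfl
    change κ y * κ y * h y = h x * (κ y * κ y) + _
    rw [hsum']
    by_cases hy : y ∈ tsupport κ
    swap
    · have : κ y = 0 := image_eq_zero_of_notMem_tsupport hy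
      simp [this]
    obtain ⟨⟨hy1, hy2⟩, hy3⟩ := hκ hy
    have hy2' : χ (extChartAt (𝓡 m) x₀ y) = 1 := hy2
    have h1 := hγH (extChartAt (𝓡 m) x₀ y)
    have hχ0 : χ u₀ = 1 := hχ1.self_of_nhds
    rw [hy2', hχ0, (extChartAt (𝓡 m) x₀).left_inv hy3, hinv, one_mul, one_mul] at h1
    have h2 : ∀ a, X a y = extChartAt (𝓡 m) x₀ y a := by
      intro a
      have hy1' : f y = 1 := hy1
      change f y * _ = _
      rw [hy1', one_mul]
    rw [h1, mul_add, Finset.mul_sum]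
    congr 1
    · ring
    · refine Finset.sum_congr rfl fun a _ => ?_
      rw [h2]
      ring
  have hκx : κ' x = 1 := κ.eventuallyEq_one.self_of_nhds
  have hXx : ∀ a, X a x = u₀ a := by
    intro a
    have hf1 : f x = 1 := (hψ hx : ∀ᶠ y in 𝓝 x, f y = 1).self_of_nhds
    change f x * _ = _
    rw [hf1, one_mul]
  have hγ1 : ∀ a, γ a u₀ = fderiv ℝ (fun w => h ((extChartAt (𝓡 m) x₀).symm w)) u₀
      (EuclideanSpace.basisFun (Fin m) ℝ a) := by
    intro a
    rw [hγ0]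
    congr 1
    refine Filter.EventuallyEq.fderiv_eq ?_
    filter_upwards [hχ1] with w hw
    rw [hw]; simp
  have hDid := congrArg (fun F : Fn m M => F x) (congrArg D hid)
  -- The terms containing `D (κ' * κ')` are the same on both sides and cancel. Since `X a - u₀ a`
  -- vanishes at `x`, Leibniz keeps only the terms in which `D` hits `X a`.
  have hL : D (κ' * κ' * h) x = D (κ' * κ') x * h x + D h x := by
    rw [Derivation.leibniz]
    change (κ' x * κ' x) * D h x + h x * D (κ' * κ') x = _
    rw [hκx]; ring
  have hR : D ((h x) • (κ' * κ') + ∑ a, κ' * (X a - algebraMap ℝ (Fn m M) (u₀ a)) * Γ a) x =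
      h x * D (κ' * κ') x + ∑ a, D (X a) x * γ a u₀ := by
    rw [map_add, map_sum, Derivation.map_smul]
    refine (congrArg (fun r => h x * D (κ' * κ') x + r) (fn_sum_apply _ _ x)).trans ?_
    congr 1
    refine Finset.sum_congr rfl fun a _ => ?_
    rw [Derivation.leibniz, Derivation.leibniz, map_sub, Derivation.map_algebraMap, sub_zero]
    change κ' x * (X a x - u₀ a) * D (Γ a) x + (κ x * γ a (extChartAt (𝓡 m) x₀ x)) *
      (κ' x * D (X a) x + (X a x - u₀ a) * D κ' x) = _
    have hκx' : κ x = 1 := hκx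
    rw [hXx, hκx, hκx', ← hu₀]
    ring
  have hfin : D h x = ∑ a, D (X a) x * γ a u₀ := by
    have := hL.symm.trans (hDid.trans hR)
    linarith
  rw [hfin, Finset.mul_sum]
  refine Finset.sum_congr rfl fun a _ => ?_
  rw [hγ1]
  ring

end Derivations
end CovPhase
end

noncomputable section

namespace CovPhase

/-! ### Lie derivatives of tensors -/

section TensorAlgebra

variable {A : Type*} [CommRing A] [Algebra ℝ A] {r s : ℕ}

lemma tensorLie_apply (D : Der A) (T : Tensor A r s) (a : ∀ k, Slot A r s k) :
    tensorLie D T a = D (T a) - ∑ k, T (Function.update a k (slotLie D k (a k))) := rfl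

lemma covLie_add_left (D E : Der A) (α : Cov A) : covLie (D + E) α = covLie D α + covLie E α := by
  refine LinearMap.ext fun Y => ?_
  change (D + E) (α Y) - α ⁅D + E, Y⁆ = (D (α Y) - α ⁅D, Y⁆) + (E (α Y) - α ⁅E, Y⁆)
  rw [add_lie, map_add, Derivation.add_apply]
  ring

lemma covLie_smul_left (t : ℝ) (D : Der A) (α : Cov A) :
    covLie (t • D) α = algebraMap ℝ A t • covLie D α := by
  refine LinearMap.ext fun Y => ?_
  change (t • D) (α Y) - α ⁅t • D, Y⁆ = algebraMap ℝ A t * (D (α Y) - α ⁅D, Y⁆)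
  rw [smul_lie, ← algebraMap_smul A t ⁅D, Y⁆, map_smul, Derivation.smul_apply, Algebra.smul_def,
    smul_eq_mul]
  ring

lemma covLie_lie (D E : Der A) (α : Cov A) :
    covLie ⁅D, E⁆ α = covLie D (covLie E α) - covLie E (covLie D α) := by
  refine LinearMap.ext fun Y => ?_
  change ⁅D, E⁆ (α Y) - α ⁅⁅D, E⁆, Y⁆ =
    (D (E (α Y) - α ⁅E, Y⁆) - (E (α ⁅D, Y⁆) - α ⁅E, ⁅D, Y⁆⁆)) -
      (E (D (α Y) - α ⁅D, Y⁆) - (D (α ⁅E, Y⁆) - α ⁅D, ⁅E, Y⁆⁆))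
  rw [lie_lie, map_sub, map_sub, map_sub, Derivation.commutator_apply]
  ring

lemma slotLie_add_left (D E : Der A) : ∀ (k : Fin r ⊕ Fin s) (x : Slot A r s k),
    slotLie (D + E) k x = slotLie D k x + slotLie E k x
  | .inl _, x => covLie_add_left D E x
  | .inr _, x => @add_lie (Der A) (Der A) _ _ _ D E x

lemma der_smul_lie (t : ℝ) (D Y : Der A) : ⁅t • D, Y⁆ = algebraMap ℝ A t • ⁅D, Y⁆ := by
  rw [smul_lie, algebraMap_smul]

lemma slotLie_smul_left (t : ℝ) (D : Der A) : ∀ (k : Fin r ⊕ Fin s) (x : Slot A r s k),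
    slotLie (t • D) k x = algebraMap ℝ A t • slotLie D k x
  | .inl _, x => covLie_smul_left t D x
  | .inr _, x => der_smul_lie t D x

lemma der_lie_lie (D E Y : Der A) : ⁅⁅D, E⁆, Y⁆ = ⁅D, ⁅E, Y⁆⁆ - ⁅E, ⁅D, Y⁆⁆ := lie_lie D E Y

lemma slotLie_lie (D E : Der A) : ∀ (k : Fin r ⊕ Fin s) (x : Slot A r s k),
    slotLie ⁅D, E⁆ k x = slotLie D k (slotLie E k x) - slotLie E k (slotLie D k x)
  | .inl _, x => covLie_lie D E x
  | .inr _, x => der_lie_lie D E x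

lemma tensorLie_add_left (D E : Der A) (T : Tensor A r s) :
    tensorLie (D + E) T = tensorLie D T + tensorLie E T := by
  refine MultilinearMap.ext fun a => ?_
  rw [add_apply, tensorLie_apply, tensorLie_apply, tensorLie_apply]
  simp only [slotLie_add_left, MultilinearMap.map_update_add, Finset.sum_add_distrib,
    Derivation.add_apply]
  ring

lemma tensorLie_smul_left (t : ℝ) (D : Der A) (T : Tensor A r s) :
    tensorLie (t • D) T = t • tensorLie D T := by
  refine MultilinearMap.ext fun a => ?_
  rw [smul_apply, tensorLie_apply, tensorLie_apply]
  simp only [slotLie_smul_left, MultilinearMap.map_update_smul, ← Finset.smul_sum,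
    Derivation.smul_apply]
  rw [algebraMap_smul, smul_sub]

lemma tensorLie_sub_left (D E : Der A) (T : Tensor A r s) :
    tensorLie (D - E) T = tensorLie D T - tensorLie E T := by
  refine eq_sub_of_add_eq ?_
  rw [← tensorLie_add_left, sub_add_cancel]

/-- `£_[D, E] = [£_D, £_E]`. -/
lemma tensorLie_lie (D E : Der A) (T : Tensor A r s) :
    tensorLie ⁅D, E⁆ T = tensorLie D (tensorLie E T) - tensorLie E (tensorLie D T) := by
  refine MultilinearMap.ext fun a => ?_
  -- The second application either hits the slot already used or a different one. The terms on two
  -- different slots are symmetric under exchange of `D` and `E` (`hsymm`) and cancel in the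
  -- commutator; the others give the commutator of `slotLie`.
  have key : ∀ D E : Der A, tensorLie D (tensorLie E T) a = D (E (T a)) -
      ∑ k, D (T (Function.update a k (slotLie E k (a k)))) -
      ∑ k, E (T (Function.update a k (slotLie D k (a k)))) +
      (∑ k, T (Function.update a k (slotLie E k (slotLie D k (a k)))) +
        ∑ k, ∑ l, if l = k then 0 else
          T (Function.update (Function.update a k (slotLie D k (a k))) l (slotLie E l (a l)))) := by
    intro D E
    have h1 : ∀ k, ∑ l, T (Function.update (Function.update a k (slotLie D k (a k))) l
        (slotLie E l (Function.update a k (slotLie D k (a k)) l))) =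
        T (Function.update a k (slotLie E k (slotLie D k (a k)))) +
        ∑ l, if l = k then 0 else
          T (Function.update (Function.update a k (slotLie D k (a k))) l (slotLie E l (a l))) := by
      intro k
      rw [← Finset.add_sum_erase _ _ (Finset.mem_univ k),
        ← Finset.add_sum_erase Finset.univ (fun l => if l = k then 0 else
          T (Function.update (Function.update a k (slotLie D k (a k))) l (slotLie E l (a l))))
          (Finset.mem_univ k)]
      simp only [Function.update_self, Function.update_idem, if_true, zero_add]
      congr 1
      refine Finset.sum_congr rfl fun l hl => ?_
      have hlk : l ≠ k := (Finset.mem_erase.1 hl).1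
      rw [if_neg hlk, Function.update_of_ne hlk]
    rw [tensorLie_apply]
    simp only [tensorLie_apply, h1, map_sub, map_sum, Finset.sum_sub_distrib,
      Finset.sum_add_distrib]
    ring
  have hsymm : ∑ k, ∑ l, (if l = k then 0 else
      T (Function.update (Function.update a k (slotLie D k (a k))) l (slotLie E l (a l)))) =
      ∑ k, ∑ l, if l = k then 0 else
        T (Function.update (Function.update a k (slotLie E k (a k))) l (slotLie D l (a l))) := by
    rw [Finset.sum_comm]
    refine Finset.sum_congr rfl fun k _ => Finset.sum_congr rfl fun l _ => ?_
    by_cases h : l = k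
    · subst h; simp
    · rw [if_neg h, if_neg (Ne.symm h), Function.update_comm h]
  rw [sub_apply, key D E, key E D, hsymm, tensorLie_apply]
  simp only [slotLie_lie, MultilinearMap.map_update_sub, Finset.sum_sub_distrib,
    Derivation.commutator_apply]
  ring

end TensorAlgebra

/-! ### Smooth curves of tensor fields and the product rule for Lie derivatives. -/

section TensorCurves

variable {m : ℕ} {M : Type*} [TopologicalSpace M] [ChartedSpace (Mod m) M]
  [IsManifold (𝓡 m) ∞ M] {r s : ℕ}

lemma SmoothDerCurve.lie {D E : ℝ → Der (Fn m M)} (hD : SmoothDerCurve D) (hE : SmoothDerCurve E) :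
    SmoothDerCurve fun t => ⁅D t, E t⁆ := by
  intro f hf
  simp only [Derivation.commutator_apply]
  exact (hD _ (hE _ hf)).sub (hE _ (hD _ hf))

lemma SmoothSlotCurve.lie {D : ℝ → Der (Fn m M)} (hD : SmoothDerCurve D) :
    ∀ (k : Fin r ⊕ Fin s) {a : ℝ → Slot (Fn m M) r s k}, SmoothSlotCurve k a →
      SmoothSlotCurve k fun t => slotLie (D t) k (a t)
  | .inl _, _, ha => fun Y hY => (hD _ (ha Y hY)).sub (ha _ (hD.lie hY))
  | .inr _, _, ha => hD.lie ha

lemma SmoothSlotCurve.update {a : ℝ → ∀ k, Slot (Fn m M) r s k}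
    (ha : ∀ k, SmoothSlotCurve k fun t => a t k) {k : Fin r ⊕ Fin s}
    {b : ℝ → Slot (Fn m M) r s k} (hb : SmoothSlotCurve k b) (l : Fin r ⊕ Fin s) :
    SmoothSlotCurve l fun t => Function.update (a t) k (b t) l := by
  by_cases h : l = k
  · subst h
    simpa using hb
  · simpa [Function.update_of_ne h] using ha l

lemma SmoothTensorCurve.lie {v : ℝ → VF m M} (hv : (vfCurves m M).smooth v)
    {T : ℝ → Tensor (Fn m M) r s} (hT : SmoothTensorCurve T) :
    SmoothTensorCurve fun t => tensorLie (v t).der (T t) := by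
  intro a ha
  have hD := smoothDerCurve_der hv
  exact (hD _ (hT a ha)).sub (SmoothFnCurve.sum _ fun k _ =>
    hT _ fun l => SmoothSlotCurve.update ha (SmoothSlotCurve.lie hD k (ha k)) l)

lemma SmoothTensorCurve.sub {T T' : ℝ → Tensor (Fn m M) r s} (hT : SmoothTensorCurve T)
    (hT' : SmoothTensorCurve T') : SmoothTensorCurve fun t => T t - T' t :=
  fun a ha => (hT a ha).sub (hT' a ha)

lemma SmoothTensorCurve.time_smul {T : ℝ → Tensor (Fn m M) r s} (hT : SmoothTensorCurve T) :
    SmoothTensorCurve fun t => t • T t :=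
  fun a ha => (hT a ha).time_smul

variable [T2Space M]

/-- Smoothness is tested on time-dependent functions, about which an abstract derivation says
nothing directly. In a local frame it becomes a combination, with fixed coefficients, of honest
vector fields. -/
lemma smoothDerCurve_const (D : Der (Fn m M)) : SmoothDerCurve fun _ => D := by
  intro f hf
  refine SmoothFnCurve.of_local fun x => ?_
  obtain ⟨ψ, X, e, hψ, he⟩ := exists_frame (m := m) x
  refine ⟨fun t => ∑ a, D (X a) * (e a).der (f t), SmoothFnCurve.sum _ fun a _ =>
    (smoothFnCurve_const _).mul (smoothDerCurve_der (vfCurves_const (e a)) f hf), ?_⟩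
  filter_upwards [hψ] with y hy t
  have h := congrArg (fun g : Fn m M => g y) (congrArg (fun D : Der (Fn m M) => D (f t)) (he D))
  have h1 : ψ y * D (f t) y = (∑ a, D (X a) * (e a).der (f t)) y := by
    refine h.trans (congrArg (fun g : Fn m M => g y) ?_)
    rw [der_sum_apply]
    rfl
  rwa [hy, one_mul] at h1

lemma cov_frame {ψ : Fn m M} {X : Fin m → Fn m M} {e : Fin m → VF m M}
    (he : ∀ D : Der (Fn m M), ψ • D = ∑ a, D (X a) • (e a).der) (α : Cov (Fn m M))
    (D : Der (Fn m M)) : ψ * α D = ∑ a, α (e a).der * D (X a) := by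
  have h := congrArg α (he D)
  rw [map_smul, map_sum] at h
  simp only [map_smul, smul_eq_mul] at h
  rw [h]
  exact Finset.sum_congr rfl fun a _ => mul_comm _ _

/-- Evaluation of derivations at a function. -/
def evalCov (f : Fn m M) : Cov (Fn m M) where
  toFun D := D f
  map_add' _ _ := rfl
  map_smul' _ _ := rfl

lemma cov_frame_smul {ψ : Fn m M} {X : Fin m → Fn m M} {e : Fin m → VF m M}
    (he : ∀ D : Der (Fn m M), ψ • D = ∑ a, D (X a) • (e a).der) (α : Cov (Fn m M)) :
    ψ • α = ∑ a, α (e a).der • evalCov (X a) := by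
  refine LinearMap.ext fun D => ?_
  refine (cov_frame he α D).trans ?_
  exact (map_sum (⟨⟨fun β : Cov (Fn m M) => β D, rfl⟩, fun _ _ => rfl⟩ :
    Cov (Fn m M) →+ Fn m M) (fun a => α (e a).der • evalCov (X a)) Finset.univ).symm

lemma smoothCovCurve_const (α : Cov (Fn m M)) : SmoothCovCurve fun _ => α := by
  intro D hD
  refine SmoothFnCurve.of_local fun x => ?_
  obtain ⟨ψ, X, e, hψ, he⟩ := exists_frame (m := m) x
  refine ⟨fun t => ∑ a, α (e a).der * D t (X a), SmoothFnCurve.sum _ fun a _ =>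
    (smoothFnCurve_const _).mul (hD _ (smoothFnCurve_const _)), ?_⟩
  filter_upwards [hψ] with y hy t
  have h1 : ψ y * α (D t) y = _ := congrArg (fun g : Fn m M => g y) (cov_frame he α (D t))
  rwa [hy, one_mul] at h1

/-- Frames for covector and vector slots with a common cutoff. The coefficients are evaluations on
fixed vector fields or functions, so they turn smooth curves into smooth curves. -/
lemma slot_frame (x₀ : M) : ∃ ψ : Fn m M, (∀ᶠ x in 𝓝 x₀, ψ x = 1) ∧
    ∀ k : Fin r ⊕ Fin s, ∃ (c : Fin m → Slot (Fn m M) r s k → Fn m M)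
      (e : Fin m → Slot (Fn m M) r s k),
      (∀ a : ℝ → Slot (Fn m M) r s k, SmoothSlotCurve k a → ∀ j, SmoothFnCurve fun t => c j (a t)) ∧
      ∀ x, ψ • x = ∑ j, c j x • e j := by
  obtain ⟨ψ, X, e, hψ, he⟩ := exists_frame (m := m) x₀
  refine ⟨ψ, hψ, ?_⟩
  rintro (k | k)
  · refine ⟨fun j (α : Cov (Fn m M)) => α (e j).der, fun j => evalCov (X j), ?_, ?_⟩
    · intro a ha j
      exact ha _ (smoothDerCurve_der (vfCurves_const (e j)))
    · exact cov_frame_smul he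
  · exact ⟨fun j (D : Der (Fn m M)) => D (X j), fun j => (e j).der,
      fun a ha j => ha _ (smoothFnCurve_const _), he⟩

lemma smoothSlotCurve_const : ∀ (k : Fin r ⊕ Fin s) (x : Slot (Fn m M) r s k),
    SmoothSlotCurve k fun _ => x
  | .inl _, α => smoothCovCurve_const α
  | .inr _, D => smoothDerCurve_const D

/-- Near a point, multilinearity expands the value on moving arguments into a finite sum of smooth
coefficients times fixed values of `T` on frame elements. -/
lemma smoothTensorCurve_const (T : Tensor (Fn m M) r s) : SmoothTensorCurve fun _ => T := by
  intro a ha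
  refine SmoothFnCurve.of_local fun x => ?_
  obtain ⟨ψ, hψ, h⟩ := slot_frame (m := m) (r := r) (s := s) x
  choose c e hc he using h
  refine ⟨fun t => ∑ J : Fin r ⊕ Fin s → Fin m, (∏ k, c k (J k) (a t k)) * T fun k => e k (J k),
    SmoothFnCurve.sum _ fun J _ => (SmoothFnCurve.prod _ fun k _ => hc k _ (ha k) _).mul
      (smoothFnCurve_const _), ?_⟩
  filter_upwards [hψ] with y hy t
  -- Every slot contributes one factor `ψ`; the product is `1` near the point.
  have h1 : (∏ _k : Fin r ⊕ Fin s, ψ) * T (a t) =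
      ∑ J : Fin r ⊕ Fin s → Fin m, (∏ k, c k (J k) (a t k)) * T fun k => e k (J k) := by
    have h2 := T.map_smul_univ (fun _ => ψ) (a t)
    rw [smul_eq_mul] at h2
    rw [← h2]
    simp only [he]
    rw [MultilinearMap.map_sum]
    refine Finset.sum_congr rfl fun J _ => ?_
    rw [T.map_smul_univ, smul_eq_mul]
  have h3 : (∏ _k : Fin r ⊕ Fin s, ψ) y = 1 := by
    have : (∏ _k : Fin r ⊕ Fin s, ψ) y = ∏ _k : Fin r ⊕ Fin s, ψ y :=
      map_prod (⟨⟨fun f : Fn m M => f y, rfl⟩, fun _ _ => rfl⟩ : Fn m M →* ℝ) (fun _ => ψ) _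
    rw [this, hy, Finset.prod_const_one]
  have h4 := congrArg (fun g : Fn m M => g y) h1
  have h5 : (∏ _k : Fin r ⊕ Fin s, ψ) y * T (a t) y = _ := h4
  rwa [h3, one_mul] at h5

lemma SmoothTensorCurve.apply_const {T : ℝ → Tensor (Fn m M) r s} (hT : SmoothTensorCurve T)
    (a : ∀ k, Slot (Fn m M) r s k) : SmoothFnCurve fun t => T t a :=
  hT (fun _ => a) fun k => smoothSlotCurve_const k (a k)

lemma hasDerivAt_tensorLie_const {T : ℝ → Tensor (Fn m M) r s} (hT : SmoothTensorCurve T)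
    {T' : Tensor (Fn m M) r s}
    (hT' : ∀ a x, HasDerivAt (fun t => T t a x) (T' a x) 0) (v : VF m M)
    (a : ∀ k, Slot (Fn m M) r s k) (x : M) :
    HasDerivAt (fun t => tensorLie v.der (T t) a x) (tensorLie v.der T' a x) 0 := by
  have h1 := hasDerivAt_der (hT.apply_const a) (hT' a) v x
  have h2 := HasDerivAt.fun_sum (u := Finset.univ) fun (k : Fin r ⊕ Fin s) _ =>
    hT' (Function.update a k (slotLie v.der k (a k))) x
  have h3 := h1.sub h2
  have h4 : ∀ S : Tensor (Fn m M) r s, tensorLie v.der S a x = v.der (S a) x -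
      ∑ k, S (Function.update a k (slotLie v.der k (a k))) x := by
    intro S
    rw [← fn_sum_apply]
    rfl
  rw [h4]
  exact h3.congr_of_eventuallyEq (Filter.Eventually.of_forall fun t => h4 _)

variable {ι : Type*} {r s : ι → ℕ}

lemma fieldCurves_smooth_lie {c : ℝ → Fields m M r s} (hc : (fieldCurves m M r s).smooth c)
    {v : ℝ → VF m M} (hv : (vfCurves m M).smooth v) :
    (fieldCurves m M r s).smooth fun t => fieldLie (v t) (c t) :=
  fun i => (hc i).lie hv

lemma fieldCurves_smooth_const (φ : Fields m M r s) : (fieldCurves m M r s).smooth fun _ => φ :=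
  fun i => smoothTensorCurve_const (φ i)

lemma fieldLie_add_left (v w : VF m M) (φ : Fields m M r s) :
    fieldLie (v + w) φ = fieldLie v φ + fieldLie w φ :=
  funext fun i => by
    rw [fieldLie, der_add, tensorLie_add_left]
    rfl

lemma fieldLie_sub_left (v w : VF m M) (φ : Fields m M r s) :
    fieldLie (v - w) φ = fieldLie v φ - fieldLie w φ :=
  funext fun i => by
    rw [fieldLie, der_sub, tensorLie_sub_left]
    rfl

lemma fieldLie_bracket (v w : VF m M) (φ : Fields m M r s) :
    fieldLie (v.bracket w) φ = fieldLie v (fieldLie w φ) - fieldLie w (fieldLie v φ) :=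
  funext fun i => by
    rw [fieldLie, der_bracket, tensorLie_lie]
    rfl

/-- The velocity of a curve of Lie derivatives. -/
lemma fieldCurves_velocity_lie {c : ℝ → Fields m M r s} (hc : (fieldCurves m M r s).smooth c)
    {χ : Fields m M r s} (hχ : (fieldCurves m M r s).velocity c χ)
    {v : ℝ → VF m M} (hv : (vfCurves m M).smooth v) {w : VF m M}
    (hw : (vfCurves m M).velocity v w) :
    (fieldCurves m M r s).velocity (fun t => fieldLie (v t) (c t))
      (fieldLie (v 0) χ + fieldLie w (c 0)) := by
  -- The time dependence of the vector field becomes an explicit factor `t`. The derivative at `0`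
  -- of `t` times a differentiable function is its value there, so the variation of `v' t` itself
  -- never enters.
  obtain ⟨v', hv', hv0, hvt⟩ := exists_div_time hv hw
  intro i a x
  have h1 := hasDerivAt_tensorLie_const (hc i) (hχ i) (v 0) a x
  have h2 := ((hc i).lie hv').apply_const a
  have h3 : HasDerivAt (fun t => tensorLie (v' t).der (c t i) a x) _ 0 :=
    ((h2.contDiff x).differentiable (by simp) 0).hasDerivAt
  have h4 := h1.add ((hasDerivAt_id (0 : ℝ)).mul h3)
  have h5 : ∀ t, fieldLie (v t) (c t) i a x = tensorLie (v 0).der (c t i) a x +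
      t * tensorLie (v' t).der (c t i) a x := by
    intro t
    rw [fieldLie, hvt t, der_add, der_smul, tensorLie_add_left, tensorLie_smul_left]
    rfl
  refine (h4.congr_of_eventuallyEq (Filter.Eventually.of_forall h5)).congr_deriv ?_
  rw [← hv0]
  simp only [id, one_mul, zero_mul, add_zero]
  rfl

end TensorCurves
end CovPhase
end

noncomputable section

namespace CovPhase

/-! ### Velocities and smooth maps -/

section Velocities

variable {m k p : ℕ} {X : Type*} [TopologicalSpace X] [ChartedSpace (Mod m) X]
  {Y : Type*} [TopologicalSpace Y] [ChartedSpace (Mod k) Y]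
  [IsManifold (𝓡 m) ∞ X] [IsManifold (𝓡 k) ∞ Y]

lemma formCurves_velocity_unique {c : ℝ → DForm m p X} {η θ : DForm m p X}
    (h : (formCurves m p X).velocity c η) (h' : (formCurves m p X).velocity c θ) : η = θ :=
  funext fun x => ContinuousAlternatingMap.ext fun w => (h x w).unique (h' x w)

lemma SmoothFormCurve.velocity_add {c d : ℝ → DForm m p X} {η θ : DForm m p X}
    (hc : (formCurves m p X).velocity c η) (hd : (formCurves m p X).velocity d θ) :
    (formCurves m p X).velocity (fun t => c t + d t) (η + θ) :=
  fun x w => (hc x w).add (hd x w)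

lemma SmoothFormCurve.velocity_sub {c d : ℝ → DForm m p X} {η θ : DForm m p X}
    (hc : (formCurves m p X).velocity c η) (hd : (formCurves m p X).velocity d θ) :
    (formCurves m p X).velocity (fun t => c t - d t) (η - θ) :=
  fun x w => (hc x w).sub (hd x w)

lemma SmoothFormCurve.velocity_pullback {c : ℝ → DForm m p X} {η : DForm m p X}
    (hc : (formCurves m p X).velocity c η) (f : Y → X) :
    (formCurves k p Y).velocity (fun t => CovPhase.pullback f (c t)) (CovPhase.pullback f η) :=
  fun y w => hc (f y) fun a => mapD k m f y (w a)

/-- Forms evaluated on the first argument. -/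
lemma hasDerivAt_curryLeft {η : ℝ → Mod m [⋀^Fin (p + 1)]→L[ℝ] ℝ}
    {η' : Mod m [⋀^Fin (p + 1)]→L[ℝ] ℝ} (hη : ∀ w, HasDerivAt (fun t => η t w) (η' w) 0)
    {v : ℝ → Mod m} {v' : Mod m} (hv : HasDerivAt v v' 0) (w : Fin p → Mod m) :
    HasDerivAt (fun t => (η t).curryLeft (v t) w)
      ((η'.curryLeft (v 0) + (η 0).curryLeft v') w) 0 := by
  -- The derivative of `η` is known only on fixed arguments, so the moving argument is expanded in
  -- the basis and the product rule is used termwise.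
  have hsum : ∀ (θ : Mod m [⋀^Fin (p + 1)]→L[ℝ] ℝ) (z : Mod m), θ.curryLeft z w =
      ∑ a, z a * θ (Matrix.vecCons (EuclideanSpace.basisFun (Fin m) ℝ a) w) := by
    intro θ z
    have hz : z = ∑ a, z a • EuclideanSpace.basisFun (Fin m) ℝ a := by
      simpa using ((EuclideanSpace.basisFun (Fin m) ℝ).sum_repr z).symm
    have h1 : θ.curryLeft z = ∑ a, z a • θ.curryLeft (EuclideanSpace.basisFun (Fin m) ℝ a) := by
      conv_lhs => rw [hz]
      rw [map_sum]
      exact Finset.sum_congr rfl fun a _ => map_smul _ _ _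
    rw [h1, ContinuousAlternatingMap.sum_apply]
    rfl
  have hvc : ∀ a, HasDerivAt (fun t => v t a) (v' a) 0 := fun a =>
    ((EuclideanSpace.proj (𝕜 := ℝ) a : Mod m →L[ℝ] ℝ).hasFDerivAt (x := v 0)).comp_hasDerivAt 0 hv
  have h2 := HasDerivAt.fun_sum (u := Finset.univ) fun (a : Fin m) _ =>
    (hvc a).mul (hη (Matrix.vecCons (EuclideanSpace.basisFun (Fin m) ℝ a) w))
  refine (h2.congr_of_eventuallyEq (Filter.Eventually.of_forall fun t => hsum _ _)).congr_deriv ?_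
  change _ = η'.curryLeft (v 0) w + (η 0).curryLeft v' w
  rw [hsum, hsum, ← Finset.sum_add_distrib]
  exact Finset.sum_congr rfl fun a _ => add_comm _ _

lemma SmoothFormCurve.velocity_intProd {c : ℝ → DForm m (p + 1) X} {η : DForm m (p + 1) X}
    (hc : (formCurves m (p + 1) X).velocity c η) {v : ℝ → RawVF m X} {v' : RawVF m X}
    (hv : ∀ x, @HasDerivAt ℝ _ (Mod m) _ _ _ _ (fun t => v t x) (v' x) 0) :
    (formCurves m p X).velocity (fun t => CovPhase.intProd (v t) (c t))
      (CovPhase.intProd (v 0) η + CovPhase.intProd v' (c 0)) :=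
  fun x w => hasDerivAt_curryLeft (η := fun t => c t x) (fun w => hc x w) (hv x) w

variable {V : Type*} {a : CurveStruct V} {D : Set V}

lemma IsSmoothMap.form_add {α α' : V → DForm m p X} (h : IsSmoothMap a (formCurves m p X) D α)
    (h' : IsSmoothMap a (formCurves m p X) D α') :
    IsSmoothMap a (formCurves m p X) D fun q => α q + α' q := by
  refine ⟨fun c hc hD => SmoothFormCurve.add (h.1 c hc hD) (h'.1 c hc hD), fun q hq v => ?_⟩
  obtain ⟨w, hw⟩ := h.2 q hq v
  obtain ⟨w', hw'⟩ := h'.2 q hq v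
  exact ⟨w + w', fun c hc hD h0 hv =>
    SmoothFormCurve.velocity_add (hw c hc hD h0 hv) (hw' c hc hD h0 hv)⟩

lemma IsSmoothMap.form_sub {α α' : V → DForm m p X} (h : IsSmoothMap a (formCurves m p X) D α)
    (h' : IsSmoothMap a (formCurves m p X) D α') :
    IsSmoothMap a (formCurves m p X) D fun q => α q - α' q := by
  refine ⟨fun c hc hD => SmoothFormCurve.sub (h.1 c hc hD) (h'.1 c hc hD), fun q hq v => ?_⟩
  obtain ⟨w, hw⟩ := h.2 q hq v
  obtain ⟨w', hw'⟩ := h'.2 q hq v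
  exact ⟨w - w', fun c hc hD h0 hv =>
    SmoothFormCurve.velocity_sub (hw c hc hD h0 hv) (hw' c hc hD h0 hv)⟩

lemma IsSmoothMap.form_pullback {α : V → DForm m p X} (h : IsSmoothMap a (formCurves m p X) D α)
    {f : Y → X} (hf : ContMDiff (𝓡 k) (𝓡 m) ∞ f) :
    IsSmoothMap a (formCurves k p Y) D fun q => pullback f (α q) := by
  refine ⟨fun c hc hD => SmoothFormCurve.pullback hf (h.1 c hc hD), fun q hq v => ?_⟩
  obtain ⟨w, hw⟩ := h.2 q hq v
  exact ⟨pullback f w, fun c hc hD h0 hv => SmoothFormCurve.velocity_pullback (hw c hc hD h0 hv) f⟩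

end Velocities

/-! ### Calculus on field space -/

namespace FieldSpace

variable {m : ℕ} {M : Type*} [TopologicalSpace M] [ChartedSpace (Mod m) M]
  [IsManifold (𝓡 m) ∞ M] {ι : Type*} {r s : ι → ℕ} {F : FieldSpace m M r s}
  {k p : ℕ} {X : Type*} [TopologicalSpace X] [ChartedSpace (Mod k) X] [IsManifold (𝓡 k) ∞ X]
  {φ χ : Fields m M r s}

lemma hat_mem (hφ : φ ∈ F.configs) (ξ : Fields m M r s → VF m M) : hat ξ φ ∈ F.variations :=
  F.lie_mem _ _ (F.configs_subset φ hφ)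

/-- The variations are a module over smooth functions; real scalars act as constant functions. -/
lemma real_smul_mem (t : ℝ) (hχ : χ ∈ F.variations) : t • χ ∈ F.variations := by
  have h : t • χ = algebraMap ℝ (Fn m M) t • χ := by
    refine funext fun i => MultilinearMap.ext fun a => ?_
    change t • χ i a = algebraMap ℝ (Fn m M) t • χ i a
    rw [algebraMap_smul]
  rw [h]
  exact F.variations.smul_mem _ hχ

/-- The choice made in `variation` is forced: some curve through `φ` has velocity `χ`, and
velocities of curves of forms are unique. This is where `χ` must be an allowed variation. -/
lemma delta_eq (hφ : φ ∈ F.configs) (hχ : χ ∈ F.variations)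
    {α : Fields m M r s → DForm k p X} {w : DForm k p X}
    (h : HasVariation (fieldCurves m M r s) (formCurves k p X) F.configs α φ χ w) :
    F.delta α φ χ = w := by
  have h' : ∃ w, HasVariation (fieldCurves m M r s) (formCurves k p X) F.configs α φ χ w := ⟨w, h⟩
  obtain ⟨c, hc, hD, h0, hv⟩ := F.exists_curve φ hφ χ hχ
  rw [delta, variation, dif_pos h']
  exact formCurves_velocity_unique (h'.choose_spec c hc hD h0 hv) (h c hc hD h0 hv)

lemma deltaReal_eq (hφ : φ ∈ F.configs) (hχ : χ ∈ F.variations)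
    {H : Fields m M r s → ℝ} {w : ℝ}
    (h : HasVariation (fieldCurves m M r s) realCurves F.configs H φ χ w) :
    F.deltaReal H φ χ = w := by
  have h' : ∃ w, HasVariation (fieldCurves m M r s) realCurves F.configs H φ χ w := ⟨w, h⟩
  obtain ⟨c, hc, hD, h0, hv⟩ := F.exists_curve φ hφ χ hχ
  rw [deltaReal, variation, dif_pos h']
  exact HasDerivAt.unique (h'.choose_spec c hc hD h0 hv) (h c hc hD h0 hv)

lemma hasVariation_delta (hφ : φ ∈ F.configs) {α : Fields m M r s → DForm k p X}
    (h : IsSmoothMap (fieldCurves m M r s) (formCurves k p X) F.configs α) (χ : Fields m M r s) :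
    HasVariation (fieldCurves m M r s) (formCurves k p X) F.configs α φ χ (F.delta α φ χ) := by
  have h' := h.2 φ hφ χ
  rw [delta, variation, dif_pos h']
  exact h'.choose_spec

lemma IsFieldDepVF.hasVariation {ξ : Fields m M r s → VF m M} (h : F.IsFieldDepVF ξ)
    (hφ : φ ∈ F.configs) (χ : Fields m M r s) :
    HasVariation (fieldCurves m M r s) (vfCurves m M) F.configs ξ φ χ (F.deltaVF ξ φ χ) := by
  have h' := h.2 φ hφ χ
  rw [deltaVF, variation, dif_pos h']
  exact h'.choose_spec

lemma isSmoothForm_of_isSmoothMap (hφ : φ ∈ F.configs) {α : Fields m M r s → DForm k p X}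
    (h : IsSmoothMap (fieldCurves m M r s) (formCurves k p X) F.configs α) :
    IsSmoothForm (α φ) := by
  obtain ⟨c, hc, hD, h0, -⟩ := F.exists_curve φ hφ 0 F.variations.zero_mem
  have := SmoothFormCurve.apply (h.1 c hc hD) 0
  simpa only [h0] using this

/-! ### One-forms on field space: the chain rule and the anomaly of a contraction. -/

section OneForms

variable {β : Fields m M r s → Fields m M r s → DForm k p X}

lemma IsOneForm.map_sub (hβ : F.IsOneForm β) (hφ : φ ∈ F.configs) {χ₁ χ₂ : Fields m M r s}
    (h₁ : χ₁ ∈ F.variations) (h₂ : χ₂ ∈ F.variations) : β φ (χ₁ - χ₂) = β φ χ₁ - β φ χ₂ := by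
  refine eq_sub_of_add_eq ?_
  rw [← hβ.1 φ hφ _ (F.variations.sub_mem h₁ h₂) _ h₂, sub_add_cancel]

lemma IsOneForm.sub (hβ : F.IsOneForm β) {β' : Fields m M r s → Fields m M r s → DForm k p X}
    (hβ' : F.IsOneForm β') : F.IsOneForm fun φ χ => β φ χ - β' φ χ := by
  refine ⟨fun φ hφ χ₁ h₁ χ₂ h₂ => ?_, fun φ hφ a χ hχ => ?_, hβ.2.2.form_sub hβ'.2.2⟩
  · dsimp only
    rw [hβ.1 φ hφ χ₁ h₁ χ₂ h₂, hβ'.1 φ hφ χ₁ h₁ χ₂ h₂]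
    abel
  · dsimp only
    rw [hβ.2.1 φ hφ a χ hχ, hβ'.2.1 φ hφ a χ hχ, smul_sub]

lemma IsOneForm.pullback (hβ : F.IsOneForm β) {l : ℕ} {Y : Type*} [TopologicalSpace Y]
    [ChartedSpace (Mod l) Y] [IsManifold (𝓡 l) ∞ Y] {f : Y → X}
    (hf : ContMDiff (𝓡 l) (𝓡 k) ∞ f) :
    F.IsOneForm fun φ χ => CovPhase.pullback (k := l) f (β φ χ) := by
  refine ⟨fun φ hφ χ₁ h₁ χ₂ h₂ => ?_, fun φ hφ a χ hχ => ?_, hβ.2.2.form_pullback hf⟩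
  · dsimp only
    rw [hβ.1 φ hφ χ₁ h₁ χ₂ h₂]
    rfl
  · dsimp only
    rw [hβ.2.1 φ hφ a χ hχ]
    rfl

variable [T2Space M]

lemma IsOneForm.isSmoothMap (hβ : F.IsOneForm β) (hχ : χ ∈ F.variations) :
    IsSmoothMap (fieldCurves m M r s) (formCurves k p X) F.configs fun ψ => β ψ χ := by
  refine ⟨fun c hc hD => hβ.2.2.1 (fun t => (c t, χ)) ⟨hc, fieldCurves_smooth_const χ⟩
    fun t => ⟨hD t, hχ⟩, fun φ hφ v => ?_⟩
  obtain ⟨w, hw⟩ := hβ.2.2.2 (φ, χ) ⟨hφ, hχ⟩ (v, 0)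
  exact ⟨w, fun c hc hD h0 hv => hw (fun t => (c t, χ)) ⟨hc, fieldCurves_smooth_const χ⟩
    (fun t => ⟨hD t, hχ⟩) (Prod.ext h0 rfl) ⟨hv, fun i a x => hasDerivAt_const 0 (χ i a x)⟩⟩

lemma IsOneForm.isSmoothForm (hβ : F.IsOneForm β) (hφ : φ ∈ F.configs) (hχ : χ ∈ F.variations) :
    IsSmoothForm (β φ χ) := isSmoothForm_of_isSmoothMap hφ (hβ.isSmoothMap hχ)

/-- The velocity of a one-form along a curve of fields and variations. -/
lemma IsOneForm.velocity (hβ : F.IsOneForm β) {c e : ℝ → Fields m M r s} {e' : Fields m M r s}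
    (hc : (fieldCurves m M r s).smooth c) (hD : ∀ t, c t ∈ F.configs)
    (hv : (fieldCurves m M r s).velocity c χ)
    (he : (fieldCurves m M r s).smooth e) (heD : ∀ t, e t ∈ F.variations)
    (hev : (fieldCurves m M r s).velocity e e') (he' : e' ∈ F.variations) :
    (formCurves k p X).velocity (fun t => β (c t) (e t))
      (F.delta (fun ψ => β ψ (e 0)) (c 0) χ + β (c 0) e') := by
  have h1 := hasVariation_delta (hD 0) (hβ.isSmoothMap (heD 0)) χ c hc hD rfl hv
  -- By linearity `β(c; e)` splits into `β(c; e 0)` and `β(c; e - e 0)`. For the second part, all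
  -- curves of pairs through `(c 0, 0)` with velocity `(χ, e')` share the image velocity `w`.
  obtain ⟨w, hw⟩ := hβ.2.2.2 (c 0, 0) ⟨hD 0, F.variations.zero_mem⟩ (χ, e')
  have h2 := hw (fun t => (c t, e t - e 0)) ⟨hc, fun i => (he i).sub (smoothTensorCurve_const _)⟩
    (fun t => ⟨hD t, F.variations.sub_mem (heD t) (heD 0)⟩) (Prod.ext rfl (sub_self _))
    ⟨hv, fun i a x => (hev i a x).sub_const (e 0 i a x)⟩
  have hmem : ∀ t : ℝ, t • e' ∈ F.variations := fun t =>
    real_smul_mem t he'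
  -- Another such curve, for which linearity makes the image `t • β(c; e')`; this identifies `w` as
  -- `β(c 0; e')`.
  have h3 := hw (fun t => (c t, t • e')) ⟨hc, fun i => (smoothTensorCurve_const (e' i)).time_smul⟩
    (fun t => ⟨hD t, hmem t⟩) (Prod.ext rfl (zero_smul _ _))
    ⟨hv, fun i a x => by simpa using (hasDerivAt_id (0 : ℝ)).mul_const (e' i a x)⟩
  have h4 := hasVariation_delta (hD 0) (hβ.isSmoothMap he') χ c hc hD rfl hv
  have h5 : (formCurves k p X).velocity (fun t => β (c t) (t • e')) (β (c 0) e') := by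
    intro x z
    have h6 := (hasDerivAt_id (0 : ℝ)).mul (h4 x z)
    refine (h6.congr_of_eventuallyEq (Filter.Eventually.of_forall fun t => ?_)).congr_deriv ?_
    · change β (c t) (t • e') x z = t * β (c t) e' x z
      rw [hβ.2.1 _ (hD t) t e' he']
      rfl
    · simp
  rw [formCurves_velocity_unique h3 h5] at h2
  have h7 : (fun t => β (c t) (e t)) = fun t => β (c t) (e 0) + β (c t) (e t - e 0) := by
    funext t
    rw [← hβ.1 _ (hD t) _ (heD 0) _ (F.variations.sub_mem (heD t) (heD 0)), add_sub_cancel]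
  rw [h7]
  exact SmoothFormCurve.velocity_add h1 h2

variable {ξ ζ : Fields m M r s → VF m M}

/-- The variation of `ψ ↦ β(ψ; £_ξ ψ)`. -/
lemma IsOneForm.hasVariation_hat (hβ : F.IsOneForm β) (hξ : F.IsFieldDepVF ξ)
    (hφ : φ ∈ F.configs) (hχ : χ ∈ F.variations) :
    HasVariation (fieldCurves m M r s) (formCurves k p X) F.configs (fun ψ => β ψ (hat ξ ψ)) φ χ
      (F.delta (fun ψ => β ψ (hat ξ φ)) φ χ +
        β φ (fieldLie (ξ φ) χ + fieldLie (F.deltaVF ξ φ χ) φ)) := by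
  intro c hc hD h0 hv
  have h1 := hξ.hasVariation hφ χ c hc hD h0 hv
  have h2 := hβ.velocity hc hD hv (fieldCurves_smooth_lie hc (hξ.1 c hc hD))
    (fun t => F.lie_mem _ _ (F.configs_subset _ (hD t)))
    (fieldCurves_velocity_lie hc hv (hξ.1 c hc hD) h1)
    (F.variations.add_mem (F.lie_mem _ _ hχ) (F.lie_mem _ _ (F.configs_subset _ (hD 0))))
  rw [h0] at h2
  exact h2

lemma IsOneForm.delta_hat (hβ : F.IsOneForm β) (hξ : F.IsFieldDepVF ξ)
    (hφ : φ ∈ F.configs) (hχ : χ ∈ F.variations) :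
    F.delta (fun ψ => β ψ (hat ξ ψ)) φ χ = F.delta (fun ψ => β ψ (hat ξ φ)) φ χ +
        β φ (fieldLie (ξ φ) χ + fieldLie (F.deltaVF ξ φ χ) φ) :=
  delta_eq hφ hχ (hβ.hasVariation_hat hξ hφ hχ)

lemma IsOneForm.isSmoothMap_hat (hβ : F.IsOneForm β) (hξ : F.IsFieldDepVF ξ) :
    IsSmoothMap (fieldCurves m M r s) (formCurves k p X) F.configs fun ψ => β ψ (hat ξ ψ) := by
  refine ⟨fun c hc hD => hβ.2.2.1 (fun t => (c t, hat ξ (c t)))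
    ⟨hc, fieldCurves_smooth_lie hc (hξ.1 c hc hD)⟩ fun t => ⟨hD t, hat_mem (hD t) ξ⟩,
    fun φ hφ χ => ?_⟩
  by_cases h : ∃ c : ℝ → Fields m M r s, (fieldCurves m M r s).smooth c ∧ (∀ t, c t ∈ F.configs) ∧
      c 0 = φ ∧ (fieldCurves m M r s).velocity c χ
  · obtain ⟨c, hc, hD, h0, hv⟩ := h
    obtain ⟨w, hw⟩ := hβ.2.2.2 (φ, hat ξ φ) ⟨hφ, hat_mem hφ ξ⟩
      (χ, fieldLie (ξ φ) χ + fieldLie (F.deltaVF ξ φ χ) φ)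
    refine ⟨w, fun c hc hD h0 hv => ?_⟩
    have h2 := fieldCurves_velocity_lie hc hv (hξ.1 c hc hD)
      (hξ.hasVariation hφ χ c hc hD h0 hv)
    rw [h0] at h2
    exact hw (fun t => (c t, hat ξ (c t))) ⟨hc, fieldCurves_smooth_lie hc (hξ.1 c hc hD)⟩
      (fun t => ⟨hD t, hat_mem (hD t) ξ⟩) (Prod.ext h0 (by rw [h0])) ⟨hv, h2⟩
  · exact ⟨0, fun c hc hD h0 hv => (h ⟨c, hc, hD, h0, hv⟩).elim⟩

/-- The variation along `χ` with the argument `hat ξ φ` frozen occurs in `I δ` and in `δ I` with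
opposite signs. -/
lemma IsOneForm.lieOne_eq (hβ : F.IsOneForm β) (hξ : F.IsFieldDepVF ξ)
    (hφ : φ ∈ F.configs) (hχ : χ ∈ F.variations) :
    F.lieOne ξ β φ χ = F.delta (fun ψ => β ψ χ) φ (hat ξ φ) +
      β φ (fieldLie (ξ φ) χ + fieldLie (F.deltaVF ξ φ χ) φ) := by
  rw [lieOne, deltaOne, hβ.delta_hat hξ hφ hχ]
  abel

/-- `(Δ_ξ̂ β)(ζ̂) = Δ_ξ̂ (I_ζ̂ β) - I_{Δ_ξ̂ ζ} β`. -/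
lemma IsOneForm.anomalyOne_hat (hβ : F.IsOneForm β) (res : VF m M → RawVF k X)
    (hξ : F.IsFieldDepVF ξ) (hζ : F.IsFieldDepVF ζ) (hφ : φ ∈ F.configs) :
    F.anomalyOne res ξ β φ (hat ζ φ) = F.anomalyZero res ξ (fun ψ => β ψ (hat ζ ψ)) φ -
      β φ (fieldLie (F.anomalyVF ξ ζ φ) φ) := by
  have hm := F.configs_subset φ hφ
  have hX := hat_mem hφ ξ
  have hZ := hat_mem hφ ζ
  have hL : ∀ v χ, χ ∈ F.variations → fieldLie v χ ∈ F.variations := F.lie_mem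
  -- Both sides contain the variation along `ξ̂` with the argument `ζ̂` frozen. The term `I_δξ̂` of
  -- the anomaly operator removes the contribution of `δξ`, and the remaining values of `β` match by
  -- the commutator formula for Lie derivatives of the fields.
  rw [anomalyOne, anomalyZero, lieZero, hβ.lieOne_eq hξ hφ hZ, hβ.delta_hat hζ hφ hX, anomalyVF,
    fieldLie_sub_left, fieldLie_bracket]
  rw [hβ.1 φ hφ _ (hL _ _ hZ) _ (hL _ _ hm), hβ.1 φ hφ _ (hL _ _ hX) _ (hL _ _ hm),
    hβ.map_sub hφ (hL _ _ hm) (F.variations.sub_mem (hL _ _ (hL _ _ hm)) (hL _ _ (hL _ _ hm))),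
    hβ.map_sub hφ (hL _ _ (hL _ _ hm)) (hL _ _ (hL _ _ hm))]
  simp only [hat]
  abel

end OneForms

end FieldSpace
end CovPhase
end

noncomputable section

namespace CovPhase

/-! ### Integration of top-degree forms -/

section Euclidean

open MeasureTheory

variable {m : ℕ} {G : Type*} [NormedAddCommGroup G] [NormedSpace ℝ G]

lemma top_comp_det (θ : Mod m [⋀^Fin m]→L[ℝ] ℝ) (A : Mod m →L[ℝ] Mod m) :
    θ.compContinuousLinearMap A (EuclideanSpace.basisFun (Fin m) ℝ) =
      A.det * θ (EuclideanSpace.basisFun (Fin m) ℝ) := by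
  have h := θ.toAlternatingMap.eq_smul_basis_det (EuclideanSpace.basisFun (Fin m) ℝ).toBasis
  have h1 : θ.toAlternatingMap (⇑(A : Mod m →ₗ[ℝ] Mod m) ∘
      ⇑(EuclideanSpace.basisFun (Fin m) ℝ).toBasis) =
      A.det * θ.toAlternatingMap (EuclideanSpace.basisFun (Fin m) ℝ).toBasis := by
    conv_lhs => rw [h]
    rw [AlternatingMap.smul_apply, Module.Basis.det_comp, Module.Basis.det_self, smul_eq_mul, mul_one,
      mul_comm]
  simpa using h1

lemma top_eq_zero {θ : Mod m [⋀^Fin m]→L[ℝ] ℝ}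
    (h : θ (EuclideanSpace.basisFun (Fin m) ℝ) = 0) : θ = 0 := by
  have h1 := θ.toAlternatingMap.eq_smul_basis_det (EuclideanSpace.basisFun (Fin m) ℝ).toBasis
  have h2 : θ.toAlternatingMap (EuclideanSpace.basisFun (Fin m) ℝ).toBasis = 0 := by simpa using h
  rw [h2, zero_smul] at h1
  exact ContinuousAlternatingMap.toAlternatingMap_injective h1

/-- Extension by zero of a family supported in a compact `K ⊆ O`: a point outside `O` has the
complement of `K` as a neighbourhood, on which the extension vanishes. -/
lemma contDiff_indicator {O K : Set (Mod m)} (hO : IsOpen O) (hK : IsCompact K)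
    {g : ℝ × Mod m → G} (hg : ∀ t, ∀ u ∈ O, ContDiffAt ℝ ∞ g (t, u))
    (h0 : ∀ t, ∀ u ∈ O, u ∉ K → g (t, u) = 0) (hKO : K ⊆ O) :
    ContDiff ℝ ∞ fun q : ℝ × Mod m => O.indicator (fun u => g (q.1, u)) q.2 := by
  rw [contDiff_iff_contDiffAt]
  rintro ⟨t, u⟩
  have hs : Filter.Tendsto (Prod.snd : ℝ × Mod m → Mod m) (𝓝 (t, u)) (𝓝 u) := continuous_snd.tendsto _
  by_cases hu : u ∈ O
  · refine (hg t u hu).congr_of_eventuallyEq ?_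
    filter_upwards [hs.eventually (hO.mem_nhds hu)] with q hq
    rw [Set.indicator_of_mem hq]
  · refine (contDiffAt_const (c := (0 : G))).congr_of_eventuallyEq ?_
    filter_upwards [hs.eventually (hK.isClosed.isOpen_compl.mem_nhds fun h => hu (hKO h))] with q hq
    by_cases hq' : q.2 ∈ O
    · rw [Set.indicator_of_mem hq', h0 _ _ hq' hq]
    · rw [Set.indicator_of_notMem hq']

lemma contDiff_indicator' {O K : Set (Mod m)} (hO : IsOpen O) (hK : IsCompact K)
    {g : Mod m → G} (hg : ∀ u ∈ O, ContDiffAt ℝ ∞ g u)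
    (h0 : ∀ u ∈ O, u ∉ K → g u = 0) (hKO : K ⊆ O) : ContDiff ℝ ∞ (O.indicator g) := by
  have h := contDiff_indicator (g := fun q => g q.2) hO hK
    (fun t u hu => (hg u hu).comp (t, u) contDiffAt_snd) (fun _ => h0) hKO
  exact h.comp (contDiff_prodMk_right (0 : ℝ))

lemma hasCompactSupport_indicator {O K : Set (Mod m)} (hK : IsCompact K) {g : Mod m → G}
    (h0 : ∀ u ∈ O, u ∉ K → g u = 0) : HasCompactSupport (O.indicator g) := by
  refine HasCompactSupport.intro hK fun u hu => ?_
  by_cases h : u ∈ O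
  · rw [Set.indicator_of_mem h, h0 u h hu]
  · rw [Set.indicator_of_notMem h]

lemma integrable_indicator {O K : Set (Mod m)} (hO : IsOpen O) (hK : IsCompact K)
    {g : Mod m → ℝ} (hg : ∀ u ∈ O, ContDiffAt ℝ ∞ g u)
    (h0 : ∀ u ∈ O, u ∉ K → g u = 0) (hKO : K ⊆ O) : IntegrableOn g O := by
  rw [← integrable_indicator_iff hO.measurableSet]
  exact (contDiff_indicator' hO hK hg h0 hKO).continuous.integrable_of_hasCompactSupport
    (hasCompactSupport_indicator hK h0)

/-- Differentiation under the integral sign for smooth families supported in a compact set. -/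
lemma hasDerivAt_integral_of_contDiff {F : ℝ × Mod m → ℝ} (hF : ContDiff ℝ ∞ F)
    {K : Set (Mod m)} (hK : IsCompact K) (h0 : ∀ t, ∀ u ∉ K, F (t, u) = 0) :
    HasDerivAt (fun t => ∫ u, F (t, u)) (∫ u, fderiv ℝ F (0, u) (1, 0)) 0 := by
  have hd : ∀ t u, HasDerivAt (fun t => F (t, u)) (fderiv ℝ F (t, u) (1, 0)) t := fun t u =>
    HasFDerivAt.comp_hasDerivAt (f := fun t : ℝ => (t, u)) t
      (hF.differentiable (by simp) (t, u)).hasFDerivAt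
      ((hasDerivAt_id t).prodMk (hasDerivAt_const t u))
  have hF' : Continuous fun q : ℝ × Mod m => fderiv ℝ F q (1, 0) :=
    (hF.continuous_fderiv (by simp)).clm_apply continuous_const
  have h0' : ∀ t, ∀ u ∉ K, fderiv ℝ F (t, u) (1, 0) = 0 := fun t u hu => by
    refine (hd t u).unique ?_
    simp only [h0 _ u hu]
    exact hasDerivAt_const _ _
  obtain ⟨C, hC⟩ := ((isCompact_Icc (a := (-1 : ℝ)) (b := 1)).prod hK).exists_bound_of_continuousOn
    hF'.continuousOn
  have hcs : ∀ t, HasCompactSupport fun u => F (t, u) := fun t => HasCompactSupport.intro hK (h0 t)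
  have hcont : ∀ t, Continuous fun u => F (t, u) := fun t =>
    hF.continuous.comp (Continuous.prodMk_right t)
  refine (hasDerivAt_integral_of_dominated_loc_of_deriv_le (μ := volume) (F := fun t u => F (t, u))
    (F' := fun t u => fderiv ℝ F (t, u) (1, 0)) (s := Set.Icc (-1) 1)
    (bound := K.indicator fun _ => C) (Icc_mem_nhds (by norm_num) (by norm_num))
    (Filter.Eventually.of_forall fun t => (hcont t).aestronglyMeasurable)
    ((hcont 0).integrable_of_hasCompactSupport (hcs 0))
    (hF'.comp (Continuous.prodMk_right 0)).aestronglyMeasurable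
    (Filter.Eventually.of_forall fun u t ht => ?_) ?_
    (Filter.Eventually.of_forall fun u t _ => hd t u)).2
  · by_cases hu : u ∈ K
    · rw [Set.indicator_of_mem hu]
      exact hC (t, u) ⟨ht, hu⟩
    · rw [Set.indicator_of_notMem hu, h0' t u hu, norm_zero]
  · rw [integrable_indicator_iff hK.measurableSet]
    exact integrableOn_const hK.measure_lt_top.ne

/-- Integration by parts against the constant function `1`. -/
lemma integral_fderiv_eq_zero {f : Mod m → ℝ} (hf : ContDiff ℝ ∞ f) (hs : HasCompactSupport f)
    (v : Mod m) : ∫ u, fderiv ℝ f u v = 0 := by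
  have hf' : Continuous fun u => fderiv ℝ f u v :=
    (hf.continuous_fderiv (by simp)).clm_apply continuous_const
  have hs' : HasCompactSupport fun u => fderiv ℝ f u v :=
    (hs.fderiv (𝕜 := ℝ)).comp_left (g := fun L : Mod m →L[ℝ] ℝ => L v) rfl
  have h := integral_bilinear_hasLineDerivAt_right_eq_neg_left_of_integrable
    (μ := (volume : Measure (Mod m))) (f := fun _ : Mod m => (1 : ℝ)) (f' := fun _ => 0) (g := f)
    (g' := fun u => fderiv ℝ f u v) (v := v) (B := ContinuousLinearMap.mul ℝ ℝ) (by simp)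
    (by simpa using hf'.integrable_of_hasCompactSupport hs')
    (by simpa using hf.continuous.integrable_of_hasCompactSupport hs)
    (fun u _ => (hasFDerivAt_const (1 : ℝ) u).hasLineDerivAt v)
    (fun u _ => (hf.differentiable (by simp) u).hasFDerivAt.hasLineDerivAt v)
  simpa using h

/-- The integral of the exterior derivative of a compactly supported form vanishes. -/
lemma integral_extDeriv_eq_zero {κ : Mod (m + 1) → Mod (m + 1) [⋀^Fin m]→L[ℝ] ℝ}
    (hκ : ContDiff ℝ ∞ κ) (hs : HasCompactSupport κ) :
    ∫ u, extDeriv κ u (EuclideanSpace.basisFun (Fin (m + 1)) ℝ) = 0 := by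
  simp only [extDeriv_eq_sum]
  have key : ∀ (v : Mod (m + 1)) (w : Fin m → Mod (m + 1)),
      (∀ u, fderiv ℝ κ u v w = fderiv ℝ (fun u => κ u w) u v) ∧ ContDiff ℝ ∞ (fun u => κ u w) ∧
      HasCompactSupport fun u => κ u w := by
    intro v w
    let L := ContinuousAlternatingMap.apply ℝ (Mod (m + 1)) ℝ w
    refine ⟨fun u => ?_, L.contDiff.comp hκ, hs.comp_left (g := fun θ : Mod (m + 1) [⋀^Fin m]→L[ℝ] ℝ => θ w) rfl⟩
    have h := (L.hasFDerivAt (x := κ u)).comp u (hκ.differentiable (by simp) u).hasFDerivAt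
    exact (congrArg (fun A : Mod (m + 1) →L[ℝ] ℝ => A v) h.fderiv).symm
  rw [integral_finsetSum]
  · refine Finset.sum_eq_zero fun a _ => ?_
    rw [integral_const_mul]
    simp only [(key _ _).1]
    rw [integral_fderiv_eq_zero (key 0 _).2.1 (key 0 _).2.2, mul_zero]
  · intro a _
    simp only [(key _ _).1]
    refine Integrable.const_mul (Continuous.integrable_of_hasCompactSupport
      (((key 0 _).2.1.continuous_fderiv (by simp)).clm_apply continuous_const) ?_) _
    exact ((key 0 _).2.2.fderiv (𝕜 := ℝ)).comp_left (g := fun L : Mod (m + 1) →L[ℝ] ℝ => L _) rfl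

end Euclidean

/-! ### Chart contributions to the integral: change of chart, time derivative, additivity. -/

section ChartIntegrals

open MeasureTheory

variable {m : ℕ} {X : Type*} [TopologicalSpace X] [ChartedSpace (Mod m) X]
  [IsManifold (𝓡 m) ∞ X]

/-- The contribution of a chart to the integral of a form. -/
def chartTerm (ψ : X → ℝ) (x : X) (μ η : DForm m m X) : ℝ :=
  ∫ u in (extChartAt (𝓡 m) x).target,
    ψ ((extChartAt (𝓡 m) x).symm u) *
      (Real.sign (chartRep x μ u (EuclideanSpace.basisFun (Fin m) ℝ)) *
        chartRep x η u (EuclideanSpace.basisFun (Fin m) ℝ))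

lemma pullback_id {p : ℕ} (η : DForm m p X) : pullback (k := m) id η = η := by
  funext x
  have h : mapD m m (id : X → X) x = ContinuousLinearMap.id ℝ (Mod m) := mfderiv_id
  have h1 := pullback_eq (k := m) (id : X → X) η x
  rw [h] at h1
  exact h1

lemma chartRep_zero_of {p : ℕ} {η : DForm m p X} {x : X} {u : Mod m}
    (h : η ((extChartAt (𝓡 m) x).symm u) = 0) : chartRep x η u = 0 := by
  have h' : (show Mod m [⋀^Fin p]→L[ℝ] ℝ from η ((extChartAt (𝓡 m) x).symm u)) = 0 := h
  rw [chartRep_eq, h']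
  rfl

lemma chartRep_basis_ne_zero {μ : DForm m m X} (hμ0 : ∀ x, μ x ≠ 0) {x : X} {u : Mod m}
    (hu : u ∈ (extChartAt (𝓡 m) x).target) :
    chartRep x μ u (EuclideanSpace.basisFun (Fin m) ℝ) ≠ 0 := by
  intro h
  have h1 := top_eq_zero h
  refine hμ0 ((extChartAt (𝓡 m) x).symm u) (ContinuousAlternatingMap.ext fun w => ?_)
  have h2 := congrArg (fun θ : Mod m [⋀^Fin m]→L[ℝ] ℝ => θ fun a =>
    chartD x ((extChartAt (𝓡 m) x).symm u) (w a)) h1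
  have h3 : ∀ a, chartDSymm x u (chartD x ((extChartAt (𝓡 m) x).symm u) (w a)) = w a := by
    intro a
    have := chartDSymm_chartD ((extChartAt (𝓡 m) x).map_target hu) (w a)
    rwa [(extChartAt (𝓡 m) x).right_inv hu] at this
  have h4 : (show Mod m [⋀^Fin m]→L[ℝ] ℝ from μ ((extChartAt (𝓡 m) x).symm u))
      (fun a => chartDSymm x u (chartD x ((extChartAt (𝓡 m) x).symm u) (w a))) = 0 := h2
  simp only [h3] at h4
  exact h4

/-- The coefficient of `μ` is continuous and never zero, so the orientation sign is locally constant
and behaves as a constant under differentiation. -/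
lemma sign_eventually_eq {μ : DForm m m X} (hμ : IsSmoothForm μ) (hμ0 : ∀ x, μ x ≠ 0) {x : X}
    {u : Mod m} (hu : u ∈ (extChartAt (𝓡 m) x).target) :
    (fun w => Real.sign (chartRep x μ w (EuclideanSpace.basisFun (Fin m) ℝ))) =ᶠ[𝓝 u]
      fun _ => Real.sign (chartRep x μ u (EuclideanSpace.basisFun (Fin m) ℝ)) := by
  have hc : ContinuousAt (fun w => chartRep x μ w (EuclideanSpace.basisFun (Fin m) ℝ)) u :=
    (contDiffAt_alt_iff.1 (isSmoothForm_iff.1 hμ x u hu) _).continuousAt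
  rcases (chartRep_basis_ne_zero hμ0 hu).lt_or_gt with h | h
  · filter_upwards [hc.eventually (gt_mem_nhds h)] with w hw
    rw [Real.sign_of_neg hw, Real.sign_of_neg h]
  · filter_upwards [hc.eventually (lt_mem_nhds h)] with w hw
    rw [Real.sign_of_pos hw, Real.sign_of_pos h]

/-- Independence of the chart. -/
lemma chartTerm_change {μ θ : DForm m m X} {ψ : X → ℝ} {x y : X}
    (hψ : ∀ z, ψ z ≠ 0 → z ∈ (extChartAt (𝓡 m) x).source)
    (hθ : ∀ z, θ z ≠ 0 → z ∈ (extChartAt (𝓡 m) y).source) :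
    chartTerm ψ x μ θ = chartTerm ψ y μ θ := by
  set A := (extChartAt (𝓡 m) x).target ∩ (extChartAt (𝓡 m) x).symm ⁻¹'
    (extChartAt (𝓡 m) y).source with hA
  set B := (extChartAt (𝓡 m) y).target ∩ (extChartAt (𝓡 m) y).symm ⁻¹'
    (extChartAt (𝓡 m) x).source with hB
  have hAo : IsOpen A := (continuousOn_extChartAt_symm x).isOpen_inter_preimage
    (isOpen_extChartAt_target x) (isOpen_extChartAt_source y)
  set τ := coordMap m m (id : X → X) x y with hτ
  have hτs : ∀ u ∈ A, (extChartAt (𝓡 m) y).symm (τ u) = (extChartAt (𝓡 m) x).symm u :=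
    fun u hu => (extChartAt (𝓡 m) y).left_inv hu.2
  have hinj : Set.InjOn τ A := by
    intro u hu w hw h
    have h1 := hτs u hu
    rw [h, hτs w hw] at h1
    rw [← (extChartAt (𝓡 m) x).right_inv hu.1, ← (extChartAt (𝓡 m) x).right_inv hw.1, h1]
  have himg : τ '' A = B := by
    ext w
    constructor
    · rintro ⟨u, hu, rfl⟩
      refine ⟨(extChartAt (𝓡 m) y).map_source hu.2, ?_⟩
      change (extChartAt (𝓡 m) y).symm (τ u) ∈ (extChartAt (𝓡 m) x).source
      rw [hτs u hu]
      exact (extChartAt (𝓡 m) x).map_target hu.1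
    · intro hw
      have h1 : (extChartAt (𝓡 m) x).symm (extChartAt (𝓡 m) x ((extChartAt (𝓡 m) y).symm w)) =
        (extChartAt (𝓡 m) y).symm w := (extChartAt (𝓡 m) x).left_inv hw.2
      refine ⟨extChartAt (𝓡 m) x ((extChartAt (𝓡 m) y).symm w),
        ⟨(extChartAt (𝓡 m) x).map_source hw.2, ?_⟩, ?_⟩
      · change (extChartAt (𝓡 m) x).symm (extChartAt (𝓡 m) x ((extChartAt (𝓡 m) y).symm w)) ∈
          (extChartAt (𝓡 m) y).source
        rw [h1]
        exact (extChartAt (𝓡 m) y).map_target hw.1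
      · change extChartAt (𝓡 m) y ((extChartAt (𝓡 m) x).symm
          (extChartAt (𝓡 m) x ((extChartAt (𝓡 m) y).symm w))) = w
        rw [h1, (extChartAt (𝓡 m) y).right_inv hw.1]
  have hcd : ∀ u ∈ A, ContDiffAt ℝ ∞ τ u := fun u hu =>
    contDiffAt_coordMap hu.1 contMDiffAt_id hu.2
  have hrep : ∀ (η : DForm m m X), ∀ u ∈ A, chartRep x η u
      (EuclideanSpace.basisFun (Fin m) ℝ) = (fderiv ℝ τ u).det *
        chartRep y η (τ u) (EuclideanSpace.basisFun (Fin m) ℝ) := by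
    intro η u hu
    have h := chartRep_pullback (f := (id : X → X)) (x₀ := y) η hu.1 contMDiffAt_id hu.2
    rw [pullback_id] at h
    rw [h, top_comp_det]
  -- Both integrals reduce to the overlap of the charts: outside it the integrand vanishes in the
  -- chart at `x` because of `θ`, and in the chart at `y` because of `ψ`.
  have h1 : chartTerm ψ x μ θ = ∫ u in A, ψ ((extChartAt (𝓡 m) x).symm u) *
      (Real.sign (chartRep x μ u (EuclideanSpace.basisFun (Fin m) ℝ)) *
        chartRep x θ u (EuclideanSpace.basisFun (Fin m) ℝ)) := by
    rw [chartTerm]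
    refine setIntegral_eq_of_subset_of_forall_sdiff_eq_zero
      (isOpen_extChartAt_target (I := 𝓡 m) x).measurableSet
      (Set.inter_subset_left : A ⊆ _) fun u hu => ?_
    have h2 : θ ((extChartAt (𝓡 m) x).symm u) = 0 := by
      by_contra h
      exact hu.2 ⟨hu.1, hθ _ h⟩
    rw [chartRep_zero_of h2]
    simp
  have h2 : chartTerm ψ y μ θ = ∫ u in B, ψ ((extChartAt (𝓡 m) y).symm u) *
      (Real.sign (chartRep y μ u (EuclideanSpace.basisFun (Fin m) ℝ)) *
        chartRep y θ u (EuclideanSpace.basisFun (Fin m) ℝ)) := by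
    rw [chartTerm]
    refine setIntegral_eq_of_subset_of_forall_sdiff_eq_zero
      (isOpen_extChartAt_target (I := 𝓡 m) y).measurableSet
      (Set.inter_subset_left : B ⊆ _) fun u hu => ?_
    have h2 : ψ ((extChartAt (𝓡 m) y).symm u) = 0 := by
      by_contra h
      exact hu.2 ⟨hu.1, hψ _ h⟩
    rw [h2, zero_mul]
  rw [h1, h2, ← himg, integral_image_eq_integral_abs_det_fderiv_smul volume hAo.measurableSet
    (fun u hu => ((hcd u hu).differentiableAt (by simp)).hasFDerivAt.hasFDerivWithinAt) hinj]
  refine setIntegral_congr_fun hAo.measurableSet fun u hu => ?_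
  have hdet : (fderiv ℝ τ u).det = Real.sign (fderiv ℝ τ u).det * |(fderiv ℝ τ u).det| := by
    rcases lt_trichotomy (fderiv ℝ τ u).det 0 with h | h | h
    · rw [Real.sign_of_neg h, abs_of_neg h]; ring
    · rw [h]; simp
    · rw [Real.sign_of_pos h, abs_of_pos h]; ring
  -- The coefficient of `θ` picks up the determinant and that of `μ` its sign; their product is the
  -- absolute value in the change of variables formula.
  have hss : Real.sign (fderiv ℝ τ u).det * (fderiv ℝ τ u).det = |(fderiv ℝ τ u).det| := by
    rcases lt_trichotomy (fderiv ℝ τ u).det 0 with h | h | h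
    · rw [Real.sign_of_neg h, abs_of_neg h]; ring
    · rw [h]; simp
    · rw [Real.sign_of_pos h, abs_of_pos h]; ring
  have hsm : ∀ a b : ℝ, Real.sign (a * b) = Real.sign a * Real.sign b := by
    intro a b
    rcases lt_trichotomy a 0 with ha | ha | ha <;> rcases lt_trichotomy b 0 with hb | hb | hb <;>
      simp [Real.sign_of_neg, Real.sign_of_pos, mul_pos_of_neg_of_neg, mul_neg_of_neg_of_pos,
        mul_neg_of_pos_of_neg, ha, hb]
  rw [hrep μ u hu, hrep θ u hu, hτs u hu, hsm, smul_eq_mul, ← hss]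
  ring

variable [T2Space X] [CompactSpace X]

lemma image_chart_compact {ψ : X → ℝ} {x : X} (hs : tsupport ψ ⊆ (extChartAt (𝓡 m) x).source) :
    IsCompact (extChartAt (𝓡 m) x '' tsupport ψ) ∧
      extChartAt (𝓡 m) x '' tsupport ψ ⊆ (extChartAt (𝓡 m) x).target ∧
      ∀ u ∈ (extChartAt (𝓡 m) x).target, u ∉ extChartAt (𝓡 m) x '' tsupport ψ →
        (extChartAt (𝓡 m) x).symm u ∉ tsupport ψ := by
  refine ⟨(isClosed_tsupport ψ).isCompact.image_of_continuousOn
    ((continuousOn_extChartAt x).mono hs), ?_, fun u hu h h' => h ⟨_, h', ?_⟩⟩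
  · rintro _ ⟨y, hy, rfl⟩
    exact (extChartAt (𝓡 m) x).map_source (hs hy)
  · exact (extChartAt (𝓡 m) x).right_inv hu

lemma contDiffAt_sign_mul {μ : DForm m m X} (hμ : IsSmoothForm μ) (hμ0 : ∀ x, μ x ≠ 0)
    {c : ℝ → DForm m m X} (hc : (formCurves m m X).smooth c) {ψ : X → ℝ}
    (hψ : ContMDiff (𝓡 m) 𝓘(ℝ, ℝ) ∞ ψ) {x : X} (t : ℝ) {u : Mod m}
    (hu : u ∈ (extChartAt (𝓡 m) x).target) :
    ContDiffAt ℝ ∞ (fun q : ℝ × Mod m => ψ ((extChartAt (𝓡 m) x).symm q.2) *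
      (Real.sign (chartRep x μ q.2 (EuclideanSpace.basisFun (Fin m) ℝ)) *
        chartRep x (c q.1) q.2 (EuclideanSpace.basisFun (Fin m) ℝ))) (t, u) := by
  have hs : Filter.Tendsto (Prod.snd : ℝ × Mod m → Mod m) (𝓝 (t, u)) (𝓝 u) := continuous_snd.tendsto _
  refine ContDiffAt.mul (ContDiffAt.comp
    (g := fun w => ψ ((extChartAt (𝓡 m) x).symm w)) (t, u) (contDiffAt_chart_symm_comp hψ hu)
    contDiffAt_snd)
    (ContDiffAt.mul ?_ (contDiffAt_alt_iff.1 (formCurves_smooth_iff.1 hc x t u hu) _))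
  exact contDiffAt_const.congr_of_eventuallyEq (hs.eventually (sign_eventually_eq hμ hμ0 hu))

lemma integrableOn_chartTerm {μ : DForm m m X} (hμ : IsSmoothForm μ) (hμ0 : ∀ x, μ x ≠ 0)
    {η : DForm m m X} (hη : IsSmoothForm η) {ψ : X → ℝ} (hψ : ContMDiff (𝓡 m) 𝓘(ℝ, ℝ) ∞ ψ) {x : X}
    (hs : tsupport ψ ⊆ (extChartAt (𝓡 m) x).source) :
    IntegrableOn (fun u => ψ ((extChartAt (𝓡 m) x).symm u) *
      (Real.sign (chartRep x μ u (EuclideanSpace.basisFun (Fin m) ℝ)) *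
        chartRep x η u (EuclideanSpace.basisFun (Fin m) ℝ))) (extChartAt (𝓡 m) x).target := by
  obtain ⟨hK, hKt, hK0⟩ := image_chart_compact hs
  refine integrable_indicator (isOpen_extChartAt_target x) hK (fun u hu => ?_) (fun u hu hu' => ?_) hKt
  · exact (contDiffAt_sign_mul hμ hμ0 hη.const_curve hψ 0 hu).comp u
      (f := fun w => ((0 : ℝ), w)) (contDiffAt_const.prodMk contDiffAt_id)
  · rw [image_eq_zero_of_notMem_tsupport (hK0 u hu hu'), zero_mul]

lemma hasDerivAt_chartTerm {μ : DForm m m X} (hμ : IsSmoothForm μ) (hμ0 : ∀ x, μ x ≠ 0)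
    {c : ℝ → DForm m m X} (hc : (formCurves m m X).smooth c) {η : DForm m m X}
    (hη : (formCurves m m X).velocity c η) {ψ : X → ℝ} (hψ : ContMDiff (𝓡 m) 𝓘(ℝ, ℝ) ∞ ψ) {x : X}
    (hs : tsupport ψ ⊆ (extChartAt (𝓡 m) x).source) :
    HasDerivAt (fun t => chartTerm ψ x μ (c t)) (chartTerm ψ x μ η) 0 := by
  obtain ⟨hK, hKt, hK0⟩ := image_chart_compact hs
  have hO := isOpen_extChartAt_target (I := 𝓡 m) x
  let g : ℝ × Mod m → ℝ := fun q => ψ ((extChartAt (𝓡 m) x).symm q.2) *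
      (Real.sign (chartRep x μ q.2 (EuclideanSpace.basisFun (Fin m) ℝ)) *
        chartRep x (c q.1) q.2 (EuclideanSpace.basisFun (Fin m) ℝ))
  have h0 : ∀ t, ∀ u ∈ (extChartAt (𝓡 m) x).target, u ∉ extChartAt (𝓡 m) x '' tsupport ψ →
      g (t, u) = 0 := fun t u hu hu' => by
    simp only [g]
    rw [image_eq_zero_of_notMem_tsupport (hK0 u hu hu'), zero_mul]
  have hF := contDiff_indicator (g := g) hO hK
    (fun t u hu => contDiffAt_sign_mul hμ hμ0 hc hψ t hu) h0 hKt
  have h1 := hasDerivAt_integral_of_contDiff hF hK fun t u hu => by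
    by_cases h : u ∈ (extChartAt (𝓡 m) x).target
    · simp only [Set.indicator_of_mem h, h0 t u h hu]
    · simp only [Set.indicator_of_notMem h]
  have h2 : ∀ t, ∫ u, (extChartAt (𝓡 m) x).target.indicator (fun u => g (t, u)) u =
      chartTerm ψ x μ (c t) := fun t => integral_indicator hO.measurableSet
  simp only [h2] at h1
  refine h1.congr_deriv ?_
  rw [chartTerm, ← integral_indicator hO.measurableSet]
  congr 1
  funext u
  -- The integrands agree pointwise: both are time derivatives of the same function, one by joint
  -- smoothness and one by the pointwise velocity.
  have h3 : HasDerivAt (fun t => (extChartAt (𝓡 m) x).target.indicator (fun u => g (t, u)) u)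
      (fderiv ℝ (fun q : ℝ × Mod m => (extChartAt (𝓡 m) x).target.indicator
        (fun u => g (q.1, u)) q.2) (0, u) (1, 0)) 0 :=
    HasFDerivAt.comp_hasDerivAt (f := fun t : ℝ => (t, u)) 0
      (hF.differentiable (by simp) (0, u)).hasFDerivAt
      ((hasDerivAt_id (0 : ℝ)).prodMk (hasDerivAt_const 0 u))
  refine h3.unique ?_
  by_cases hu : u ∈ (extChartAt (𝓡 m) x).target
  · simp only [Set.indicator_of_mem hu]
    exact HasDerivAt.const_mul (ψ ((extChartAt (𝓡 m) x).symm u)) (HasDerivAt.const_mul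
      (Real.sign (chartRep x μ u (EuclideanSpace.basisFun (Fin m) ℝ))) (hη ((extChartAt (𝓡 m) x).symm u)
      fun a => chartDSymm x u (EuclideanSpace.basisFun (Fin m) ℝ a)))
  · simp only [Set.indicator_of_notMem hu]
    exact hasDerivAt_const _ _

/-- By compactness only finitely many members of a locally finite partition are nonzero. This
unpacks the choice in `formIntegral` once and turns the `finsum` into a finite sum. -/
lemma exists_partition : ∃ (J : Finset X) (ρ : X → X → ℝ),
    (∀ x, ContMDiff (𝓡 m) 𝓘(ℝ, ℝ) ∞ (ρ x)) ∧
    (∀ x, tsupport (ρ x) ⊆ (extChartAt (𝓡 m) x).source) ∧ (∀ z, ∑ x ∈ J, ρ x z = 1) ∧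
    ∀ μ η : DForm m m X, formIntegral μ η = ∑ x ∈ J, chartTerm (ρ x) x μ η := by
  set ρ := Classical.choose
    (SmoothPartitionOfUnity.exists_isSubordinate_chartAt_source (𝓡 m) X) with hρ
  have hsub := Classical.choose_spec
    (SmoothPartitionOfUnity.exists_isSubordinate_chartAt_source (𝓡 m) X)
  rw [← hρ] at hsub
  have hfin := ρ.locallyFinite.finite_nonempty_of_compact
  have hmem : ∀ x, x ∉ hfin.toFinset → ∀ z, ρ x z = 0 := by
    intro x hx z
    by_contra h
    exact hx (hfin.mem_toFinset.2 ⟨z, h⟩)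
  refine ⟨hfin.toFinset, fun x => ρ x, fun x => (ρ x).contMDiff, fun x => ?_, fun z => ?_,
    fun μ η => ?_⟩
  · rw [extChartAt_source]
    exact hsub x
  · rw [← ρ.sum_eq_one (Set.mem_univ z)]
    refine (finsum_eq_sum_of_support_subset _ fun x hx => ?_).symm
    by_contra h
    exact hx (hmem x h z)
  · refine finsum_eq_sum_of_support_subset _ fun x hx => ?_
    by_contra h
    refine hx ?_
    simp only [← hρ, hmem x h, zero_mul, integral_zero]

variable {μ : DForm m m X} (hμ : IsSmoothForm μ) (hμ0 : ∀ x, μ x ≠ 0)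
include hμ hμ0

lemma chartTerm_add {η θ : DForm m m X} (hη : IsSmoothForm η) (hθ : IsSmoothForm θ) {ψ : X → ℝ}
    (hψ : ContMDiff (𝓡 m) 𝓘(ℝ, ℝ) ∞ ψ) {x : X}
    (hs : tsupport ψ ⊆ (extChartAt (𝓡 m) x).source) :
    chartTerm ψ x μ (η + θ) = chartTerm ψ x μ η + chartTerm ψ x μ θ := by
  rw [chartTerm, chartTerm, chartTerm, ← integral_add (integrableOn_chartTerm hμ hμ0 hη hψ hs)
    (integrableOn_chartTerm hμ hμ0 hθ hψ hs)]
  congr 1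
  funext u
  rw [chartRep_add, ContinuousAlternatingMap.add_apply]
  ring

lemma formIntegral_add {η θ : DForm m m X} (hη : IsSmoothForm η) (hθ : IsSmoothForm θ) :
    formIntegral μ (η + θ) = formIntegral μ η + formIntegral μ θ := by
  obtain ⟨J, ρ, h1, h2, -, h4⟩ := exists_partition (m := m) (X := X)
  rw [h4, h4, h4, ← Finset.sum_add_distrib]
  exact Finset.sum_congr rfl fun x _ => chartTerm_add hμ hμ0 hη hθ (h1 x) (h2 x)

lemma hasDerivAt_formIntegral {c : ℝ → DForm m m X} (hc : (formCurves m m X).smooth c)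
    {η : DForm m m X} (hη : (formCurves m m X).velocity c η) :
    HasDerivAt (fun t => formIntegral μ (c t)) (formIntegral μ η) 0 := by
  obtain ⟨J, ρ, h1, h2, -, h4⟩ := exists_partition (m := m) (X := X)
  simp only [h4]
  exact HasDerivAt.fun_sum fun x _ => hasDerivAt_chartTerm hμ hμ0 hc hη (h1 x) (h2 x)

end ChartIntegrals

/-! ### Stokes' theorem on a closed manifold -/

section Stokes

open MeasureTheory

variable {m p : ℕ} {X : Type*} [TopologicalSpace X] [ChartedSpace (Mod m) X]
  [IsManifold (𝓡 m) ∞ X]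

lemma IsSmoothForm.add {η θ : DForm m p X} (hη : IsSmoothForm η) (hθ : IsSmoothForm θ) :
    IsSmoothForm (η + θ) :=
  SmoothFormCurve.apply (SmoothFormCurve.add hη.const_curve hθ.const_curve) 0

lemma IsSmoothForm.sub {η θ : DForm m p X} (hη : IsSmoothForm η) (hθ : IsSmoothForm θ) :
    IsSmoothForm (η - θ) :=
  SmoothFormCurve.apply (SmoothFormCurve.sub hη.const_curve hθ.const_curve) 0

lemma isSmoothForm_zero : IsSmoothForm (0 : DForm m p X) :=
  isSmoothForm_iff.2 fun _ _ _ =>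
    (contDiffAt_const (c := (0 : Mod m [⋀^Fin p]→L[ℝ] ℝ))).congr_of_eventuallyEq
      (Filter.Eventually.of_forall fun _ => chartRep_zero_of rfl)

lemma IsSmoothForm.sum {κ : Type*} (s : Finset κ) {η : κ → DForm m p X}
    (hη : ∀ a ∈ s, IsSmoothForm (η a)) : IsSmoothForm (∑ a ∈ s, η a) :=
  Finset.sum_induction _ _ (fun _ _ => IsSmoothForm.add) isSmoothForm_zero hη

lemma extD_add {η θ : DForm m p X} (hη : IsSmoothForm η) (hθ : IsSmoothForm θ) :
    extD (η + θ) = extD η + extD θ := by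
  funext x
  have hx := mem_extChartAt_target (I := 𝓡 m) x
  have h := extDeriv_add (hη.differentiableAt hx) (hθ.differentiableAt hx)
  have h1 : extD (η + θ) x = extDeriv (chartRep x η + chartRep x θ) (extChartAt (𝓡 m) x x) :=
    extD_eq _ _
  exact (h1.trans h).trans (congrArg₂ (fun a b : Mod m [⋀^Fin (p + 1)]→L[ℝ] ℝ => a + b)
    (extD_eq η x).symm (extD_eq θ x).symm)

lemma extD_zero : extD (0 : DForm m p X) = 0 := by
  have h := extD_add (isSmoothForm_zero (m := m) (p := p) (X := X)) isSmoothForm_zero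
  rwa [add_zero, left_eq_add] at h

lemma extD_sub {η θ : DForm m p X} (hη : IsSmoothForm η) (hθ : IsSmoothForm θ) :
    extD (η - θ) = extD η - extD θ := by
  refine eq_sub_of_add_eq ?_
  rw [← extD_add (hη.sub hθ) hθ, sub_add_cancel]

lemma extD_sum {κ : Type*} (s : Finset κ) {η : κ → DForm m p X}
    (hη : ∀ a ∈ s, IsSmoothForm (η a)) : extD (∑ a ∈ s, η a) = ∑ a ∈ s, extD (η a) := by
  classical
  induction s using Finset.induction_on with
  | empty => simpa using extD_zero
  | insert a s ha ih =>
    rw [Finset.sum_insert ha, Finset.sum_insert ha, extD_add (hη a (by simp))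
      (IsSmoothForm.sum s fun b hb => hη b (by simp [hb])), ih fun b hb => hη b (by simp [hb])]

lemma IsSmoothForm.fn_smul {η : DForm m p X} (hη : IsSmoothForm η) {ψ : X → ℝ}
    (hψ : ContMDiff (𝓡 m) 𝓘(ℝ, ℝ) ∞ ψ) : IsSmoothForm (fun z => ψ z • η z : DForm m p X) :=
  isSmoothForm_iff.2 fun x₀ u hu =>
    (contDiffAt_chart_symm_comp hψ hu).smul (isSmoothForm_iff.1 hη x₀ u hu)

lemma extDeriv_zero_fun {k q : ℕ} (u : Mod k) :
    extDeriv (fun _ : Mod k => (0 : Mod k [⋀^Fin q]→L[ℝ] ℝ)) u = 0 := by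
  ext v
  simp [extDeriv, ContinuousAlternatingMap.alternatizeUncurryFin_apply]

lemma extD_eq_zero_of_notMem_tsupport {η : DForm m p X} {ψ : X → ℝ} {z : X} (hz : z ∉ tsupport ψ) :
    extD (fun z => ψ z • η z : DForm m p X) z = 0 := by
  have hcs : ContinuousAt (extChartAt (𝓡 m) z).symm (extChartAt (𝓡 m) z z) :=
    (contMDiffAt_chart_symm (mem_extChartAt_target (I := 𝓡 m) z)).continuousAt
  have hs : (extChartAt (𝓡 m) z).symm (extChartAt (𝓡 m) z z) = z := extChartAt_to_inv z
  have h : chartRep z (fun z => ψ z • η z : DForm m p X) =ᶠ[𝓝 (extChartAt (𝓡 m) z z)]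
      fun _ => 0 := by
    have h1 := hcs.eventually (p := fun y => ψ y = 0)
      (by rw [hs]; exact notMem_tsupport_iff_eventuallyEq.1 hz)
    filter_upwards [h1] with w hw
    refine chartRep_zero_of ?_
    simp only [hw, zero_smul]
  refine (extD_eq _ z).trans ?_
  rw [h.extDeriv_eq]
  exact extDeriv_zero_fun _

end Stokes

/-! ### Reduction of Stokes' theorem to one chart by a partition of unity. -/

section StokesClosed

open MeasureTheory

variable {m : ℕ} {X : Type*} [TopologicalSpace X] [ChartedSpace (Mod (m + 1)) X]
  [IsManifold (𝓡 (m + 1)) ∞ X] [T2Space X] [CompactSpace X]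
  {μ : DForm (m + 1) (m + 1) X} (hμ : IsSmoothForm μ) (hμ0 : ∀ x, μ x ≠ 0)
include hμ hμ0

/-- The orientation sign, being locally constant, moves inside the exterior derivative. The
resulting form has compact support in the target of the chart and extends by zero to all of `ℝᵐ⁺¹`.
-/
lemma chartTerm_extD_eq_zero {η : DForm (m + 1) m X} (hη : IsSmoothForm η) {ψ : X → ℝ}
    (hψ : ContMDiff (𝓡 (m + 1)) 𝓘(ℝ, ℝ) ∞ ψ) {y : X}
    (hs : tsupport ψ ⊆ (extChartAt (𝓡 (m + 1)) y).source) :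
    chartTerm (fun _ => 1) y μ (extD fun z => ψ z • η z) = 0 := by
  obtain ⟨hK, hKt, hK0⟩ := image_chart_compact hs
  have hO := isOpen_extChartAt_target (I := 𝓡 (m + 1)) y
  have hη' := hη.fn_smul hψ
  let σ : Mod (m + 1) → ℝ := fun u =>
    Real.sign (chartRep y μ u (EuclideanSpace.basisFun (Fin (m + 1)) ℝ))
  let g : Mod (m + 1) → Mod (m + 1) [⋀^Fin m]→L[ℝ] ℝ := fun u =>
    σ u • chartRep y (fun z => ψ z • η z) u
  have hg : ∀ u ∈ (extChartAt (𝓡 (m + 1)) y).target, ContDiffAt ℝ ∞ g u := fun u hu =>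
    (contDiffAt_const.congr_of_eventuallyEq (sign_eventually_eq hμ hμ0 hu)).smul
      (isSmoothForm_iff.1 hη' y u hu)
  have h0 : ∀ u ∈ (extChartAt (𝓡 (m + 1)) y).target,
      u ∉ extChartAt (𝓡 (m + 1)) y '' tsupport ψ → g u = 0 := fun u hu hu' => by
    have h1 : ψ ((extChartAt (𝓡 (m + 1)) y).symm u) = 0 :=
      image_eq_zero_of_notMem_tsupport (hK0 u hu hu')
    simp only [g]
    rw [chartRep_zero_of (by simp only [h1, zero_smul]), smul_zero]
  have hint := integral_extDeriv_eq_zero (contDiff_indicator' hO hK hg h0 hKt)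
    (hasCompactSupport_indicator hK h0)
  rw [← hint, chartTerm, ← integral_indicator hO.measurableSet]
  congr 1
  funext u
  by_cases hu : u ∈ (extChartAt (𝓡 (m + 1)) y).target
  · have h1 : (extChartAt (𝓡 (m + 1)) y).target.indicator g =ᶠ[𝓝 u] fun w =>
        σ u • chartRep y (fun z => ψ z • η z) w := by
      filter_upwards [hO.mem_nhds hu, sign_eventually_eq hμ hμ0 hu] with w hw hw'
      rw [Set.indicator_of_mem hw]
      simp only [g, σ, hw']
    have h2 := extDeriv_smul (σ u) (chartRep y (fun z => ψ z • η z : DForm (m + 1) m X)) (x := u)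
    rw [Set.indicator_of_mem hu, h1.extDeriv_eq, one_mul, hη'.chartRep_extD hu]
    refine Eq.trans ?_ (congrArg (fun θ : Mod (m + 1) [⋀^Fin (m + 1)]→L[ℝ] ℝ =>
      θ (EuclideanSpace.basisFun (Fin (m + 1)) ℝ)) h2).symm
    rfl
  · have h1 : (extChartAt (𝓡 (m + 1)) y).target.indicator g =ᶠ[𝓝 u] fun _ => 0 := by
      filter_upwards [hK.isClosed.isOpen_compl.mem_nhds fun h => hu (hKt h)] with w hw
      by_cases hw' : w ∈ (extChartAt (𝓡 (m + 1)) y).target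
      · rw [Set.indicator_of_mem hw', h0 w hw' hw]
      · rw [Set.indicator_of_notMem hw']
    rw [Set.indicator_of_notMem hu, h1.extDeriv_eq, extDeriv_zero_fun]
    rfl

/-- Stokes' theorem on a closed oriented manifold. -/
theorem formIntegral_extD_eq_zero {η : DForm (m + 1) m X} (hη : IsSmoothForm η) :
    formIntegral μ (extD η) = 0 := by
  obtain ⟨J, ρ, h1, h2, h3, h4⟩ := exists_partition (m := m + 1) (X := X)
  have hdec : η = ∑ y ∈ J, fun z => ρ y z • η z := by
    funext z
    rw [Finset.sum_apply, ← Finset.sum_smul, h3, one_smul]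
  have hsm : ∀ y, IsSmoothForm (fun z => ρ y z • η z : DForm (m + 1) m X) :=
    fun y => hη.fn_smul (h1 y)
  have hsupp : ∀ y z, extD (fun z => ρ y z • η z : DForm (m + 1) m X) z ≠ 0 →
      z ∈ tsupport (ρ y) := fun y z h => by
    by_contra hz
    exact h (extD_eq_zero_of_notMem_tsupport hz)
  -- Each localized piece `d(ρ y η)` is supported in the chart at `y`, so its part weighted by `ρ x`
  -- can be computed there instead of in the chart at `x`.
  have hterm : ∀ x, chartTerm (ρ x) x μ (extD η) =
      ∑ y ∈ J, chartTerm (ρ x) y μ (extD fun z => ρ y z • η z) := by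
    intro x
    conv_lhs => rw [hdec, extD_sum J fun y _ => hsm y]
    have hadd : ∀ s : Finset X, chartTerm (ρ x) x μ (∑ y ∈ s, extD fun z => ρ y z • η z) =
        ∑ y ∈ s, chartTerm (ρ x) x μ (extD fun z => ρ y z • η z) := by
      classical
      intro s
      induction s using Finset.induction_on with
      | empty =>
        rw [Finset.sum_empty, Finset.sum_empty, chartTerm]
        simp only [chartRep_zero_of (η := (0 : DForm (m + 1) (m + 1) X)) rfl]
        simp
      | insert a s ha ih =>
        rw [Finset.sum_insert ha, Finset.sum_insert ha, chartTerm_add hμ hμ0 (hsm a).extD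
          (IsSmoothForm.sum s fun b _ => (hsm b).extD) (h1 x) (h2 x), ih]
    rw [hadd]
    refine Finset.sum_congr rfl fun y _ => chartTerm_change (fun z hz => h2 x (subset_tsupport _ hz))
      fun z hz => h2 y (hsupp y z hz)
  rw [h4]
  simp only [hterm]
  -- With the chart at `y` fixed, the weights `ρ x` sum to `1`.
  rw [Finset.sum_comm]
  refine Finset.sum_eq_zero fun y _ => ?_
  rw [← chartTerm_extD_eq_zero hμ hμ0 hη (h1 y) (h2 y)]
  simp only [chartTerm]
  rw [← integral_finsetSum]
  · congr 1
    funext u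
    rw [← Finset.sum_mul, h3]
  · intro x _
    obtain ⟨hK, hKt, hK0⟩ := image_chart_compact (h2 y)
    refine integrable_indicator (isOpen_extChartAt_target y) hK (fun u hu => ?_)
      (fun u hu hu' => ?_) hKt
    · exact (contDiffAt_sign_mul hμ hμ0 (hsm y).extD.const_curve (h1 x) 0 hu).comp u
        (f := fun w => ((0 : ℝ), w)) (contDiffAt_const.prodMk contDiffAt_id)
    · rw [chartRep_zero_of (extD_eq_zero_of_notMem_tsupport (hK0 u hu hu'))]
      simp

end StokesClosed
end CovPhase
end

noncomputable section

namespace CovPhase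

/-! ### Algebra of forms and Lie derivatives -/

section FormAlgebra

variable {m k p : ℕ} {X : Type*} [TopologicalSpace X] [ChartedSpace (Mod m) X]
  {Y : Type*} [TopologicalSpace Y] [ChartedSpace (Mod k) Y]

lemma intProd_add_left (v w : RawVF m X) (η : DForm m (p + 1) X) :
    intProd (v + w) η = intProd v η + intProd w η :=
  funext fun x => map_add (show Mod m [⋀^Fin (p + 1)]→L[ℝ] ℝ from η x).curryLeft (v x) (w x)

lemma intProd_add (v : RawVF m X) (η θ : DForm m (p + 1) X) :
    intProd v (η + θ) = intProd v η + intProd v θ := rfl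

lemma intProd_zero (v : RawVF m X) : intProd v (0 : DForm m (p + 1) X) = 0 := rfl

lemma pullback_add (f : Y → X) (η θ : DForm m p X) :
    pullback (k := k) f (η + θ) = pullback f η + pullback f θ := rfl

lemma pullback_sub (f : Y → X) (η θ : DForm m p X) :
    pullback (k := k) f (η - θ) = pullback f η - pullback f θ := rfl

lemma pullback_congr {f : Y → X} {η θ : DForm m p X} (h : ∀ y, η (f y) = θ (f y)) :
    pullback (k := k) f η = pullback f θ :=
  funext fun y => congrArg (fun L : Mod m [⋀^Fin p]→L[ℝ] ℝ =>
    L.compContinuousLinearMap (mapD k m f y)) (h y)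

/-- Forms of degree larger than the dimension vanish. -/
lemma form_eq_zero (η : DForm m (m + 1) X) : η = 0 := by
  funext x
  refine ContinuousAlternatingMap.ext fun w => ?_
  refine (show Mod m [⋀^Fin (m + 1)]→L[ℝ] ℝ from η x).toAlternatingMap.map_linearDependent w
    fun h => ?_
  have := h.fintype_card_le_finrank
  simp at this

variable [IsManifold (𝓡 m) ∞ X] [IsManifold (𝓡 k) ∞ Y]

lemma IsSmoothForm.intProd {v : RawVF m X} (hv : SmoothRawCurve fun _ => v)
    {η : DForm m (p + 1) X} (hη : IsSmoothForm η) : IsSmoothForm (intProd v η) :=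
  SmoothFormCurve.apply (SmoothFormCurve.intProd hv hη.const_curve) 0

lemma IsSmoothForm.pullback {f : Y → X} (hf : ContMDiff (𝓡 k) (𝓡 m) ∞ f) {η : DForm m p X}
    (hη : IsSmoothForm η) : IsSmoothForm (pullback (k := k) f η) :=
  SmoothFormCurve.apply (SmoothFormCurve.pullback hf hη.const_curve) 0

lemma IsSmoothForm.lieForm {v : RawVF m X} (hv : SmoothRawCurve fun _ => v) {η : DForm m p X}
    (hη : IsSmoothForm η) : IsSmoothForm (lieForm v η) := by
  cases p with
  | zero => exact hη.extD.intProd hv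
  | succ p => exact (hη.extD.intProd hv).add (hη.intProd hv).extD

/-- The velocity of a smooth curve of forms is smooth. -/
lemma isSmoothForm_velocity {c : ℝ → DForm m p X} {η : DForm m p X}
    (hc : (formCurves m p X).smooth c) (hv : (formCurves m p X).velocity c η) :
    IsSmoothForm η := by
  rw [isSmoothForm_iff]
  intro x₀ u hu
  rw [contDiffAt_alt_iff]
  intro w
  let G : ℝ × Mod m → ℝ := fun q => chartRep x₀ (c q.1) q.2 w
  have hG : ∀ u ∈ (extChartAt (𝓡 m) x₀).target, ContDiffAt ℝ ∞ G (0, u) := fun u hu =>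
    contDiffAt_alt_iff.1 (formCurves_smooth_iff.1 hc x₀ 0 u hu) w
  have h1 : ContDiffAt ℝ ∞ (fun u => fderiv ℝ G (0, u) (1, 0)) u := by
    have h2 : ContDiffAt ℝ ∞ (fderiv ℝ G) (0, u) := (hG u hu).fderiv_right (by simp)
    have h3 : ContDiffAt ℝ ∞ (fun u => fderiv ℝ G (0, u)) u :=
      ContDiffAt.comp (g := fderiv ℝ G) (f := fun u => ((0 : ℝ), u)) u h2
        (contDiffAt_const.prodMk contDiffAt_id)
    exact h3.clm_apply contDiffAt_const
  refine h1.congr_of_eventuallyEq ?_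
  filter_upwards [target_mem_nhds hu] with z hz
  have h4 : HasDerivAt (fun t => G (t, z)) (fderiv ℝ G (0, z) (1, 0)) 0 :=
    HasFDerivAt.comp_hasDerivAt (f := fun t : ℝ => (t, z)) 0
      ((hG z hz).differentiableAt (by simp)).hasFDerivAt
      ((hasDerivAt_id (0 : ℝ)).prodMk (hasDerivAt_const 0 z))
  exact (hv ((extChartAt (𝓡 m) x₀).symm z) fun a => chartDSymm x₀ z (w a)).unique h4

lemma lieForm_add {v : RawVF m X} (hv : SmoothRawCurve fun _ => v) {η θ : DForm m p X}
    (hη : IsSmoothForm η) (hθ : IsSmoothForm θ) :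
    lieForm v (η + θ) = lieForm v η + lieForm v θ := by
  cases p with
  | zero =>
    change CovPhase.intProd v (extD (η + θ)) = _
    rw [extD_add hη hθ]
    rfl
  | succ p =>
    change CovPhase.intProd v (extD (η + θ)) + extD (CovPhase.intProd v (η + θ)) =
      (CovPhase.intProd v (extD η) + extD (CovPhase.intProd v η)) +
        (CovPhase.intProd v (extD θ) + extD (CovPhase.intProd v θ))
    rw [extD_add hη hθ, intProd_add, intProd_add, extD_add (hη.intProd hv) (hθ.intProd hv)]
    abel

lemma lieForm_sub {v : RawVF m X} (hv : SmoothRawCurve fun _ => v) {η θ : DForm m p X}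
    (hη : IsSmoothForm η) (hθ : IsSmoothForm θ) :
    lieForm v (η - θ) = lieForm v η - lieForm v θ := by
  refine eq_sub_of_add_eq ?_
  rw [← lieForm_add hv (hη.sub hθ) hθ, sub_add_cancel]

/-- The Lie derivative commutes with the restriction to a submanifold. -/
lemma pullback_lieForm {f : Y → X} (hf : ContMDiff (𝓡 k) (𝓡 m) ∞ f) {v : VF m X}
    (hv : IsTangent (k := k) f v) {η : DForm m p X} (hη : IsSmoothForm η) :
    pullback (k := k) f (lieForm (fun x => v x) η) = lieForm (restrict f v) (pullback f η) := by
  cases p with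
  | zero =>
    change pullback (k := k) f (CovPhase.intProd (fun x => v x) (extD η)) =
      CovPhase.intProd (restrict f v) (extD (pullback f η))
    rw [pullback_intProd hv, hη.extD_pullback hf]
  | succ p =>
    change pullback (k := k) f (CovPhase.intProd (fun x => v x) (extD η)) +
        pullback (k := k) f (extD (CovPhase.intProd (fun x => v x) η)) =
      CovPhase.intProd (restrict f v) (extD (pullback f η)) +
        extD (CovPhase.intProd (restrict f v) (pullback f η))
    rw [pullback_intProd hv (extD η), hη.extD_pullback hf, ← pullback_intProd hv η,
      (hη.intProd (smoothRawCurve_const v)).extD_pullback hf]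

/-- Smooth forms that agree on a set agree on its closure. -/
lemma eqOn_closure_of_isSmoothForm {η θ : DForm m p X} (hη : IsSmoothForm η)
    (hθ : IsSmoothForm θ) {U : Set X} (h : ∀ x ∈ U, η x = θ x) {x : X} (hx : x ∈ closure U) :
    η x = θ x := by
  let g : X → Mod m [⋀^Fin p]→L[ℝ] ℝ := fun y => chartRep x (η - θ) (extChartAt (𝓡 m) x y)
  have hg : ContinuousAt g x :=
    ContinuousAt.comp (g := chartRep x (η - θ)) (f := extChartAt (𝓡 m) x)
      (isSmoothForm_iff.1 (hη.sub hθ) x _ (mem_extChartAt_target x)).continuousAt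
      (continuousAt_extChartAt x)
  have h0 : ∀ᶠ y in 𝓝[U] x, g y = 0 := by
    filter_upwards [self_mem_nhdsWithin,
      mem_nhdsWithin_of_mem_nhds (source_mem_nhds (mem_extChartAt_source (I := 𝓡 m) x))]
      with y hy hys
    refine chartRep_zero_of ?_
    rw [(extChartAt (𝓡 m) x).left_inv hys]
    exact sub_eq_zero.2 (h y hy)
  have hne : (𝓝[U] x).NeBot := mem_closure_iff_nhdsWithin_neBot.1 hx
  have h1 : g x = 0 := tendsto_nhds_unique (hg.mono_left nhdsWithin_le_nhds)
    (tendsto_const_nhds.congr' (h0.mono fun y hy => hy.symm))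
  have h2 := eq_chartRep (η - θ) x
  exact sub_eq_zero.1 (h2.trans h1)

/-! ### Integrals of Lie derivatives over closed submanifolds. -/

section Integrals

variable [T2Space Y] [CompactSpace Y] {μ : DForm k k Y} (hμ : IsSmoothForm μ) (hμ0 : ∀ y, μ y ≠ 0)
include hμ hμ0

lemma formIntegral_sub {η θ : DForm k k Y} (hη : IsSmoothForm η) (hθ : IsSmoothForm θ) :
    formIntegral μ (η - θ) = formIntegral μ η - formIntegral μ θ := by
  refine eq_sub_of_add_eq ?_
  rw [← formIntegral_add hμ hμ0 (hη.sub hθ) hθ, sub_add_cancel]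

/-- `£_v η` and `i_v dη` have the same integral over a closed submanifold. -/
lemma formIntegral_pullback_lieForm {f : Y → X} (hf : ContMDiff (𝓡 k) (𝓡 m) ∞ f)
    {v : RawVF m X} (hv : SmoothRawCurve fun _ => v) {η : DForm m k X} (hη : IsSmoothForm η) :
    formIntegral μ (pullback f (lieForm v η)) =
      formIntegral μ (pullback f (intProd v (extD η))) := by
  cases k with
  -- On functions `lieForm` is `i_v d` by definition, so a zero-dimensional cut needs no Stokes
  -- theorem.
  | zero => rfl
  | succ k =>
    have h1 := hη.intProd hv
    change formIntegral μ (pullback f (CovPhase.intProd v (extD η)) +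
      pullback f (extD (CovPhase.intProd v η))) = _
    rw [formIntegral_add hμ hμ0 ((hη.extD.intProd hv).pullback hf) (h1.extD.pullback hf),
      ← h1.extD_pullback hf, formIntegral_extD_eq_zero hμ hμ0 (h1.pullback hf), add_zero]

end Integrals

end FormAlgebra
end CovPhase
end

noncomputable section

namespace CovPhase

/-! ### The charge density and its variation -/

namespace FieldSpace

variable {m k p : ℕ} {M : Type*} [TopologicalSpace M] [ChartedSpace (Mod m) M]
  [IsManifold (𝓡 m) ∞ M] {N : Type*} [TopologicalSpace N] [ChartedSpace (Mod k) N]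
  [IsManifold (𝓡 k) ∞ N] {ι : Type*} {r s : ι → ℕ} {F : FieldSpace m M r s}
  {φ χ : Fields m M r s} {i : N → M} {ζ : Fields m M r s → VF m M}

lemma isSmoothForm_delta {α : Fields m M r s → DForm k p N}
    (hα : IsSmoothMap (fieldCurves m M r s) (formCurves k p N) F.configs α)
    (hφ : φ ∈ F.configs) (hχ : χ ∈ F.variations) : IsSmoothForm (F.delta α φ χ) := by
  obtain ⟨c, hc, hD, h0, hv⟩ := F.exists_curve φ hφ χ hχ
  exact isSmoothForm_velocity (hα.1 c hc hD) (hasVariation_delta hφ hα χ c hc hD h0 hv)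

lemma delta_add {α α' : Fields m M r s → DForm k p N}
    (hα : IsSmoothMap (fieldCurves m M r s) (formCurves k p N) F.configs α)
    (hα' : IsSmoothMap (fieldCurves m M r s) (formCurves k p N) F.configs α')
    (hφ : φ ∈ F.configs) (hχ : χ ∈ F.variations) :
    F.delta (fun ψ => α ψ + α' ψ) φ χ = F.delta α φ χ + F.delta α' φ χ :=
  delta_eq hφ hχ fun c hc hD h0 hv => SmoothFormCurve.velocity_add
    (hasVariation_delta hφ hα χ c hc hD h0 hv) (hasVariation_delta hφ hα' χ c hc hD h0 hv)

lemma delta_sub {α α' : Fields m M r s → DForm k p N}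
    (hα : IsSmoothMap (fieldCurves m M r s) (formCurves k p N) F.configs α)
    (hα' : IsSmoothMap (fieldCurves m M r s) (formCurves k p N) F.configs α')
    (hφ : φ ∈ F.configs) (hχ : χ ∈ F.variations) :
    F.delta (fun ψ => α ψ - α' ψ) φ χ = F.delta α φ χ - F.delta α' φ χ :=
  delta_eq hφ hχ fun c hc hD h0 hv => SmoothFormCurve.velocity_sub
    (hasVariation_delta hφ hα χ c hc hD h0 hv) (hasVariation_delta hφ hα' χ c hc hD h0 hv)

lemma delta_pullback {f : N → M} {α : Fields m M r s → DForm m p M}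
    (hα : IsSmoothMap (fieldCurves m M r s) (formCurves m p M) F.configs α)
    (hφ : φ ∈ F.configs) (hχ : χ ∈ F.variations) :
    F.delta (fun ψ => pullback (k := k) f (α ψ)) φ χ = pullback f (F.delta α φ χ) :=
  delta_eq hφ hχ fun c hc hD h0 hv => SmoothFormCurve.velocity_pullback
    (hasVariation_delta hφ hα χ c hc hD h0 hv) f

lemma isFieldDepVF_const (v : VF m M) : F.IsFieldDepVF fun _ => v :=
  ⟨fun _ _ _ => vfCurves_const v, fun _ _ _ => ⟨0, fun _ _ _ _ _ x => hasDerivAt_const (0 : ℝ) (show Mod m from v x)⟩⟩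

variable (hi : Manifold.IsImmersion (𝓡 k) (𝓡 m) ∞ i) (hζ : F.IsFieldDepVF ζ)
  (hζN : ∀ φ ∈ F.configs, IsTangent (k := k) i (ζ φ))
include hi hζ hζN

lemma isTangent_deltaVF (hφ : φ ∈ F.configs) (hχ : χ ∈ F.variations) :
    IsTangent (k := k) i (F.deltaVF ζ φ χ) := by
  obtain ⟨c, hc, hD, h0, hv⟩ := F.exists_curve φ hφ χ hχ
  exact (hasDerivAt_restrict hi (hζ.hasVariation hφ χ c hc hD h0 hv) fun t => hζN _ (hD t)).1

/-- The Leibniz rule for a contraction with a field-dependent tangent vector field;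
`hasDerivAt_restrict` says that restriction commutes with the variation. -/
lemma isSmoothMap_intProd_restrict {α : Fields m M r s → DForm k (p + 1) N}
    (hα : IsSmoothMap (fieldCurves m M r s) (formCurves k (p + 1) N) F.configs α) :
    IsSmoothMap (fieldCurves m M r s) (formCurves k p N) F.configs
        (fun ψ => intProd (restrict i (ζ ψ)) (α ψ)) ∧
      ∀ φ ∈ F.configs, ∀ χ ∈ F.variations,
        F.delta (fun ψ => intProd (restrict i (ζ ψ)) (α ψ)) φ χ =
          intProd (restrict i (ζ φ)) (F.delta α φ χ) +
            intProd (restrict i (F.deltaVF ζ φ χ)) (α φ) := by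
  have key : ∀ φ ∈ F.configs, ∀ χ, HasVariation (fieldCurves m M r s) (formCurves k p N) F.configs
      (fun ψ => intProd (restrict i (ζ ψ)) (α ψ)) φ χ
      (intProd (restrict i (ζ φ)) (F.delta α φ χ) +
        intProd (restrict i (F.deltaVF ζ φ χ)) (α φ)) := by
    intro φ hφ χ c hc hD h0 hv
    have h := SmoothFormCurve.velocity_intProd (hasVariation_delta hφ hα χ c hc hD h0 hv)
      (v := fun t => restrict i (ζ (c t)))
      (hasDerivAt_restrict hi (hζ.hasVariation hφ χ c hc hD h0 hv) fun t => hζN _ (hD t)).2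
    rw [h0] at h
    exact h
  refine ⟨⟨fun c hc hD => ?_, fun φ hφ χ => ⟨_, key φ hφ χ⟩⟩, fun φ hφ χ hχ =>
    delta_eq hφ hχ (key φ hφ χ)⟩
  exact SmoothFormCurve.intProd (smoothRawCurve_restrict hi (vfCurves_smooth_iff.1 (hζ.1 c hc hD))
    fun t => hζN _ (hD t)) (hα.1 c hc hD)

end FieldSpace

/-! ### The density in terms of `ℓ' + b'` and `β' - λ'`, its variation, and the flux. -/

namespace Functionals

open FieldSpace

variable {n : ℕ} {M : Type*} [TopologicalSpace M] [ChartedSpace (Mod (n + 2)) M]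
  [IsManifold (𝓡 (n + 2)) ∞ M] [T2Space M] {N : Type*} [TopologicalSpace N]
  [ChartedSpace (Mod (n + 1)) N] [IsManifold (𝓡 (n + 1)) ∞ N]
  {ι : Type*} {r s : ι → ℕ} {T : Functionals n M N r s} {F : FieldSpace (n + 2) M r s}
  {U : Set M} {i : N → M} {φ χ : Fields (n + 2) M r s} {v w : VF (n + 2) M}
  {ξ ζ : Fields (n + 2) M r s → VF (n + 2) M}

variable (T i) in
/-- The boundary Lagrangian `ℓ' + b'` on the hypersurface. -/
def bdryL (φ : Fields (n + 2) M r s) : DForm (n + 1) (n + 1) N := T.ell φ + pullback i (T.b φ)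

variable (T i) in
/-- The corner term `β' - λ'` on the hypersurface. -/
def corner (φ χ : Fields (n + 2) M r s) : DForm (n + 1) n N := T.β φ χ - pullback i (T.lam φ χ)

/-- Tangency lets `i_v b'` pass through the pullback and join `i_v ℓ'`, while `λ'` joins `β'`. Only
the combinations whose anomalies occur in the extension and in the flux remain. -/
lemma density_eq (hv : IsTangent (k := n + 1) i v) : T.density i φ v =
    pullback i (T.Qvc φ v) + intProd (restrict i v) (T.bdryL i φ) -
      T.corner i φ (fieldLie v φ) := by
  have h := pullback_intProd hv (T.b φ)
  have h' : T.density i φ v = pullback i (T.Qvc φ v) +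
      pullback i (intProd (fun x => v x) (T.b φ)) + pullback i (T.lam φ (fieldLie v φ)) +
      intProd (restrict i v) (T.ell φ) - T.β φ (fieldLie v φ) := rfl
  rw [h', h, bdryL, corner, intProd_add]
  abel

variable (hT : T.IsCovariantPhaseSpace F U i)
include hT

lemma isSmoothMap_Qvc (hζ : F.IsFieldDepVF ζ) : IsSmoothMap (fieldCurves (n + 2) M r s)
    (formCurves (n + 2) n M) F.configs fun ψ => T.Qvc ψ (ζ ψ) := by
  refine ⟨fun c hc hD => hT.smooth_Qvc.1 (fun t => (c t, ζ (c t))) ⟨hc, hζ.1 c hc hD⟩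
    fun t => ⟨hD t, Set.mem_univ _⟩, fun φ hφ χ => ?_⟩
  obtain ⟨w, hw⟩ := hT.smooth_Qvc.2 (φ, ζ φ) ⟨hφ, Set.mem_univ _⟩ (χ, F.deltaVF ζ φ χ)
  exact ⟨w, fun c hc hD h0 hv => hw (fun t => (c t, ζ (c t))) ⟨hc, hζ.1 c hc hD⟩
    (fun t => ⟨hD t, Set.mem_univ _⟩) (Prod.ext h0 (congrArg ζ h0))
    ⟨hv, hζ.hasVariation hφ χ c hc hD h0 hv⟩⟩

variable (hi : Manifold.IsImmersion (𝓡 (n + 1)) (𝓡 (n + 2)) ∞ i)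
include hi

lemma isSmoothMap_bdryL : IsSmoothMap (fieldCurves (n + 2) M r s) (formCurves (n + 1) (n + 1) N)
    F.configs (T.bdryL i) :=
  hT.smooth_ell.1.form_add (hT.smooth_b.1.form_pullback hi.contMDiff)

lemma isOneForm_corner : F.IsOneForm (T.corner i) :=
  hT.smooth_β.sub (hT.smooth_lam.pullback hi.contMDiff)

lemma density_add (hφ : φ ∈ F.configs) (hv : IsTangent (k := n + 1) i v)
    (hw : IsTangent (k := n + 1) i w) :
    T.density i φ (v + w) = T.density i φ v + T.density i φ w := by
  have hm := F.configs_subset φ hφ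
  rw [density_eq hv, density_eq hw, density_eq (hv.add hw), hT.Qvc_add φ hφ, pullback_add,
    restrict_add hi hv hw, intProd_add_left, fieldLie_add_left,
    (isOneForm_corner hT hi).1 φ hφ _ (F.lie_mem _ _ hm) _ (F.lie_mem _ _ hm)]
  abel

lemma density_sub (hφ : φ ∈ F.configs) (hv : IsTangent (k := n + 1) i v)
    (hw : IsTangent (k := n + 1) i w) :
    T.density i φ (v - w) = T.density i φ v - T.density i φ w := by
  refine eq_sub_of_add_eq ?_
  rw [← density_add hT hi hφ (hv.sub hw) hw, sub_add_cancel]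

lemma isSmoothForm_density (hφ : φ ∈ F.configs) (hv : IsTangent (k := n + 1) i v) :
    IsSmoothForm (T.density i φ v) := by
  rw [density_eq hv]
  have hQ := isSmoothForm_of_isSmoothMap hφ (isSmoothMap_Qvc hT (isFieldDepVF_const v))
  exact ((hQ.pullback hi.contMDiff).add ((isSmoothForm_of_isSmoothMap hφ
    (isSmoothMap_bdryL hT hi)).intProd (smoothRawCurve_restrict hi (smoothRawCurve_const v)
      fun _ => hv))).sub ((isOneForm_corner hT hi).isSmoothForm hφ
        (F.lie_mem _ _ (F.configs_subset φ hφ)))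

/-- The variation of the charge density. -/
lemma delta_density (hζ : F.IsFieldDepVF ζ)
    (hζN : ∀ φ ∈ F.configs, IsTangent (k := n + 1) i (ζ φ)) :
    IsSmoothMap (fieldCurves (n + 2) M r s) (formCurves (n + 1) n N) F.configs
        (fun ψ => T.density i ψ (ζ ψ)) ∧
      ∀ φ ∈ F.configs, ∀ χ ∈ F.variations,
        F.delta (fun ψ => T.density i ψ (ζ ψ)) φ χ =
          pullback i (F.delta (fun ψ => T.Qvc ψ (ζ ψ)) φ χ) +
            (intProd (restrict i (ζ φ)) (F.delta (T.bdryL i) φ χ) +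
              intProd (restrict i (F.deltaVF ζ φ χ)) (T.bdryL i φ)) -
            F.delta (fun ψ => T.corner i ψ (hat ζ ψ)) φ χ := by
  have hQ := isSmoothMap_Qvc hT hζ
  have hQ' := hQ.form_pullback hi.contMDiff
  obtain ⟨hL, hL'⟩ := isSmoothMap_intProd_restrict hi hζ hζN (isSmoothMap_bdryL hT hi)
  have hC := (isOneForm_corner hT hi).isSmoothMap_hat hζ
  -- The rearranged density is available only where `ζ` is tangent, that is on configurations, so it
  -- is substituted along curves of configurations.
  have hcurve : ∀ c : ℝ → Fields (n + 2) M r s, (∀ t, c t ∈ F.configs) →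
      (fun t => T.density i (c t) (ζ (c t))) = fun t => pullback i (T.Qvc (c t) (ζ (c t))) +
        intProd (restrict i (ζ (c t))) (T.bdryL i (c t)) - T.corner i (c t) (hat ζ (c t)) :=
    fun c hD => funext fun t => density_eq (hζN _ (hD t))
  have hS := (hQ'.form_add hL).form_sub hC
  have key : ∀ φ ∈ F.configs, ∀ χ, HasVariation (fieldCurves (n + 2) M r s)
      (formCurves (n + 1) n N) F.configs (fun ψ => T.density i ψ (ζ ψ)) φ χ
      (F.delta (fun ψ => pullback i (T.Qvc ψ (ζ ψ)) +
        intProd (restrict i (ζ ψ)) (T.bdryL i ψ) - T.corner i ψ (hat ζ ψ)) φ χ) := by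
    intro φ hφ χ c hc hD h0 hv
    rw [hcurve c hD]
    exact hasVariation_delta hφ hS χ c hc hD h0 hv
  refine ⟨⟨fun c hc hD => ?_, fun φ hφ χ => ⟨_, key φ hφ χ⟩⟩, fun φ hφ χ hχ => ?_⟩
  · rw [hcurve c hD]
    exact hS.1 c hc hD
  · rw [delta_eq hφ hχ (key φ hφ χ), delta_sub (hQ'.form_add hL) hC hφ hχ,
      delta_add hQ' hL hφ hχ, delta_pullback hQ hφ hχ, hL' φ hφ χ hχ]

/-- The variation of the charge density along `ξ̂`. -/
lemma delta_density_hat (hξ : F.IsFieldDepVF ξ) (hζ : F.IsFieldDepVF ζ)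
    (hξN : ∀ φ ∈ F.configs, IsTangent (k := n + 1) i (ξ φ))
    (hζN : ∀ φ ∈ F.configs, IsTangent (k := n + 1) i (ζ φ)) (hφ : φ ∈ F.configs) :
    F.delta (fun ψ => T.density i ψ (ζ ψ)) φ (hat ξ φ) =
      lieForm (restrict i (ξ φ)) (T.density i φ (ζ φ)) + T.density i φ (F.anomalyVF ξ ζ φ) +
        intProd (restrict i (ζ φ)) (F.anomalyZero (restrict i) ξ (T.bdryL i) φ) -
        F.anomalyOne (restrict i) ξ (T.corner i) φ (hat ζ φ) := by
  have hx := hat_mem hφ ξ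
  have htδ := isTangent_deltaVF hi hζ hζN hφ hx
  obtain ⟨htb, hb⟩ := restrict_bracket hi (hξN φ hφ) (hζN φ hφ)
  have hta : IsTangent (k := n + 1) i (F.anomalyVF ξ ζ φ) := htδ.sub htb
  have hrξ := smoothRawCurve_restrict hi (smoothRawCurve_const (ξ φ)) fun _ => hξN φ hφ
  have hrζ := smoothRawCurve_restrict hi (smoothRawCurve_const (ζ φ)) fun _ => hζN φ hφ
  have hω := isSmoothForm_of_isSmoothMap hφ (isSmoothMap_bdryL hT hi)
  have hQs := isSmoothForm_of_isSmoothMap hφ (isSmoothMap_Qvc hT hζ)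
  have hC := isOneForm_corner hT hi
  have hCs := hC.isSmoothForm hφ (hat_mem hφ ζ)
  have hQ : F.delta (fun ψ => T.Qvc ψ (ζ ψ)) φ (hat ξ φ) =
      T.Qvc φ (F.anomalyVF ξ ζ φ) + lieForm (fun x => ξ φ x) (T.Qvc φ (ζ φ)) :=
    eq_add_of_sub_eq (hT.anomaly_Qvc ξ hξ ζ hζ φ hφ)
  have hωδ : F.delta (T.bdryL i) φ (hat ξ φ) = F.anomalyZero (restrict i) ξ (T.bdryL i) φ +
      lieForm (restrict i (ξ φ)) (T.bdryL i φ) := (sub_add_cancel _ _).symm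
  -- Varying `C(ζ̂)` produces the anomaly of `C`, the anomaly of `ζ` and a Lie derivative; the last
  -- two match the corresponding terms of `Q^vc` and of `i_ζ ω`.
  have hCδ : F.delta (fun ψ => T.corner i ψ (hat ζ ψ)) φ (hat ξ φ) =
      F.anomalyOne (restrict i) ξ (T.corner i) φ (hat ζ φ) +
        T.corner i φ (fieldLie (F.anomalyVF ξ ζ φ) φ) +
        lieForm (restrict i (ξ φ)) (T.corner i φ (hat ζ φ)) := by
    rw [hC.anomalyOne_hat (restrict i) hξ hζ hφ, sub_add_cancel]
    exact (sub_add_cancel _ _).symm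
  -- The bracket separated here is the one produced by moving `£_ξ` past `i_ζ`.
  have hr : restrict (k := n + 1) i (F.deltaVF ζ φ (hat ξ φ)) =
      restrict i (F.anomalyVF ξ ζ φ) +
        VectorField.mlieBracket (𝓡 (n + 1)) (restrict i (ξ φ)) (restrict i (ζ φ)) := by
    rw [← hb, ← restrict_add hi hta htb]
    exact congrArg _ (sub_add_cancel _ _).symm
  have hl : lieForm (restrict (k := n + 1) i (ξ φ)) (T.density i φ (ζ φ)) =
      lieForm (restrict i (ξ φ)) (pullback i (T.Qvc φ (ζ φ))) +
        lieForm (restrict i (ξ φ)) (intProd (restrict i (ζ φ)) (T.bdryL i φ)) -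
        lieForm (restrict i (ξ φ)) (T.corner i φ (hat ζ φ)) := by
    rw [density_eq (hζN φ hφ), ← lieForm_add hrξ (hQs.pullback hi.contMDiff) (hω.intProd hrζ)]
    exact lieForm_sub hrξ ((hQs.pullback hi.contMDiff).add (hω.intProd hrζ)) hCs
  rw [(delta_density hT hi hζ hζN).2 φ hφ _ hx, hQ, hωδ, hCδ, hr, hl, density_eq hta,
    pullback_add, pullback_lieForm hi.contMDiff (hξN φ hφ) hQs, intProd_add, intProd_add_left,
    lieForm_intProd hrξ hrζ hω]
  abel

/-- On solutions, the flux of `ζ̂` is `dh_ζ` up to the anomaly of the boundary Lagrangian. -/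
lemma flux_eq (hU : Set.range i ⊆ closure U) (hφ : φ ∈ T.solutions F U)
    (hζN : IsTangent (k := n + 1) i (ζ φ)) :
    T.flux φ (hat ζ φ) = extD (T.density i φ (ζ φ)) +
      F.anomalyZero (restrict i) ζ (T.bdryL i) φ := by
  have hc := hφ.1
  have hz := hat_mem hc ζ
  have hi' := hi.contMDiff
  have hrζ := smoothRawCurve_restrict hi (smoothRawCurve_const (ζ φ)) fun _ => hζN
  have hω := isSmoothForm_of_isSmoothMap hc (isSmoothMap_bdryL hT hi)
  have hQs := isSmoothForm_of_isSmoothMap hc (isSmoothMap_Qvc hT (isFieldDepVF_const (ζ φ)))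
  have hC := isOneForm_corner hT hi
  have hlam := hT.smooth_lam.isSmoothForm hc hz
  have hLs := isSmoothForm_of_isSmoothMap hc hT.smooth_L.1
  have hbs := isSmoothForm_of_isSmoothMap hc hT.smooth_b.1
  have hJ : IsSmoothForm (T.Jvc F φ (ζ φ)) :=
    (((hT.smooth_θ.isSmoothForm hc hz).sub (isSmoothForm_delta hT.smooth_b.1 hc hz)).sub
      hlam.extD).sub ((hLs.sub hbs.extD).intProd (smoothRawCurve_const (ζ φ)))
  -- The Noether identity is given in `U` only; both sides are smooth forms and `N` lies in the
  -- closure of `U`.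
  have h1 : pullback (k := n + 1) i (T.Jvc F φ (ζ φ)) = pullback i (extD (T.Qvc φ (ζ φ))) :=
    pullback_congr fun y => eqOn_closure_of_isSmoothForm hJ hQs.extD
      (fun x hx => hT.noether φ hφ (ζ φ) x hx) (hU ⟨y, rfl⟩)
  -- Since `ζ` is tangent, the pullback of `i_ζ L^c` is the contraction of the pullback of `L^c`, an
  -- `(n + 2)`-form on an `(n + 1)`-manifold.
  have h2 : pullback (k := n + 1) i (T.Jvc F φ (ζ φ)) = pullback i (T.θ φ (hat ζ φ)) -
      pullback i (F.delta T.b φ (hat ζ φ)) - pullback i (extD (T.lam φ (hat ζ φ))) := by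
    have h3 := pullback_intProd hζN (T.covL φ)
    rw [form_eq_zero (pullback i (T.covL φ)), intProd_zero] at h3
    exact (congrArg (fun η => pullback i (T.covθ F φ (hat ζ φ)) - η) h3).trans (sub_zero _)
  have h4 : F.delta (T.bdryL i) φ (hat ζ φ) =
      F.delta T.ell φ (hat ζ φ) + pullback i (F.delta T.b φ (hat ζ φ)) := by
    rw [← delta_pullback hT.smooth_b.1 hc hz]
    exact delta_add hT.smooth_ell.1 (hT.smooth_b.1.form_pullback hi') hc hz
  -- Cartan's formula on a top-degree form has only its second term.
  have h5 : lieForm (restrict (k := n + 1) i (ζ φ)) (T.bdryL i φ) =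
      extD (intProd (restrict i (ζ φ)) (T.bdryL i φ)) := by
    change intProd _ (extD (T.bdryL i φ)) + _ = _
    rw [form_eq_zero (extD (T.bdryL i φ)), intProd_zero, zero_add]
  have h6 : extD (T.density i φ (ζ φ)) = pullback i (extD (T.Qvc φ (ζ φ))) +
      extD (intProd (restrict i (ζ φ)) (T.bdryL i φ)) -
      (extD (T.β φ (hat ζ φ)) - pullback i (extD (T.lam φ (hat ζ φ)))) := by
    rw [← hQs.extD_pullback hi', ← hlam.extD_pullback hi',
      ← extD_sub (hT.smooth_β.isSmoothForm hc hz) (hlam.pullback hi'),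
      ← extD_add (hQs.pullback hi') (hω.intProd hrζ), density_eq hζN]
    exact extD_sub ((hQs.pullback hi').add (hω.intProd hrζ)) (hC.isSmoothForm hc hz)
  rw [anomalyZero, lieZero, h4, h5, h6, ← h1, h2, hT.decomposition φ hφ _ hz]
  abel

end Functionals
end CovPhase
end

noncomputable section

namespace CovPhase

/-! ### The charge representation theorem -/

namespace Functionals

open FieldSpace

variable {n : ℕ} {M : Type*} [TopologicalSpace M] [ChartedSpace (Mod (n + 2)) M]
  [IsManifold (𝓡 (n + 2)) ∞ M] [T2Space M] {N : Type*} [TopologicalSpace N]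
  [ChartedSpace (Mod (n + 1)) N] [IsManifold (𝓡 (n + 1)) ∞ N]
  {S : Type*} [TopologicalSpace S] [ChartedSpace (Mod n) S] [IsManifold (𝓡 n) ∞ S]
  [T2Space S] [CompactSpace S] {j : S → N} {μ : DForm n n S}
  {ι : Type*} {r s : ι → ℕ} {T : Functionals n M N r s} {F : FieldSpace (n + 2) M r s}
  {U : Set M} {i : N → M} {φ : Fields (n + 2) M r s}
  {ξ ζ : Fields (n + 2) M r s → VF (n + 2) M}

variable (hT : T.IsCovariantPhaseSpace F U i)
  (hi : Manifold.IsImmersion (𝓡 (n + 1)) (𝓡 (n + 2)) ∞ i)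
  (hj : ContMDiff (𝓡 n) (𝓡 (n + 1)) ∞ j) (hμ : IsSmoothForm μ) (hμ0 : ∀ x, μ x ≠ 0)
include hT hi hj hμ hμ0

lemma hasVariation_charge (hζ : F.IsFieldDepVF ζ)
    (hζN : ∀ φ ∈ F.configs, IsTangent (k := n + 1) i (ζ φ)) (hφ : φ ∈ F.configs)
    (χ : Fields (n + 2) M r s) :
    HasVariation (fieldCurves (n + 2) M r s) realCurves F.configs (T.charge i j μ ζ) φ χ
      (formIntegral μ (pullback j (F.delta (fun ψ => T.density i ψ (ζ ψ)) φ χ))) := by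
  intro c hc hD h0 hv
  have h := (delta_density hT hi hζ hζN).1
  exact hasDerivAt_formIntegral hμ hμ0 (SmoothFormCurve.pullback hj (h.1 c hc hD))
    (SmoothFormCurve.velocity_pullback (hasVariation_delta hφ h χ c hc hD h0 hv) j)

/-- `{H_ξ, H_ζ} = H_⟦ξ, ζ⟧ + K_{ξ,ζ}` on solutions. -/
theorem bracketBT_eq (hU : Set.range i ⊆ closure U) (hξ : F.IsFieldDepVF ξ)
    (hζ : F.IsFieldDepVF ζ) (hξN : ∀ φ ∈ F.configs, IsTangent (k := n + 1) i (ξ φ))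
    (hζN : ∀ φ ∈ F.configs, IsTangent (k := n + 1) i (ζ φ)) (hφ : φ ∈ T.solutions F U) :
    T.bracketBT F i j μ ξ ζ φ =
      T.charge i j μ (F.brmod ξ ζ) φ + T.extension F i j μ ξ ζ φ := by
  have hc := hφ.1
  have hx := hat_mem hc ξ
  have hz := hat_mem hc ζ
  have hrξ := smoothRawCurve_restrict hi (smoothRawCurve_const (ξ φ)) fun _ => hξN φ hc
  have hrζ := smoothRawCurve_restrict hi (smoothRawCurve_const (ζ φ)) fun _ => hζN φ hc
  have hta : IsTangent (k := n + 1) i (F.anomalyVF ξ ζ φ) :=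
    (isTangent_deltaVF hi hζ hζN hc hx).sub (restrict_bracket hi (hξN φ hc) (hζN φ hc)).1
  have htδ := isTangent_deltaVF hi hξ hξN hc hz
  have hL := isSmoothMap_bdryL hT hi
  have hω := isSmoothForm_of_isSmoothMap hc hL
  have hh := isSmoothForm_density hT hi hc (hζN φ hc)
  have hδh : IsSmoothForm (F.delta (fun ψ => T.density i ψ (ζ ψ)) φ (hat ξ φ)) :=
    isSmoothForm_delta (delta_density hT hi hζ hζN).1 hc hx
  -- The modified bracket is exactly the difference between the argument of `h_δξ` in the flux and
  -- that of the anomalous density in `δh_ζ`.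
  have hbr : F.brmod ξ ζ φ = F.deltaVF ξ φ (hat ζ φ) - F.anomalyVF ξ ζ φ := by
    rw [brmod, anomalyVF]
    abel
  let K : DForm (n + 1) n N :=
    intProd (restrict i (ξ φ)) (F.anomalyZero (restrict i) ζ (T.bdryL i) φ) -
      intProd (restrict i (ζ φ)) (F.anomalyZero (restrict i) ξ (T.bdryL i) φ)
  have hK : IsSmoothForm K :=
    (((isSmoothForm_delta hL hc hz).sub (hω.lieForm hrζ)).intProd hrξ).sub
      (((isSmoothForm_delta hL hc hx).sub (hω.lieForm hrξ)).intProd hrζ)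
  have hB := isSmoothForm_density hT hi hc (htδ.sub hta)
  have hlie := hh.lieForm hrξ
  have hint := hh.extD.intProd hrξ
  -- The theorem before integration: the anomaly of the corner term occurs in both the flux and
  -- `δh_ζ`, and the last bracket has zero integral over the cut.
  have hflux : intProd (restrict i (ξ φ)) (T.flux φ (hat ζ φ)) -
      F.anomalyOne (restrict i) ξ (T.corner i) φ (hat ζ φ) +
      T.density i φ (F.deltaVF ξ φ (hat ζ φ)) =
      F.delta (fun ψ => T.density i ψ (ζ ψ)) φ (hat ξ φ) +
        ((T.density i φ (F.deltaVF ξ φ (hat ζ φ) - F.anomalyVF ξ ζ φ) + K) +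
          (intProd (restrict i (ξ φ)) (extD (T.density i φ (ζ φ))) -
            lieForm (restrict i (ξ φ)) (T.density i φ (ζ φ)))) := by
    rw [delta_density_hat hT hi hξ hζ hξN hζN hc, flux_eq hT hi hU hφ (hζN φ hc),
      density_sub hT hi hc htδ hta, intProd_add]
    simp only [K]
    abel
  have hF : T.totalFlux F i j μ ξ φ (hat ζ φ) =
      formIntegral μ (pullback j (F.delta (fun ψ => T.density i ψ (ζ ψ)) φ (hat ξ φ))) +
        ((T.charge i j μ (F.brmod ξ ζ) φ + T.extension F i j μ ξ ζ φ) + 0) := by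
    have h1 : T.extension F i j μ ξ ζ φ = formIntegral μ (pullback j K) := rfl
    have h2 : T.totalFlux F i j μ ξ φ (hat ζ φ) = formIntegral μ (pullback j
        (intProd (restrict i (ξ φ)) (T.flux φ (hat ζ φ)) -
          F.anomalyOne (restrict i) ξ (T.corner i) φ (hat ζ φ) +
          T.density i φ (F.deltaVF ξ φ (hat ζ φ)))) := rfl
    -- The summand `0` is replaced by the vanishing difference between the integrals of `i_ξ dh_ζ`
    -- and `£_ξ h_ζ`, after which all terms on the right are collected into one integral.
    rw [h2, hflux, h1, charge, hbr, ← sub_eq_zero.2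
        (formIntegral_pullback_lieForm hμ hμ0 hj hrξ hh).symm,
      ← formIntegral_sub hμ hμ0 (hint.pullback hj) (hlie.pullback hj), ← pullback_sub,
      ← formIntegral_add hμ hμ0 (hB.pullback hj) (hK.pullback hj), ← pullback_add,
      ← formIntegral_add hμ hμ0 ((hB.add hK).pullback hj) ((hint.sub hlie).pullback hj),
      ← pullback_add, ← formIntegral_add hμ hμ0 (hδh.pullback hj)
        (((hB.add hK).add (hint.sub hlie)).pullback hj), ← pullback_add]
  rw [bracketBT, hF, deltaReal_eq hc hx (hasVariation_charge hT hi hj hμ hμ0 hζ hζN hc _)]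
  ring

end Functionals
end CovPhase
end

theorem mainTheorem5 {n : ℕ}
    -- spacetime, the bounding hypersurface, and the cut, with their dimensions
    {M : Type*} [TopologicalSpace M] [ChartedSpace (CovPhase.Mod (n + 2)) M]
    [IsManifold (𝓡 (n + 2)) ∞ M] [T2Space M] [SigmaCompactSpace M]
    {N : Type*} [TopologicalSpace N] [ChartedSpace (CovPhase.Mod (n + 1)) N]
    [IsManifold (𝓡 (n + 1)) ∞ N] [T2Space N] [SigmaCompactSpace N]
    {S : Type*} [TopologicalSpace S] [ChartedSpace (CovPhase.Mod n) S]
    [IsManifold (𝓡 n) ∞ S] [T2Space S] [CompactSpace S]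
    (U : Set M) (hU : IsOpen U)
    (i : N → M) (hi : Manifold.IsSmoothEmbedding (𝓡 (n + 1)) (𝓡 (n + 2)) ∞ i)
    (hiU : Set.range i ⊆ frontier U)
    (j : S → N) (hj : Manifold.IsSmoothEmbedding (𝓡 n) (𝓡 (n + 1)) ∞ j)
    -- the orientation of the cut
    (μ : CovPhase.DForm n n S) (hμ : CovPhase.IsSmoothForm μ) (hμ0 : ∀ x, μ x ≠ 0)
    -- the fields and the theory
    {ι : Type*} {r s : ι → ℕ} (F : CovPhase.FieldSpace (n + 2) M r s)
    (T : CovPhase.Functionals n M N r s) (hT : T.IsCovariantPhaseSpace F U i)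
    -- field-dependent vector fields tangent to the hypersurface
    (ξ ζ : CovPhase.Fields (n + 2) M r s → CovPhase.VF (n + 2) M)
    (hξ : F.IsFieldDepVF ξ) (hζ : F.IsFieldDepVF ζ)
    (hξN : ∀ φ ∈ F.configs, CovPhase.IsTangent (k := n + 1) i (ξ φ))
    (hζN : ∀ φ ∈ F.configs, CovPhase.IsTangent (k := n + 1) i (ζ φ))
    (φ : CovPhase.Fields (n + 2) M r s) (hφ : φ ∈ T.solutions F U) :
    -- `H_ζ` is differentiable in the direction `ξ̂`, so that its variation is meaningful
    (∃ w : ℝ, CovPhase.HasVariation (CovPhase.fieldCurves (n + 2) M r s) CovPhase.realCurves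
      F.configs (T.charge i j μ ζ) φ (CovPhase.FieldSpace.hat ξ φ) w) ∧
    T.bracketBT F i j μ ξ ζ φ =
      T.charge i j μ (F.brmod ξ ζ) φ + T.extension F i j μ ξ ζ φ := by
  have hii := hi.isImmersion
  have hj' := hj.isImmersion.contMDiff
  have hU' : Set.range i ⊆ closure U := hiU.trans frontier_subset_closure
  exact ⟨⟨_, CovPhase.Functionals.hasVariation_charge hT hii hj' hμ hμ0 hζ hζN hφ.1 _⟩,
    CovPhase.Functionals.bracketBT_eq hT hii hj' hμ hμ0 hU' hξ hζ hξN hζN hφ⟩
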